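/- Let $k_0$ be a Noetherian commutative ring, let $k$ be a field over $k_0$, and let $M_0$ be a quasi-separable formal monoid over $k_0$. That is, $M_0$ is a monoid object $(M_0,i_0,m_0)$ in ind-(finite flat schemes over $k_0$), presented by a cofiltered system $E_0=(E_{0,\alpha})$ of finite flat commutative $k_0$-algebras such that, for every field $K$ over $k_0$, the quotient of $K\otimes_{k_0}E_{0,\alpha}$ by its nilradical is separable (étale) over $K$. Put $E_\alpha=k\otimes_{k_0}E_{0,\alpha}$ and $E=(E_\alpha)$, and let $i:E\to k$ and $m:E\to E\otimes_kE$ be the maps of the base point and the product. Let $\mu$ be an action of $M_0$ on $\operatorname{spec}k$ over $k_0$, given by compatible maps $\mu_\alpha:k\to E_\alpha$. Let $G$ be an $M_0$-group: an affine group scheme over $k$ with an action of $M_0$ lying over $\mu$, such that the group operations are equivariant. Let $A$ be the Hopf algebra of $G$, let $s_\alpha:A\to A\otimes_{k_0}E_{0,\alpha}$ be the maps of the action, and let $\mathrm{Rep}_G$ be the category of finite dimensional representations of $G$, i.e. of finite dimensional $A$-comodules over $k$. **Definitions.** Let $C$ be a $k$-linear tensor category (abelian, finite dimensional Hom spaces,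 objects of finite length, symmetric $k$-bilinear tensor product, duals, $\operatorname{End}(\mathbf 1)=k$). For a finite commutative $k$-algebra $F$, an $F$-module in $C$ is *flat* if $N\mapsto N\otimes_F X$ preserves injective maps of finite $F$-modules $N$, and *injective* if its dual is flat. For $f:F\to F'$, $f^!$ denotes the right adjoint $X\mapsto \mathrm{Hom}_F(F',X)$ of restriction of scalars. $\mathrm{Prolong}_E(C)$ is the category of systems $(X_\alpha)$ of injective $E_\alpha$-modules in $C$ with transition maps $X_\beta\to X_\alpha$, for each transition map $f:E_\alpha\to E_\beta$, inducing $X_\beta\cong f^!X_\alpha$. Its tensor product is computed at each $\alpha$ as the largest subobject of $X_\alpha\otimes Y_\alpha$ on which the two actions of $E_\alpha$ agree; its unit is $p^!(\mathbf 1)=(E_\alpha^\vee)$, for $p:k\to E$. An *$E_0$-structure* on $C$ consists of 1. a $k_0$-linear symmetric tensor functor $\tau:C\to\mathrm{Prolong}_E(C)$, exact as a functor to $E$-modules; 2. a tensor isomorphism $i^!\circ\tau\cong\mathrm{Id}_C$; 3. an $E\otimes_kE$-linear tensor isomorphism $\tau\circ\tau\cong m^!\circ\tau$, where on $\tau_\alpha(\tau_\beta(X))$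 the algebra $E_\beta$ acts by applying $\tau_\alpha$ to its action on $\tau_\beta(X)$, the algebra $E_\alpha$ acts because $\tau_\alpha$ takes values in $E_\alpha$-modules, and the two together give an action of $E_\beta\otimes_kE_\alpha=k\otimes_{k_0}(E_{0,\beta}\otimes_{k_0}E_{0,\alpha})$. An *$E_0$-tensor category* is a $k$-linear tensor category with an $E_0$-structure. **Statement.** $\mathrm{Rep}_G$ is a $k$-linear tensor category. For a representation $X$ with coaction $\rho$, let $\tau_\alpha(X)=E_\alpha^\vee\otimes_{\mu_\alpha}X$, where $E_\alpha^\vee$ is the $k$-linear dual of $E_\alpha$ with its $E_\alpha$-module structure, the tensor product is over $k$ acting on $E_\alpha^\vee$ through $\mu_\alpha$, and the $k$-vector space structure of $\tau_\alpha(X)$ comes from $p:k\to E_\alpha$. The group $G$ acts on $\tau_\alpha(X)$ through the action of $M_0$ on $G$: if $\rho(x)=\sum_j x_j\otimes a_j$ and $s_\alpha(a_j)=\sum_l a_{jl}\otimes d_{jl}$, then $\theta\otimes x\mapsto\sum_{j,l}(d_{jl}\theta\otimes x_j)\otimes a_{jl}$. The transition maps are $\theta\otimes x\mapsto(\theta\circ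 f)\otimes x$. Then the functor $\tau=(\tau_\alpha)$ takes values in $\mathrm{Prolong}_E(\mathrm{Rep}_G)$. It is $k_0$-linear, is exact as a functor to $E$-modules, and is a symmetric tensor functor $\mathrm{Rep}_G\to\mathrm{Prolong}_E(\mathrm{Rep}_G)$; there is a tensor isomorphism $i^!\tau(V)\cong V$, and there is an $E\otimes_kE$-linear tensor isomorphism $\tau\circ\tau\to m^!\circ\tau$. Thus $\tau$ is part of an $E_0$-structure on $\mathrm{Rep}_G$, which makes $\mathrm{Rep}_G$ an $E_0$-tensor category. -/

import Mathlib

open CategoryTheory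

universe u

namespace OpTensor

section Monoids
open scoped TensorProduct

/-- A finite algebra `A` over a field `K` is quasi-separable if its reduction is separable
(for finite commutative algebras over a field: étale) over `K`. -/
def QuasiSeparableAlg (K A : Type u) [Field K] [CommRing A] [Algebra K A] : Prop :=
  Module.Finite K A ∧ Algebra.Etale K (A ⧸ nilradical A)

/-- A quasi-separable formal set over `spec k₀`, presented by its pro-finite algebra `E₀`: a small
cofiltered system of finite flat commutative `k₀`-algebras, all of whose fibres over fields are
quasi-separable. -/
structure ProFiniteAlg (k₀ : Type u) [CommRing k₀] where
  I : Type u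
  [cat : SmallCategory I]
  [cofiltered : IsCofiltered I]
  alg : I ⥤ CommAlgCat.{u} k₀
  finite (α : I) : Module.Finite k₀ (alg.obj α)
  flat (α : I) : Module.Flat k₀ (alg.obj α)
  quasiSeparable (α : I) (K : Type u) [Field K] [Algebra k₀ K] :
    QuasiSeparableAlg K (K ⊗[k₀] alg.obj α)

attribute [instance] ProFiniteAlg.cat ProFiniteAlg.cofiltered

namespace ProFiniteAlg
variable {k₀ : Type u} [CommRing k₀] (P : ProFiniteAlg k₀)

/-- The algebra `E₀,α` at the index `α`. -/
abbrev E (α : P.I) : Type u := P.alg.obj α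

/-- The transition map `E₀,α → E₀,β`. -/
abbrev res {α β : P.I} (f : α ⟶ β) : P.E α →ₐ[k₀] P.E β := (P.alg.map f).hom

/-- Two algebra maps `E₀,α → B` and `E₀,β → B` represent the same point `spec B → M₀` of the formal
set, that is, the same element of `colim Hom(E₀,α, B)`. -/
def SameHom {α β : P.I} {B : Type u} [CommRing B] [Algebra k₀ B]
    (φ : P.E α →ₐ[k₀] B) (ψ : P.E β →ₐ[k₀] B) : Prop :=
  ∃ (γ : P.I) (f : γ ⟶ α) (g : γ ⟶ β), φ.comp (P.res f) = ψ.comp (P.res g)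

variable (k : Type u) [Field k] [Algebra k₀ k]

/-- The algebra `E_α = k ⊗ E₀,α` of the base change of the formal set to `spec k`. -/
abbrev base (α : P.I) : Type u := k ⊗[k₀] P.E α

/-- The transition map `E_α → E_β`. -/
abbrev baseRes {α β : P.I} (f : α ⟶ β) : P.base k α →ₐ[k] P.base k β :=
  Algebra.TensorProduct.map (AlgHom.id k k) (P.res f)

end ProFiniteAlg

/-- A quasi-separable formal monoid `M₀` over `spec k₀`: a formal set with a base point
`spec k₀ → M₀` and a product `M₀ × M₀ → M₀` that satisfy the monoid laws. Both maps are given by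
representatives; all laws are equalities of points of the formal set, that is, they hold up to
passing to a further index. The product is not assumed to be commutative. -/
structure FormalMonoid (k₀ : Type u) [CommRing k₀] extends ProFiniteAlg k₀ where
  unitIdx : I
  unit : toProFiniteAlg.E unitIdx →ₐ[k₀] k₀
  mulIdx : I → I → I
  mul (α β : I) : toProFiniteAlg.E (mulIdx α β) →ₐ[k₀]
    toProFiniteAlg.E α ⊗[k₀] toProFiniteAlg.E β
  mul_res {α α' β β' : I} (f : α ⟶ α') (g : β ⟶ β') :
    toProFiniteAlg.SameHom
      ((Algebra.TensorProduct.map (toProFiniteAlg.res f) (toProFiniteAlg.res g)).comp (mul α β))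
      (mul α' β')
  unit_mul (α : I) : toProFiniteAlg.SameHom
    (((Algebra.TensorProduct.lid k₀ (toProFiniteAlg.E α)).toAlgHom.comp
      (Algebra.TensorProduct.map unit (AlgHom.id k₀ _))).comp (mul unitIdx α))
    (AlgHom.id k₀ (toProFiniteAlg.E α))
  mul_unit (α : I) : toProFiniteAlg.SameHom
    (((Algebra.TensorProduct.rid k₀ k₀ (toProFiniteAlg.E α)).toAlgHom.comp
      (Algebra.TensorProduct.map (AlgHom.id k₀ _) unit)).comp (mul α unitIdx))
    (AlgHom.id k₀ (toProFiniteAlg.E α))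
  mul_assoc (α β γ : I) : toProFiniteAlg.SameHom
    (((Algebra.TensorProduct.assoc k₀ k₀ k₀ (toProFiniteAlg.E α) (toProFiniteAlg.E β)
        (toProFiniteAlg.E γ)).toAlgHom.comp
      (Algebra.TensorProduct.map (mul α β) (AlgHom.id k₀ _))).comp (mul (mulIdx α β) γ))
    ((Algebra.TensorProduct.map (AlgHom.id k₀ _) (mul β γ)).comp (mul α (mulIdx β γ)))

variable {k₀ : Type u} [CommRing k₀]

/-- A (left) action of the formal monoid `M₀` on the affine scheme `spec B` over `k₀`, as a compatible
system of maps `act α : B → B ⊗ E₀,α`, with `(act α b)(z, m) = b (m z)`. The base point acts as the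
identity, and `(m₁ m₂) z = m₁ (m₂ z)`. -/
structure MAction (M : FormalMonoid k₀) (B : Type u) [CommRing B] [Algebra k₀ B] where
  act (α : M.I) : B →ₐ[k₀] B ⊗[k₀] M.E α
  act_res {α β : M.I} (f : α ⟶ β) :
    (Algebra.TensorProduct.map (AlgHom.id k₀ B) (M.res f)).comp (act α) = act β
  act_unit : ((Algebra.TensorProduct.rid k₀ k₀ B).toAlgHom.comp
    (Algebra.TensorProduct.map (AlgHom.id k₀ B) M.unit)).comp (act M.unitIdx) = AlgHom.id k₀ B
  act_mul (α β : M.I) :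
    (Algebra.TensorProduct.map (AlgHom.id k₀ B) (M.mul α β)).comp (act (M.mulIdx α β)) =
      (((Algebra.TensorProduct.map (AlgHom.id k₀ B)
          (Algebra.TensorProduct.comm k₀ (M.E β) (M.E α)).toAlgHom).comp
        (Algebra.TensorProduct.assoc k₀ k₀ k₀ B (M.E β) (M.E α)).toAlgHom).comp
        (Algebra.TensorProduct.map (act β) (AlgHom.id k₀ (M.E α)))).comp (act α)


/-- Base change of coefficients along `f : B → B'`. -/
abbrev mapL {k₀ B B' : Type u} [CommRing k₀] [CommRing B] [CommRing B'] 
    [Algebra k₀ B] [Algebra k₀ B'] (f : B →ₐ[k₀] B') (D : Type u) [CommRing D] [Algebra k₀ D] :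
    B ⊗[k₀] D →ₐ[k₀] B' ⊗[k₀] D :=
  Algebra.TensorProduct.map f (AlgHom.id k₀ D)

variable {k : Type u} [Field k] [Algebra k₀ k]

/-- Given an action `μ` of `M₀` on `spec k`: an affine `M₀`-scheme over `spec k`, that is, an action of
`M₀` on `spec A` for which `spec A → spec k` is equivariant. -/
structure MAlgebra {M : FormalMonoid k₀} (μ : MAction M k) (A : Type u) [CommRing A]
    [Algebra k A] [Algebra k₀ A] [IsScalarTower k₀ k A] extends MAction M A where
  semilinear (α : M.I) : (act α).comp (IsScalarTower.toAlgHom k₀ k A) =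
    (mapL (IsScalarTower.toAlgHom k₀ k A) (M.E α)).comp (μ.act α)

namespace MAlgebra
variable {M : FormalMonoid k₀} {μ : MAction M k}
  {A : Type u} [CommRing A] [Algebra k A] [Algebra k₀ A] [IsScalarTower k₀ k A]
  {A' : Type u} [CommRing A'] [Algebra k A'] [Algebra k₀ A'] [IsScalarTower k₀ k A']

theorem act_smul (s : MAlgebra μ A) (α : M.I) (c : k) (a : A) :
    s.act α (c • a) = mapL (IsScalarTower.toAlgHom k₀ k A) (M.E α) (μ.act α c) * s.act α a := by
  rw [Algebra.smul_def, map_mul]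
  congr 1
  exact DFunLike.congr_fun (s.semilinear α) c

variable (k₀ k A A') in
/-- The coprojection `A → A ⊗[k] A'`, over `k₀`. -/
abbrev inl : A →ₐ[k₀] A ⊗[k] A' :=
  (Algebra.TensorProduct.includeLeft : A →ₐ[k] A ⊗[k] A').restrictScalars k₀

variable (k₀ k A A') in
/-- The coprojection `A' → A ⊗[k] A'`, over `k₀`. -/
abbrev inr : A' →ₐ[k₀] A ⊗[k] A' :=
  (Algebra.TensorProduct.includeRight : A' →ₐ[k] A ⊗[k] A').restrictScalars k₀

/-- The diagonal action of `M₀` on the product `spec A × spec A'` over `spec k`. -/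
def prodAct (s : MAlgebra μ A) (s' : MAlgebra μ A') (α : M.I) :
    A ⊗[k] A' →+ (A ⊗[k] A') ⊗[k₀] M.E α :=
  TensorProduct.liftAddHom
    (AddMonoidHom.mk' (fun a => AddMonoidHom.mk' (fun a' =>
        mapL (inl k₀ k A A') (M.E α) (s.act α a) *
        mapL (inr k₀ k A A') (M.E α) (s'.act α a'))
      (fun x y => by rw [map_add, map_add, mul_add]))
      (fun x y => by ext z; simp only [AddMonoidHom.mk'_apply, map_add, add_mul,
        AddMonoidHom.add_apply]))
    (by
      intro c a b
      have key : ∀ t : k ⊗[k₀] M.E α,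
          mapL (inl k₀ k A A') (M.E α) (mapL (IsScalarTower.toAlgHom k₀ k A) (M.E α) t) =
          mapL (inr k₀ k A A') (M.E α) (mapL (IsScalarTower.toAlgHom k₀ k A') (M.E α) t) := by
        intro t
        induction t with
        | zero => simp
        | add x y hx hy => simp only [map_add, hx, hy]
        | tmul x d => simp [Algebra.algebraMap_eq_smul_one]
      simp [act_smul, key, mul_comm, mul_left_comm])

theorem prodAct_tmul (s : MAlgebra μ A) (s' : MAlgebra μ A') (α : M.I) (a : A) (a' : A') :
    prodAct s s' α (a ⊗ₜ a') =
      mapL (inl k₀ k A A') (M.E α) (s.act α a) *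
        mapL (inr k₀ k A A') (M.E α) (s'.act α a') := rfl

end MAlgebra

/-- An (affine) `M₀`-group `G` over `spec k`: a group object in the category of affine
`M₀`-schemes over `spec k`. Thus `A` is the Hopf algebra of `G`, with an action `s` of `M₀` on
`spec A` over the action `μ` on `spec k`, and the product, the unit and the inverse of `G` are
equivariant. -/
structure MGroup {M : FormalMonoid k₀} (μ : MAction M k) where
  A : Type u
  [commRing : CommRing A]
  [hopf : HopfAlgebra k A]
  [algebra₀ : Algebra k₀ A]
  [tower : IsScalarTower k₀ k A]
  s : MAlgebra μ A
  comul (α : M.I) (a : A) :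
    mapL ((Bialgebra.comulAlgHom k A).restrictScalars k₀) (M.E α) (s.act α a) =
      MAlgebra.prodAct s s α (Coalgebra.comul (R := k) a)
  counit (α : M.I) (a : A) :
    mapL ((Bialgebra.counitAlgHom k A).restrictScalars k₀) (M.E α) (s.act α a) =
      μ.act α (Coalgebra.counit (R := k) a)
  antipode (α : M.I) (a : A) :
    LinearMap.rTensor (M.E α) ((HopfAlgebra.antipode k (A := A)).restrictScalars k₀)
      (s.act α a) = s.act α (HopfAlgebra.antipode k a)

attribute [instance] MGroup.commRing MGroup.hopf MGroup.algebra₀ MGroup.tower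

end Monoids

section Categories
open MonoidalCategory Limits
universe v w

/-- `C` is a `k`-linear (rigid) tensor category: it is abelian, with finite dimensional Hom spaces and
objects of finite length, the tensor product is symmetric and `k`-bilinear, every object has a dual,
and `End(1) = k`. -/
structure IsTensorCategory (k : Type u) [Field k] (C : Type v) [Category.{w} C] [Preadditive C]
    [Linear k C] [MonoidalCategory C] [SymmetricCategory C] : Prop where
  hasFiniteProducts : HasFiniteProducts C
  hasKernels : HasKernels C
  hasCokernels : HasCokernels C
  isNormalMono : IsNormalMonoCategory C
  isNormalEpi : IsNormalEpiCategory C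
  finite_hom (X Y : C) : Module.Finite k (X ⟶ Y)
  finite_length (X : C) : ∃ n : ℕ, ∀ s : LTSeries (Subobject X), s.length ≤ n
  monoidalPreadditive : MonoidalPreadditive C
  monoidalLinear : MonoidalLinear k C
  rigid (X : C) : ∃ Y : C, Nonempty (ExactPairing X Y)
  unit_end : Function.Bijective (algebraMap k (End (𝟙_ C)))

/-- An `E`-module in `C`: an object of `C` with an action of the `k`-algebra `E`. -/
structure EMod (k : Type u) [Field k] (E : Type u) [CommRing E] [Algebra k E]
    (C : Type v) [Category.{w} C] [Preadditive C] [Linear k C] where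
  X : C
  act : E →ₐ[k] End X

namespace EMod
variable {k : Type u} [Field k] {E F : Type u} [CommRing E] [Algebra k E] [CommRing F] [Algebra k F]
  {C : Type v} [Category.{w} C] [Preadditive C] [Linear k C]

/-- The action of `e`, as a morphism of `C`. -/
abbrev smul (X : EMod k E C) (e : E) : X.X ⟶ X.X := X.act e

/-- A map of `E`-modules. -/
@[ext]
structure Hom (X Y : EMod k E C) where
  hom : X.X ⟶ Y.X
  comm (e : E) : X.smul e ≫ hom = hom ≫ Y.smul e

instance : Category (EMod k E C) where
  Hom X Y := Hom X Y
  id X := ⟨𝟙 X.X, fun e => by simp⟩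
  comp f g := ⟨f.hom ≫ g.hom, fun e => by
    rw [← Category.assoc, f.comm, Category.assoc, g.comm, Category.assoc]⟩

variable (k E C) in
/-- The underlying object of an `E`-module; this is `p_*`. -/
def forget : EMod k E C ⥤ C where
  obj X := X.X
  map f := Hom.hom f

@[simp] theorem hom_comp {X Y Z : EMod k E C} (f : X ⟶ Y) (g : Y ⟶ Z) :
    Hom.hom (f ≫ g) = Hom.hom f ≫ Hom.hom g := rfl
@[simp] theorem hom_id (X : EMod k E C) : Hom.hom (𝟙 X) = 𝟙 X.X := rfl

/-- An object of `C`, as a module over `k`. -/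
def ofObj (X : C) : EMod k k C := ⟨X, Algebra.ofId k (End X)⟩

/-- For a map `f : E → F` of algebras, an `F`-module `Y` and an `E`-module `X`, the map `g : Y → X`
exhibits `Y` as `f^!(X) = Hom_E(F, X)`: it is `E`-linear, and is universal with this property, so
that `Hom_F(Z, Y) = Hom_E(f_* Z, X)` for every `F`-module `Z`. -/
structure IsCartesian (f : E →ₐ[k] F) (Y : EMod k F C) (X : EMod k E C) (g : Y.X ⟶ X.X) :
    Prop where
  linear (e : E) : Y.smul (f e) ≫ g = g ≫ X.smul e
  universal (Z : EMod k F C) (h : Z.X ⟶ X.X) (_ : ∀ e : E, Z.smul (f e) ≫ h = h ≫ X.smul e) :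
    ∃! l : Z ⟶ Y, l.hom ≫ g = h

/-- The biadditive map `t : M × X → T` exhibits the object `T` as the tensor product `M ⊗_E X` of the
`E`-module `M` with the `E`-module `X` in `C`. -/
structure IsTensorOver (M : Type u) [AddCommGroup M] [Module E M] (X : EMod k E C) (T : C)
    (t : M →+ (X.X ⟶ T)) : Prop where
  linear (e : E) (m : M) : t (e • m) = X.smul e ≫ t m
  universal (T' : C) (t' : M →+ (X.X ⟶ T')) (_ : ∀ e m, t' (e • m) = X.smul e ≫ t' m) :
    ∃! l : T ⟶ T', ∀ m, t m ≫ l = t' m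

/-- The `E`-module `X` in `C` is flat: `M ↦ M ⊗_E X` is exact on finite `E`-modules, that is, it
preserves injective maps. -/
def IsFlat (X : EMod k E C) : Prop :=
  ∀ (M N : Type u) [AddCommGroup M] [Module E M] [Module.Finite E M]
    [AddCommGroup N] [Module E N] [Module.Finite E N] (j : M →ₗ[E] N), Function.Injective j →
    ∀ (T T' : C) (t : M →+ (X.X ⟶ T)) (t' : N →+ (X.X ⟶ T')),
      IsTensorOver M X T t → IsTensorOver N X T' t' →
      ∀ l : T ⟶ T', (∀ m, t m ≫ l = t' (j m)) → Mono l

variable [MonoidalCategory C]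

/-- The `E`-module `X` in `C` is injective, in the sense that its dual (with the transposed action of
`E`) is flat. -/
def IsInjective (X : EMod k E C) : Prop :=
  ∃ (Y : EMod k E C) (_ : ExactPairing X.X Y.X),
    (∀ e : E, η_ X.X Y.X ≫ (X.smul e ▷ Y.X) = η_ X.X Y.X ≫ (X.X ◁ Y.smul e)) ∧ Y.IsFlat

/-- The map `g : Z → X ⊗ Y` exhibits `Z` as the tensor product of `E`-modules which is dual to the usual
`⊗_E`, that is, as `Hom_E(X^∨, Y)`: this is the largest subobject of `X ⊗ Y` on which the two
actions of `E` agree. -/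
structure IsTensor (X Y Z : EMod k E C) (g : Z.X ⟶ X.X ⊗ Y.X) : Prop where
  linear (e : E) : Z.smul e ≫ g = g ≫ (X.smul e ▷ Y.X)
  balanced (e : E) : g ≫ (X.smul e ▷ Y.X) = g ≫ (X.X ◁ Y.smul e)
  universal (W : C) (h : W ⟶ X.X ⊗ Y.X)
    (_ : ∀ e : E, h ≫ (X.smul e ▷ Y.X) = h ≫ (X.X ◁ Y.smul e)) : ∃! l : W ⟶ Z.X, l ≫ g = h

end EMod

variable {k₀ : Type u} [CommRing k₀] (P : ProFiniteAlg k₀) (k : Type u) [Field k] [Algebra k₀ k]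
  (C : Type v) [Category.{w} C] [Preadditive C] [Linear k C]

/-- A module in `C` over the pro-finite algebra `E`: a module over each `E_α`, with `E_α`-linear maps
`X_β → X_α` for the transition maps `E_α → E_β`. -/
structure ModSys where
  obj (α : P.I) : EMod k (P.base k α) C
  tr {α β : P.I} (f : α ⟶ β) : (obj β).X ⟶ (obj α).X
  tr_linear {α β : P.I} (f : α ⟶ β) (e : P.base k α) :
    (obj β).smul (P.baseRes k f e) ≫ tr f = tr f ≫ (obj α).smul e
  tr_id (α : P.I) : tr (𝟙 α) = 𝟙 _
  tr_comp {α β γ : P.I} (f : α ⟶ β) (g : β ⟶ γ) : tr (f ≫ g) = tr g ≫ tr f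

namespace ModSys
variable {P k C}

/-- A map of modules over the pro-finite algebra. -/
@[ext]
structure Hom (X Y : ModSys P k C) where
  app (α : P.I) : X.obj α ⟶ Y.obj α
  tr_app {α β : P.I} (f : α ⟶ β) : X.tr f ≫ (app α).hom = (app β).hom ≫ Y.tr f

instance : Category (ModSys P k C) where
  Hom X Y := Hom X Y
  id X := ⟨fun α => 𝟙 _, fun f => by simp⟩
  comp f g := ⟨fun α => f.app α ≫ g.app α, fun h => by
    rw [EMod.hom_comp, EMod.hom_comp, ← Category.assoc, f.tr_app, Category.assoc, g.tr_app,
      Category.assoc]⟩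

variable (P k C) in
/-- The component at `α`. -/
def proj (α : P.I) : ModSys P k C ⥤ EMod k (P.base k α) C where
  obj X := X.obj α
  map f := Hom.app f α

variable [MonoidalCategory C]

/-- The objects of `Prolong_E(C)`: each component is an injective `E_α`-module, and for each transition
map `f : E_α → E_β`, the map `X_β → X_α` induces `X_β = f^!(X_α)`. -/
structure IsProlongation (X : ModSys P k C) : Prop where
  cartesian {α β : P.I} (f : α ⟶ β) : EMod.IsCartesian (P.baseRes k f) (X.obj β) (X.obj α) (X.tr f)
  injective (α : P.I) : (X.obj α).IsInjective

end ModSys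

variable [MonoidalCategory C]

/-- The category `Prolong_E(C)`. -/
abbrev Plng : Type _ := ObjectProperty.FullSubcategory (fun X : ModSys P k C => X.IsProlongation)

variable {P k C}
namespace Plng

/-- The component at `α`. -/
abbrev comp (X : Plng P k C) (α : P.I) : EMod k (P.base k α) C := X.obj.obj α
/-- The transition map. -/
abbrev tr (X : Plng P k C) {α β : P.I} (f : α ⟶ β) : (X.comp β).X ⟶ (X.comp α).X := X.obj.tr f

variable (P k C) in
/-- The component at `α`, as a functor. -/
abbrev proj (α : P.I) : Plng P k C ⥤ EMod k (P.base k α) C :=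
  ObjectProperty.ι _ ⋙ ModSys.proj P k C α

variable (P k C) in
/-- The object of `C` underlying the component at `α`, as a functor. -/
abbrev und (α : P.I) : Plng P k C ⥤ C := proj P k C α ⋙ EMod.forget _ _ _
end Plng

/-- The structure of a (symmetric) tensor functor on `τ : C → Prolong_E(C)`, where the tensor product of
`Prolong_E(C)` is computed at each index by `EMod.IsTensor`, and its unit is `p^!(1) = E^∨`. The
isomorphisms `τ(X ⊗ Y) = τ(X) ⊗ τ(Y)` and `τ(1) = p^!(1)` are given by the maps `δ` and `ε` with the
corresponding universal properties; they are natural, associative, unital and symmetric, and they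
commute with the transition maps. -/
structure TensorStructure [SymmetricCategory C] (τ : C ⥤ Plng P k C) where
  δ (α : P.I) (X Y : C) :
    ((τ.obj (X ⊗ Y)).comp α).X ⟶ ((τ.obj X).comp α).X ⊗ ((τ.obj Y).comp α).X
  ε (α : P.I) : ((τ.obj (𝟙_ C)).comp α).X ⟶ 𝟙_ C
  isTensor (α : P.I) (X Y : C) : EMod.IsTensor ((τ.obj X).comp α) ((τ.obj Y).comp α)
    ((τ.obj (X ⊗ Y)).comp α) (δ α X Y)
  isUnit (α : P.I) : EMod.IsCartesian (Algebra.ofId k (P.base k α)) ((τ.obj (𝟙_ C)).comp α)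
    (EMod.ofObj (𝟙_ C)) (ε α)
  δ_natural (α : P.I) {X X' Y Y' : C} (f : X ⟶ X') (g : Y ⟶ Y') :
    (τ ⋙ Plng.und P k C α).map (f ⊗ₘ g) ≫ δ α X' Y' =
      δ α X Y ≫ ((τ ⋙ Plng.und P k C α).map f ⊗ₘ (τ ⋙ Plng.und P k C α).map g)
  δ_assoc (α : P.I) (X Y Z : C) :
    δ α (X ⊗ Y) Z ≫ (δ α X Y ▷ _) ≫ (α_ _ _ _).hom =
      (τ ⋙ Plng.und P k C α).map (α_ X Y Z).hom ≫ δ α X (Y ⊗ Z) ≫ (_ ◁ δ α Y Z)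
  δ_left_unit (α : P.I) (X : C) :
    δ α (𝟙_ C) X ≫ (ε α ▷ _) ≫ (λ_ _).hom = (τ ⋙ Plng.und P k C α).map (λ_ X).hom
  δ_right_unit (α : P.I) (X : C) :
    δ α X (𝟙_ C) ≫ (_ ◁ ε α) ≫ (ρ_ _).hom = (τ ⋙ Plng.und P k C α).map (ρ_ X).hom
  δ_braiding (α : P.I) (X Y : C) :
    δ α X Y ≫ (β_ _ _).hom = (τ ⋙ Plng.und P k C α).map (β_ X Y).hom ≫ δ α Y X
  δ_tr {α β : P.I} (f : α ⟶ β) (X Y : C) :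
    (τ.obj (X ⊗ Y)).tr f ≫ δ α X Y = δ β X Y ≫ ((τ.obj X).tr f ⊗ₘ (τ.obj Y).tr f)
  ε_tr {α β : P.I} (f : α ⟶ β) : (τ.obj (𝟙_ C)).tr f ≫ ε α = ε β

/-- The functor `F` is `k₀`-linear. -/
structure IsLinearOver (k₀ : Type u) [CommRing k₀] [Algebra k₀ k] (F : C ⥤ C) : Prop where
  map_add {X Y : C} (f g : X ⟶ Y) : F.map (f + g) = F.map f + F.map g
  map_smul {X Y : C} (r : k₀) (f : X ⟶ Y) :
    F.map (algebraMap k₀ k r • f) = algebraMap k₀ k r • F.map f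

namespace IsLinearOver
open scoped TensorProduct

/-- Restriction of scalars of `End X` to `k₀`. -/
abbrev endAlgebra (k₀ : Type u) [CommRing k₀] [Algebra k₀ k] (X : C) : Algebra k₀ (End X) :=
  Algebra.compHom (End X) (algebraMap k₀ k)

/-- The algebra map `End X → End (F X)`. -/
def mapEnd {F : C ⥤ C} (hF : IsLinearOver (k := k) k₀ F) (X : C) :
    letI := endAlgebra (k := k) k₀ X
    letI := endAlgebra (k := k) k₀ (F.obj X)
    End X →ₐ[k₀] End (F.obj X) :=
  letI := endAlgebra (k := k) k₀ X
  letI := endAlgebra (k := k) k₀ (F.obj X)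
  { toFun := fun f => F.map f
    map_one' := F.map_id X
    map_mul' := fun f g => F.map_comp g f
    map_zero' := by
      have h := hF.map_add (0 : X ⟶ X) 0
      rw [add_zero] at h
      exact left_eq_add.mp h
    map_add' := fun f g => hF.map_add f g
    commutes' := fun r => by
      have h := hF.map_smul r (𝟙 X)
      rw [F.map_id] at h
      exact h }

/-- Given an action `a` of `k ⊗ R` on `X`, and an action `b` of `k ⊗ S` on `F X` which commutes with the
image of `a`, the action of `k ⊗ (R ⊗ S)` on `F X` for which `c ⊗ (r ⊗ s)` acts as
`c • (F (a r) b s)`. -/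
def sqAct {F : C ⥤ C} (hF : IsLinearOver (k := k) k₀ F) {R S : Type u} [CommRing R] [Algebra k₀ R]
    [CommRing S] [Algebra k₀ S] {X : C} (a : k ⊗[k₀] R →ₐ[k] End X)
    (b : k ⊗[k₀] S →ₐ[k] End (F.obj X))
    (hab : ∀ r s, F.map (a r : X ⟶ X) ≫ (b s : F.obj X ⟶ F.obj X) = b s ≫ F.map (a r : X ⟶ X)) :
    k ⊗[k₀] (R ⊗[k₀] S) →ₐ[k] End (F.obj X) :=
  letI := endAlgebra (k := k) k₀ X
  letI := endAlgebra (k := k) k₀ (F.obj X)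
  haveI : IsScalarTower k₀ k (End X) := IsScalarTower.of_algebraMap_eq fun _ => rfl
  haveI : IsScalarTower k₀ k (End (F.obj X)) := IsScalarTower.of_algebraMap_eq fun _ => rfl
  Algebra.TensorProduct.lift (Algebra.ofId k (End (F.obj X)))
    (Algebra.TensorProduct.lift
      ((mapEnd hF X).comp ((a.restrictScalars k₀).comp Algebra.TensorProduct.includeRight))
      ((b.restrictScalars k₀).comp Algebra.TensorProduct.includeRight)
      (fun _ _ => (hab _ _).symm))
    (fun c _ => Algebra.commutes c _)

end IsLinearOver


variable (M : FormalMonoid k₀)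

namespace FormalMonoid
open scoped TensorProduct
variable {M} (k)

/-- The algebra map `E → k` of the base point `i : spec k → M`. -/
abbrev baseUnit : M.base k M.unitIdx →ₐ[k] k :=
  (Algebra.TensorProduct.rid k₀ k k).toAlgHom.comp
    (Algebra.TensorProduct.map (AlgHom.id k k) M.unit)

/-- The algebra map `E → E ⊗_k E = k ⊗ (E₀ ⊗ E₀)` of the product `m : M × M → M`. -/
abbrev baseMul (α β : M.I) : M.base k (M.mulIdx α β) →ₐ[k] k ⊗[k₀] (M.E α ⊗[k₀] M.E β) :=
  Algebra.TensorProduct.map (AlgHom.id k k) (M.mul α β)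

end FormalMonoid

namespace Plng
open scoped TensorProduct
/-- The component `τ_α(τ_β(X))` of `τ(τ(X))`, as a module over `E_β ⊗_k E_α = k ⊗ (E₀,β ⊗ E₀,α)`:
`E_β` acts through `τ_α` of its action on `τ_β(X)`, and `E_α` and `k` act since `τ_α` takes values
in `E_α`-modules. -/
def sq (τ : C ⥤ Plng P k C) (hτ : ∀ α, IsLinearOver (k := k) k₀ (τ ⋙ Plng.und P k C α))
    (α β : P.I) (X : C) : EMod k (k ⊗[k₀] (P.E β ⊗[k₀] P.E α)) C where
  X := ((τ.obj ((τ.obj X).comp β).X).comp α).X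
  act := (hτ α).sqAct ((τ.obj X).comp β).act ((τ.obj ((τ.obj X).comp β).X).comp α).act
    (fun r s => (((τ ⋙ proj P k C α).map (((τ.obj X).comp β).smul r)).comm s).symm)
end Plng

variable (k C) in
/-- An `E₀`-structure on the `k`-linear tensor category `C` (where `E₀` is the pro-finite algebra of
the formal monoid `M`, and `E = k ⊗ E₀`):

* a `k₀`-linear tensor functor `τ : C → Prolong_E(C)`, exact as a functor to `E`-modules;
* a tensor isomorphism `i^! ∘ τ = Id`, given by a natural map `a : X → τ(X)` which exhibits `X` as
  `i^!(τ(X))`, and which is compatible with the tensor structures;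
* an `E ⊗_k E`-linear tensor isomorphism `τ ∘ τ = m^! ∘ τ`, given by natural maps
  `b : τ_α(τ_β(X)) → τ_γ(X)`, where `m` is represented by `E_γ → E_β ⊗_k E_α`, which exhibit the
  source as `m^!(τ(X))`, and which are compatible with the transition maps and with the tensor
  structures. -/
structure E₀Structure [SymmetricCategory C] where
  τ : C ⥤ Plng M.toProFiniteAlg k C
  linear (α : M.I) : IsLinearOver (k := k) k₀ (τ ⋙ Plng.und M.toProFiniteAlg k C α)
  exact (α : M.I) : PreservesFiniteLimits (τ ⋙ Plng.proj M.toProFiniteAlg k C α) ∧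
    PreservesFiniteColimits (τ ⋙ Plng.proj M.toProFiniteAlg k C α)
  tensor : TensorStructure τ
  a : 𝟭 C ⟶ τ ⋙ Plng.und M.toProFiniteAlg k C M.unitIdx
  a_cartesian (X : C) : EMod.IsCartesian (M.baseUnit k) (EMod.ofObj X)
    ((τ.obj X).comp M.unitIdx) (a.app X)
  a_tensor (X Y : C) : a.app (X ⊗ Y) ≫ tensor.δ M.unitIdx X Y = (a.app X ⊗ₘ a.app Y)
  a_unit : a.app (𝟙_ C) ≫ tensor.ε M.unitIdx = 𝟙 (𝟙_ C)
  b (α β : M.I) : (τ ⋙ Plng.und M.toProFiniteAlg k C β) ⋙ (τ ⋙ Plng.und M.toProFiniteAlg k C α) ⟶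
    τ ⋙ Plng.und M.toProFiniteAlg k C (M.mulIdx β α)
  b_cartesian (α β : M.I) (X : C) : EMod.IsCartesian (M.baseMul k β α)
    (Plng.sq τ linear α β X) ((τ.obj X).comp (M.mulIdx β α)) ((b α β).app X)
  b_tr {α α' β β' γ : M.I} (f : α ⟶ α') (g : β ⟶ β') (u : γ ⟶ M.mulIdx β α)
    (v : γ ⟶ M.mulIdx β' α')
    (_ : ((Algebra.TensorProduct.map (M.res g) (M.res f)).comp (M.mul β α)).comp (M.res u) =
      (M.mul β' α').comp (M.res v)) (X : C) :
    (τ ⋙ Plng.und M.toProFiniteAlg k C α').map ((τ.obj X).tr g) ≫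
        (τ.obj ((τ.obj X).comp β).X).tr f ≫ (b α β).app X ≫ (τ.obj X).tr u =
      (b α' β').app X ≫ (τ.obj X).tr v
  b_tensor (α β : M.I) (X Y : C) :
    (b α β).app (X ⊗ Y) ≫ tensor.δ (M.mulIdx β α) X Y =
      (τ ⋙ Plng.und M.toProFiniteAlg k C α).map (tensor.δ β X Y) ≫
        tensor.δ α ((τ.obj X).comp β).X ((τ.obj Y).comp β).X ≫
          ((b α β).app X ⊗ₘ (b α β).app Y)
  b_unit (α β : M.I) : (b α β).app (𝟙_ C) ≫ tensor.ε (M.mulIdx β α) =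
    (τ ⋙ Plng.und M.toProFiniteAlg k C α).map (tensor.ε β) ≫ tensor.ε α

end Categories

section Comodules
open scoped TensorProduct
variable (k : Type u) [Field k] (A : Type u) [CommRing A] [HopfAlgebra k A]

/-- A finite dimensional representation of the affine group scheme with Hopf algebra `A`: a finite
dimensional vector space `V` with a coaction `ρ : V → V ⊗ A`. -/
structure RepCat where
  V : Type u
  [addCommGroup : AddCommGroup V]
  [module : Module k V]
  [finite : Module.Finite k V]
  ρ : V →ₗ[k] V ⊗[k] A
  counit : (TensorProduct.rid k V).toLinearMap ∘ₗ
    LinearMap.lTensor V (Coalgebra.counit (R := k) (A := A)) ∘ₗ ρ = LinearMap.id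
  coassoc : (TensorProduct.assoc k V A A).toLinearMap ∘ₗ LinearMap.rTensor A ρ ∘ₗ ρ =
    LinearMap.lTensor V (Coalgebra.comul (R := k) (A := A)) ∘ₗ ρ

namespace RepCat
attribute [instance] RepCat.addCommGroup RepCat.module RepCat.finite

variable {k A}

/-- A map of representations. -/
@[ext]
structure Hom (X Y : RepCat k A) where
  lin : X.V →ₗ[k] Y.V
  comm : Y.ρ ∘ₗ lin = LinearMap.rTensor A lin ∘ₗ X.ρ

instance : Category (RepCat k A) where
  Hom X Y := Hom X Y
  id X := ⟨LinearMap.id, by simp⟩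
  comp f g := ⟨g.lin ∘ₗ f.lin, by
    rw [← LinearMap.comp_assoc, g.comm, LinearMap.comp_assoc, f.comm, LinearMap.rTensor_comp,
      LinearMap.comp_assoc]⟩

/-- The underlying linear map of a morphism. -/
def lin {X Y : RepCat k A} (f : X ⟶ Y) : X.V →ₗ[k] Y.V := Hom.lin f

theorem lin_comm {X Y : RepCat k A} (f : X ⟶ Y) :
    Y.ρ ∘ₗ lin f = LinearMap.rTensor A (lin f) ∘ₗ X.ρ := Hom.comm f

theorem ρ_lin {X Y : RepCat k A} (f : X ⟶ Y) (x : X.V) :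
    Y.ρ (lin f x) = LinearMap.rTensor A (lin f) (X.ρ x) := LinearMap.congr_fun (lin_comm f) x

@[ext]
theorem hom_ext {X Y : RepCat k A} {f g : X ⟶ Y} (h : lin f = lin g) : f = g := Hom.ext h

/-- A linear map that commutes with the coactions, as a map of representations. -/
def ofLin {X Y : RepCat k A} (f : X.V →ₗ[k] Y.V)
    (h : Y.ρ ∘ₗ f = LinearMap.rTensor A f ∘ₗ X.ρ) : X ⟶ Y := ⟨f, h⟩

@[simp] theorem lin_ofLin {X Y : RepCat k A} (f : X.V →ₗ[k] Y.V) (h) :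
    lin (X := X) (Y := Y) (ofLin f h) = f := rfl
@[simp] theorem lin_id (X : RepCat k A) : lin (𝟙 X) = LinearMap.id := rfl
@[simp] theorem lin_comp {X Y Z : RepCat k A} (f : X ⟶ Y) (g : Y ⟶ Z) :
    lin (f ≫ g) = lin g ∘ₗ lin f := rfl

instance (X Y : RepCat k A) : Add (X ⟶ Y) where
  add f g := ofLin (lin f + lin g) (by
    rw [LinearMap.comp_add, LinearMap.rTensor_add, LinearMap.add_comp, lin_comm, lin_comm])
instance (X Y : RepCat k A) : Zero (X ⟶ Y) where
  zero := ofLin 0 (by simp)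
instance (X Y : RepCat k A) : Neg (X ⟶ Y) where
  neg f := ofLin (-lin f) (by
    rw [LinearMap.comp_neg, LinearMap.rTensor_neg, LinearMap.neg_comp, lin_comm])
instance (X Y : RepCat k A) : Sub (X ⟶ Y) where
  sub f g := ofLin (lin f - lin g) (by
    rw [LinearMap.comp_sub, LinearMap.rTensor_sub, LinearMap.sub_comp, lin_comm, lin_comm])
instance (X Y : RepCat k A) : SMul k (X ⟶ Y) where
  smul c f := ofLin (c • lin f) (by
    rw [LinearMap.comp_smul, LinearMap.rTensor_smul, LinearMap.smul_comp, lin_comm])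
instance (X Y : RepCat k A) : SMul ℕ (X ⟶ Y) where
  smul n f := ofLin (n • lin f) (by
    rw [← Nat.cast_smul_eq_nsmul k, LinearMap.comp_smul, LinearMap.rTensor_smul,
      LinearMap.smul_comp, lin_comm])
instance (X Y : RepCat k A) : SMul ℤ (X ⟶ Y) where
  smul n f := ofLin (n • lin f) (by
    rw [← Int.cast_smul_eq_zsmul k, LinearMap.comp_smul, LinearMap.rTensor_smul,
      LinearMap.smul_comp, lin_comm])

@[simp] theorem lin_add {X Y : RepCat k A} (f g : X ⟶ Y) : lin (f + g) = lin f + lin g := rfl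
@[simp] theorem lin_zero (X Y : RepCat k A) : lin (0 : X ⟶ Y) = 0 := rfl
@[simp] theorem lin_smul {X Y : RepCat k A} (c : k) (f : X ⟶ Y) : lin (c • f) = c • lin f := rfl

theorem lin_injective (X Y : RepCat k A) :
    Function.Injective (lin : (X ⟶ Y) → (X.V →ₗ[k] Y.V)) := fun _ _ h => hom_ext h

instance (X Y : RepCat k A) : AddCommGroup (X ⟶ Y) :=
  (lin_injective X Y).addCommGroup _ rfl (fun _ _ => rfl) (fun _ => rfl) (fun _ _ => rfl)
    (fun _ _ => rfl) (fun _ _ => rfl)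

instance : Preadditive (RepCat k A) where
  add_comp _ _ _ f f' g := by ext x; simp
  comp_add _ _ _ f g g' := by ext x; simp

instance (X Y : RepCat k A) : Module k (X ⟶ Y) :=
  (lin_injective X Y).module k ⟨⟨lin, rfl⟩, fun _ _ => rfl⟩ (fun _ _ => rfl)

instance : Linear k (RepCat k A) where
  smul_comp _ _ _ c f g := by ext x; simp
  comp_smul _ _ _ f c g := by ext x; simp

/-- The coaction on a tensor product of representations. -/
def tensorρ (X Y : RepCat k A) : X.V ⊗[k] Y.V →ₗ[k] (X.V ⊗[k] Y.V) ⊗[k] A :=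
  LinearMap.lTensor (X.V ⊗[k] Y.V) (LinearMap.mul' k A) ∘ₗ
    (TensorProduct.tensorTensorTensorComm k X.V A Y.V A).toLinearMap ∘ₗ
    TensorProduct.map X.ρ Y.ρ

/-- The tensor product of representations. -/
abbrev tensor (X Y : RepCat k A) : RepCat k A where
  V := X.V ⊗[k] Y.V
  ρ := tensorρ X Y
  counit := by
    have key : ∀ (s : X.V ⊗[k] A) (t : Y.V ⊗[k] A),
        TensorProduct.rid k _ (LinearMap.lTensor (X.V ⊗[k] Y.V) (Coalgebra.counit (R := k) (A := A))
          (LinearMap.lTensor (X.V ⊗[k] Y.V) (LinearMap.mul' k A)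
            (TensorProduct.tensorTensorTensorComm k X.V A Y.V A (s ⊗ₜ t)))) =
        (TensorProduct.rid k _ (LinearMap.lTensor _ (Coalgebra.counit (R := k) (A := A)) s)) ⊗ₜ
        (TensorProduct.rid k _ (LinearMap.lTensor _ (Coalgebra.counit (R := k) (A := A)) t)) := by
      intro s t
      induction s with
      | zero => simp
      | add a b ha hb => simp only [TensorProduct.add_tmul, map_add, ha, hb]
      | tmul x a =>
        induction t with
        | zero => simp
        | add a b ha hb => simp only [TensorProduct.tmul_add, map_add, ha, hb]
        | tmul y b => simp [TensorProduct.smul_tmul', smul_smul, mul_comm]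
    apply TensorProduct.ext'
    intro x y
    have hx := LinearMap.congr_fun X.counit x
    have hy := LinearMap.congr_fun Y.counit y
    simp only [LinearMap.comp_apply, LinearEquiv.coe_coe, LinearMap.id_apply] at hx hy
    simp only [tensorρ, LinearMap.comp_apply, LinearEquiv.coe_coe, LinearMap.id_apply,
      TensorProduct.map_tmul, key, hx, hy]
  coassoc := by
    -- multiplication of the coefficients of two elements
    let m : (X.V ⊗[k] A) ⊗[k] (Y.V ⊗[k] A) →ₗ[k] (X.V ⊗[k] Y.V) ⊗[k] A :=
      LinearMap.lTensor (X.V ⊗[k] Y.V) (LinearMap.mul' k A) ∘ₗ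
        (TensorProduct.tensorTensorTensorComm k X.V A Y.V A).toLinearMap
    let m₂ : (X.V ⊗[k] (A ⊗[k] A)) ⊗[k] (Y.V ⊗[k] (A ⊗[k] A)) →ₗ[k]
        (X.V ⊗[k] Y.V) ⊗[k] (A ⊗[k] A) :=
      LinearMap.lTensor (X.V ⊗[k] Y.V) (LinearMap.mul' k (A ⊗[k] A)) ∘ₗ
        (TensorProduct.tensorTensorTensorComm k X.V (A ⊗[k] A) Y.V (A ⊗[k] A)).toLinearMap
    have h₁ : ∀ (s : X.V ⊗[k] A) (t : Y.V ⊗[k] A),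
        LinearMap.lTensor (X.V ⊗[k] Y.V) (Coalgebra.comul (R := k) (A := A)) (m (s ⊗ₜ t)) =
        m₂ (LinearMap.lTensor _ (Coalgebra.comul (R := k) (A := A)) s ⊗ₜ
          LinearMap.lTensor _ (Coalgebra.comul (R := k) (A := A)) t) := by
      intro s t
      induction s with
      | zero => simp
      | add a b ha hb => simp only [TensorProduct.add_tmul, map_add, ha, hb]
      | tmul x a =>
        induction t with
        | zero => simp
        | add a b ha hb => simp only [TensorProduct.tmul_add, map_add, ha, hb]
        | tmul y b => simp [m, m₂]
    have h₃ : ∀ (s : X.V ⊗[k] A) (t : Y.V ⊗[k] A) (a b : A),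
        TensorProduct.assoc k _ A A (m (s ⊗ₜ t) ⊗ₜ (a * b)) =
        m₂ (TensorProduct.assoc k _ A A (s ⊗ₜ a) ⊗ₜ TensorProduct.assoc k _ A A (t ⊗ₜ b)) := by
      intro s t a b
      induction s with
      | zero => simp
      | add a b ha hb => simp only [TensorProduct.add_tmul, map_add, ha, hb]
      | tmul x a =>
        induction t with
        | zero => simp
        | add a b ha hb =>
          simp only [TensorProduct.tmul_add, TensorProduct.add_tmul, map_add, ha, hb]
        | tmul y b => simp [m, m₂]
    have h₂ : ∀ (s : X.V ⊗[k] A) (t : Y.V ⊗[k] A),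
        TensorProduct.assoc k _ A A (LinearMap.rTensor A (m ∘ₗ TensorProduct.map X.ρ Y.ρ)
          (m (s ⊗ₜ t))) =
        m₂ (TensorProduct.assoc k _ A A (LinearMap.rTensor A X.ρ s) ⊗ₜ
          TensorProduct.assoc k _ A A (LinearMap.rTensor A Y.ρ t)) := by
      intro s t
      induction s with
      | zero => simp
      | add a b ha hb => simp only [TensorProduct.add_tmul, map_add, ha, hb]
      | tmul x a =>
        induction t with
        | zero => simp
        | add a b ha hb => simp only [TensorProduct.tmul_add, map_add, ha, hb]
        | tmul y b =>
          rw [LinearMap.rTensor_tmul, LinearMap.rTensor_tmul, ← h₃]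
          simp [m]
    apply TensorProduct.ext'
    intro x y
    have hx := LinearMap.congr_fun X.coassoc x
    have hy := LinearMap.congr_fun Y.coassoc y
    simp only [LinearMap.comp_apply, LinearEquiv.coe_coe] at hx hy
    change TensorProduct.assoc k _ A A (LinearMap.rTensor A (m ∘ₗ TensorProduct.map X.ρ Y.ρ)
          (m (X.ρ x ⊗ₜ Y.ρ y))) = LinearMap.lTensor (X.V ⊗[k] Y.V)
            (Coalgebra.comul (R := k) (A := A)) (m (X.ρ x ⊗ₜ Y.ρ y))
    rw [h₁, h₂, hx, hy]

/-- The trivial representation. -/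
abbrev triv : RepCat k A where
  V := k
  ρ := (TensorProduct.mk k k A).flip 1
  counit := by ext; simp
  coassoc := by ext; simp [Algebra.TensorProduct.one_def]

theorem tensorρ_tmul (X Y : RepCat k A) (x : X.V) (y : Y.V) :
    (tensor X Y).ρ (x ⊗ₜ y) = LinearMap.lTensor (X.V ⊗[k] Y.V) (LinearMap.mul' k A)
      (TensorProduct.tensorTensorTensorComm k X.V A Y.V A (X.ρ x ⊗ₜ Y.ρ y)) := rfl

/-- An isomorphism of representations from a linear equivalence. -/
def isoOfLin {X Y : RepCat k A} (e : X.V ≃ₗ[k] Y.V)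
    (h : Y.ρ ∘ₗ e.toLinearMap = LinearMap.rTensor A e.toLinearMap ∘ₗ X.ρ) : X ≅ Y where
  hom := ofLin e.toLinearMap h
  inv := ofLin e.symm.toLinearMap (by
    ext y
    obtain ⟨x, rfl⟩ := e.surjective y
    have hx : Y.ρ (e x) = LinearMap.rTensor A e.toLinearMap (X.ρ x) := LinearMap.congr_fun h x
    simp only [LinearMap.comp_apply, LinearEquiv.coe_coe, hx, LinearEquiv.symm_apply_apply]
    rw [← LinearMap.comp_apply, ← LinearMap.rTensor_comp]
    simp)
  hom_inv_id := by ext x; simp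
  inv_hom_id := by ext x; simp

/-- The tensor product of maps. -/
def tensorMap {X X' Y Y' : RepCat k A} (f : X ⟶ X') (g : Y ⟶ Y') : tensor X Y ⟶ tensor X' Y' :=
  ofLin (TensorProduct.map (lin f) (lin g)) (by
    have key : ∀ (s : X.V ⊗[k] A) (t : Y.V ⊗[k] A),
        LinearMap.lTensor (X'.V ⊗[k] Y'.V) (LinearMap.mul' k A)
          (TensorProduct.tensorTensorTensorComm k X'.V A Y'.V A
            (LinearMap.rTensor A (lin f) s ⊗ₜ LinearMap.rTensor A (lin g) t)) =
        LinearMap.rTensor A (TensorProduct.map (lin f) (lin g))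
          (LinearMap.lTensor (X.V ⊗[k] Y.V) (LinearMap.mul' k A)
            (TensorProduct.tensorTensorTensorComm k X.V A Y.V A (s ⊗ₜ t))) := by
      intro s t
      induction s with
      | zero => simp
      | add a b ha hb => simp only [TensorProduct.add_tmul, map_add, ha, hb]
      | tmul x a =>
        induction t with
        | zero => simp
        | add a b ha hb => simp only [TensorProduct.tmul_add, map_add, ha, hb]
        | tmul y b => simp
    apply TensorProduct.ext'
    intro x y
    have h := key (X.ρ x) (Y.ρ y)
    rw [← ρ_lin, ← ρ_lin] at h
    exact h)

@[simp] theorem lin_tensorMap {X X' Y Y' : RepCat k A} (f : X ⟶ X') (g : Y ⟶ Y') :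
    lin (tensorMap f g) = TensorProduct.map (lin f) (lin g) := rfl

/-- The usual associativity isomorphism. -/
def assocIso (X Y Z : RepCat k A) : tensor (tensor X Y) Z ≅ tensor X (tensor Y Z) :=
  isoOfLin (X := tensor (tensor X Y) Z) (Y := tensor X (tensor Y Z))
    (TensorProduct.assoc k X.V Y.V Z.V) (by
    let m (U W : Type u) [AddCommGroup U] [Module k U] [AddCommGroup W] [Module k W] :
        (U ⊗[k] A) ⊗[k] (W ⊗[k] A) →ₗ[k] (U ⊗[k] W) ⊗[k] A :=
      LinearMap.lTensor (U ⊗[k] W) (LinearMap.mul' k A) ∘ₗ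
        (TensorProduct.tensorTensorTensorComm k U A W A).toLinearMap
    have key : ∀ (r : X.V ⊗[k] A) (s : Y.V ⊗[k] A) (t : Z.V ⊗[k] A),
        m X.V (Y.V ⊗[k] Z.V) (r ⊗ₜ m Y.V Z.V (s ⊗ₜ t)) =
        LinearMap.rTensor A (TensorProduct.assoc k X.V Y.V Z.V).toLinearMap
          (m (X.V ⊗[k] Y.V) Z.V (m X.V Y.V (r ⊗ₜ s) ⊗ₜ t)) := by
      intro r s t
      induction r with
      | zero => simp
      | add a b ha hb => simp only [TensorProduct.add_tmul, map_add, ha, hb]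
      | tmul x a =>
        induction s with
        | zero => simp
        | add a b ha hb =>
          simp only [TensorProduct.tmul_add, TensorProduct.add_tmul, map_add, ha, hb]
        | tmul y b =>
          induction t with
          | zero => simp
          | add a b ha hb =>
            simp only [TensorProduct.tmul_add, map_add, ha, hb]
          | tmul z c => simp [m, mul_assoc]
    apply TensorProduct.ext_threefold
    intro x y z
    exact key (X.ρ x) (Y.ρ y) (Z.ρ z))

/-- The usual left unit isomorphism. -/
def leftIso (X : RepCat k A) : tensor triv X ≅ X :=
  isoOfLin (X := tensor triv X) (Y := X) (TensorProduct.lid k X.V) (by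
    have key : ∀ (c : k) (t : X.V ⊗[k] A), c • t =
        LinearMap.rTensor A (TensorProduct.lid k X.V).toLinearMap
          (LinearMap.lTensor (k ⊗[k] X.V) (LinearMap.mul' k A)
            (TensorProduct.tensorTensorTensorComm k k A X.V A ((c ⊗ₜ 1) ⊗ₜ t))) := by
      intro c t
      induction t with
      | zero => simp
      | add a b ha hb => simp only [TensorProduct.tmul_add, map_add, smul_add, ha, hb]
      | tmul y b => simp [TensorProduct.smul_tmul']
    apply TensorProduct.ext'
    intro c x
    refine ((X.ρ).map_smul c x).trans ?_
    exact key c (X.ρ x))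

/-- The usual right unit isomorphism. -/
def rightIso (X : RepCat k A) : tensor X triv ≅ X :=
  isoOfLin (X := tensor X triv) (Y := X) (TensorProduct.rid k X.V) (by
    have key : ∀ (c : k) (t : X.V ⊗[k] A), c • t =
        LinearMap.rTensor A (TensorProduct.rid k X.V).toLinearMap
          (LinearMap.lTensor (X.V ⊗[k] k) (LinearMap.mul' k A)
            (TensorProduct.tensorTensorTensorComm k X.V A k A (t ⊗ₜ (c ⊗ₜ 1)))) := by
      intro c t
      induction t with
      | zero => simp
      | add a b ha hb => simp only [TensorProduct.add_tmul, map_add, smul_add, ha, hb]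
      | tmul y b => simp [TensorProduct.smul_tmul']
    apply TensorProduct.ext'
    intro x c
    refine ((X.ρ).map_smul c x).trans ?_
    exact key c (X.ρ x))

/-- The usual commutativity isomorphism. -/
def commIso (X Y : RepCat k A) : tensor X Y ≅ tensor Y X :=
  isoOfLin (X := tensor X Y) (Y := tensor Y X) (TensorProduct.comm k X.V Y.V) (by
    have key : ∀ (s : X.V ⊗[k] A) (t : Y.V ⊗[k] A),
        LinearMap.lTensor (Y.V ⊗[k] X.V) (LinearMap.mul' k A)
          (TensorProduct.tensorTensorTensorComm k Y.V A X.V A (t ⊗ₜ s)) =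
        LinearMap.rTensor A (TensorProduct.comm k X.V Y.V).toLinearMap
          (LinearMap.lTensor (X.V ⊗[k] Y.V) (LinearMap.mul' k A)
            (TensorProduct.tensorTensorTensorComm k X.V A Y.V A (s ⊗ₜ t))) := by
      intro s t
      induction s with
      | zero => simp
      | add a b ha hb => simp only [TensorProduct.tmul_add, TensorProduct.add_tmul, map_add, ha, hb]
      | tmul x a =>
        induction t with
        | zero => simp
        | add a b ha hb =>
          simp only [TensorProduct.tmul_add, TensorProduct.add_tmul, map_add, ha, hb]
        | tmul y b => simp [mul_comm]
    apply TensorProduct.ext'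
    intro x y
    exact key (X.ρ x) (Y.ρ y))

instance : MonoidalCategoryStruct (RepCat k A) where
  tensorObj := tensor
  whiskerLeft X _ _ f := tensorMap (𝟙 X) f
  whiskerRight f Y := tensorMap f (𝟙 Y)
  tensorHom f g := tensorMap f g
  tensorUnit := triv
  associator := assocIso
  leftUnitor := leftIso
  rightUnitor := rightIso

instance : MonoidalCategory (RepCat k A) where
  tensorHom_def f g := hom_ext (by apply TensorProduct.ext'; intro x y; rfl)
  id_tensorHom_id X Y := hom_ext (by apply TensorProduct.ext'; intro x y; rfl)
  tensorHom_comp_tensorHom f g h j := hom_ext (by apply TensorProduct.ext'; intro x y; rfl)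
  whiskerLeft_id X Y := hom_ext (by apply TensorProduct.ext'; intro x y; rfl)
  id_whiskerRight X Y := hom_ext (by apply TensorProduct.ext'; intro x y; rfl)
  associator_naturality f g h :=
    hom_ext (by apply TensorProduct.ext_threefold; intro x y z; rfl)
  leftUnitor_naturality f := hom_ext (by
    apply TensorProduct.ext'; intro c x; exact ((lin f).map_smul c x).symm)
  rightUnitor_naturality f := hom_ext (by
    apply TensorProduct.ext'; intro x c; exact ((lin f).map_smul c x).symm)
  pentagon W X Y Z := hom_ext (by apply TensorProduct.ext_fourfold; intro w x y z; rfl)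
  triangle X Y := hom_ext (by
    apply TensorProduct.ext_threefold; intro x c y
    exact (TensorProduct.smul_tmul (R := k) (c : k) x y).symm)

instance : SymmetricCategory (RepCat k A) where
  braiding := commIso
  braiding_naturality_right X _ _ f := hom_ext (by apply TensorProduct.ext'; intro x y; rfl)
  braiding_naturality_left f Z := hom_ext (by apply TensorProduct.ext'; intro x y; rfl)
  hexagon_forward X Y Z := hom_ext (by apply TensorProduct.ext_threefold; intro x y z; rfl)
  hexagon_reverse X Y Z := hom_ext (by
    apply TensorProduct.ext
    apply LinearMap.ext
    intro x
    apply TensorProduct.ext'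
    intro y z
    rfl)
  symmetry X Y := hom_ext (by apply TensorProduct.ext'; intro x y; rfl)

end RepCat
end Comodules

section Tau
open scoped TensorProduct
variable {k₀ : Type u} [CommRing k₀] {k : Type u} [Field k] [Algebra k₀ k]

section CoeffAct
variable {D : Type u} [CommRing D] [Algebra k₀ D]
  {N : Type u} [AddCommGroup N] [Module k N] [Module (k ⊗[k₀] D) N] [IsScalarTower k (k ⊗[k₀] D) N]
  {N' : Type u} [AddCommGroup N'] [Module k N'] [Module (k ⊗[k₀] D) N']
  [IsScalarTower k (k ⊗[k₀] D) N']
  {B : Type u} [CommRing B] [Algebra k B] [Algebra k₀ B] [IsScalarTower k₀ k B]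
  {B' : Type u} [CommRing B'] [Algebra k B'] [Algebra k₀ B'] [IsScalarTower k₀ k B']

theorem coeffAct_aux (n : N) (r : k₀) (b : B) (d : D) :
    (((1 : k) ⊗ₜ[k₀] d) • n) ⊗ₜ[k] (r • b) = (((1 : k) ⊗ₜ[k₀] (r • d)) • n) ⊗ₜ[k] b := by
  have h : (1 : k) ⊗ₜ[k₀] (r • d) = algebraMap k₀ k r • ((1 : k) ⊗ₜ[k₀] d) := by
    rw [TensorProduct.tmul_smul, algebraMap_smul]
  rw [h, smul_assoc, TensorProduct.smul_tmul (algebraMap k₀ k r) _ b, algebraMap_smul]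

variable (B) in
/-- For an element `n` of a module over `k ⊗ D`, the map `B ⊗ D → N ⊗ B`, `b ⊗ d ↦ d n ⊗ b`. -/
def coeffAct (n : N) : B ⊗[k₀] D →+ N ⊗[k] B :=
  TensorProduct.liftAddHom
    (AddMonoidHom.mk' (fun b => AddMonoidHom.mk' (fun d => (((1 : k) ⊗ₜ[k₀] d) • n) ⊗ₜ[k] b)
      (fun d d' => by rw [TensorProduct.tmul_add, add_smul, TensorProduct.add_tmul]))
      (fun b b' => by ext d; exact TensorProduct.tmul_add _ _ _))
    (fun r b d => coeffAct_aux n r b d)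

@[simp] theorem coeffAct_tmul (n : N) (b : B) (d : D) :
    coeffAct (k₀ := k₀) (k := k) B n (b ⊗ₜ d) = (((1 : k) ⊗ₜ[k₀] d) • n) ⊗ₜ[k] b := rfl

theorem coeffAct_add (n n' : N) (t : B ⊗[k₀] D) :
    coeffAct (k := k) B (n + n') t = coeffAct (k := k) B n t + coeffAct (k := k) B n' t := by
  induction t with
  | zero => simp
  | add x y hx hy => simp only [map_add, hx, hy]; abel
  | tmul b d => simp [TensorProduct.add_tmul]

theorem coeffAct_zero (t : B ⊗[k₀] D) : coeffAct (k := k) B (0 : N) t = 0 := by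
  induction t with
  | zero => simp
  | add x y hx hy => simp only [map_add, hx, hy, add_zero]
  | tmul b d => simp

/-- Moving scalars of `k ⊗ D` from the coefficients to the vector. -/
theorem coeffAct_mul (n : N) (e : k ⊗[k₀] D) (t : B ⊗[k₀] D) :
    coeffAct (k := k) B n (mapL (IsScalarTower.toAlgHom k₀ k B) D e * t) =
      coeffAct (k := k) B (e • n) t := by
  induction e with
  | zero => simp [coeffAct_zero]
  | add x y hx hy => simp only [map_add, add_mul, hx, hy, add_smul, coeffAct_add]
  | tmul c d =>
    induction t with
    | zero => simp
    | add x y hx hy => simp only [map_add, mul_add, hx, hy]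
    | tmul b d' =>
      have h : (c ⊗ₜ[k₀] d : k ⊗[k₀] D) = c • ((1 : k) ⊗ₜ[k₀] d) := by
        rw [TensorProduct.smul_tmul', smul_eq_mul, mul_one]
      have h₂ : ((1 : k) ⊗ₜ[k₀] (d * d')) • n =
          ((1 : k) ⊗ₜ[k₀] d') • ((1 : k) ⊗ₜ[k₀] d) • n := by
        rw [← mul_smul, Algebra.TensorProduct.tmul_mul_tmul, mul_one, mul_comm]
      rw [Algebra.TensorProduct.map_tmul, Algebra.TensorProduct.tmul_mul_tmul, coeffAct_tmul,
        coeffAct_tmul, h, smul_assoc, smul_comm ((1 : k) ⊗ₜ[k₀] d') c,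
        TensorProduct.smul_tmul c _ b]
      change (((1 : k) ⊗ₜ[k₀] (d * d')) • n) ⊗ₜ[k] (algebraMap k B c * b) = _
      rw [h₂, Algebra.smul_def]

theorem coeffAct_smul (n : N) (c : k) (t : B ⊗[k₀] D) :
    coeffAct (k := k) B (c • n) t = c • coeffAct (k := k) B n t := by
  induction t with
  | zero => simp
  | add x y hx hy => simp only [map_add, hx, hy, smul_add]
  | tmul b d => 
    rw [coeffAct_tmul, coeffAct_tmul, TensorProduct.smul_tmul', smul_comm]

/-- Naturality in the vector. -/
theorem coeffAct_map (f : N →ₗ[k] N') (hf : ∀ (e : k ⊗[k₀] D) n, f (e • n) = e • f n) (n : N)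
    (t : B ⊗[k₀] D) :
    LinearMap.rTensor B f (coeffAct (k := k) B n t) = coeffAct (k := k) B (f n) t := by
  induction t with
  | zero => simp
  | add x y hx hy => simp only [map_add, hx, hy]
  | tmul b d => simp [hf]

/-- Naturality in the coefficients. -/
theorem coeffAct_coeff (g : B →ₐ[k] B') (n : N) (t : B ⊗[k₀] D) :
    LinearMap.lTensor N g.toLinearMap (coeffAct (k := k) B n t) =
      coeffAct (k := k) B' n (mapL (g.restrictScalars k₀) D t) := by
  induction t with
  | zero => simp
  | add x y hx hy => simp only [map_add, hx, hy]
  | tmul b d => simp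

theorem rid_coeffAct (n : N) (e : k ⊗[k₀] D) :
    TensorProduct.rid k N (coeffAct (k := k) k n e) = e • n := by
  induction e with
  | zero => simp
  | add x y hx hy => simp only [map_add, hx, hy, add_smul]
  | tmul c d =>
    rw [coeffAct_tmul, TensorProduct.rid_tmul, ← smul_assoc, TensorProduct.smul_tmul',
      smul_eq_mul, mul_one]

theorem assoc_coeffAct (n : N) (q : B ⊗[k₀] D) (b : B) (d : D) :
    TensorProduct.assoc k N B B (coeffAct (k := k) B (((1 : k) ⊗ₜ[k₀] d) • n) q ⊗ₜ b) =
      coeffAct (k := k) (B ⊗[k] B) n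
        (mapL (MAlgebra.inl k₀ k B B) D q * mapL (MAlgebra.inr k₀ k B B) D (b ⊗ₜ d)) := by
  induction q with
  | zero => simp
  | add x y hx hy => simp only [map_add, add_mul, TensorProduct.add_tmul, hx, hy]
  | tmul b' d' =>
    have h : ((1 : k) ⊗ₜ[k₀] (d' * d)) • n = ((1 : k) ⊗ₜ[k₀] d') • ((1 : k) ⊗ₜ[k₀] d) • n := by
      rw [← mul_smul, Algebra.TensorProduct.tmul_mul_tmul, mul_one]
    simp [h]

end CoeffAct

variable {M : FormalMonoid k₀}

/-- The `k`-linear dual `E_α^∨` of `E_α = k ⊗ E₀,α`, with its `E_α`-module structure, and with the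
`k`-structure which is given by the action map `μ : k → E_α`. -/
def CoE (_μ : MAction M k) (α : M.I) : Type u := Module.Dual k (M.base k α)

namespace CoE
variable (μ : MAction M k) (α : M.I)

instance : AddCommGroup (CoE μ α) := inferInstanceAs (AddCommGroup (Module.Dual k (M.base k α)))

variable {μ α} in
/-- A functional, as an element of `E_α^∨`. -/
def mk (θ : Module.Dual k (M.base k α)) : CoE μ α := θ

variable {μ α} in
/-- The functional given by an element of `E_α^∨`. -/
def toDual (θ : CoE μ α) : Module.Dual k (M.base k α) := θ

instance : Module (M.base k α) (CoE μ α) where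
  smul e θ := mk (toDual θ ∘ₗ LinearMap.mulLeft k e)
  one_smul θ := by
    change toDual θ ∘ₗ LinearMap.mulLeft k 1 = toDual θ
    ext; simp
  mul_smul e e' θ := by
    change toDual θ ∘ₗ LinearMap.mulLeft k (e * e') =
      (toDual θ ∘ₗ LinearMap.mulLeft k e') ∘ₗ LinearMap.mulLeft k e
    apply LinearMap.ext; intro x
    simp only [LinearMap.comp_apply, LinearMap.mulLeft_apply]
    rw [← mul_assoc, mul_comm e' e]
  smul_zero e := LinearMap.zero_comp _
  smul_add e θ θ' := LinearMap.add_comp _ _ _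
  add_smul e e' θ := by
    change toDual θ ∘ₗ LinearMap.mulLeft k (e + e') =
      toDual θ ∘ₗ LinearMap.mulLeft k e + toDual θ ∘ₗ LinearMap.mulLeft k e'
    apply LinearMap.ext; intro x
    simp [add_mul]
  zero_smul θ := by
    change toDual θ ∘ₗ LinearMap.mulLeft k 0 = 0
    apply LinearMap.ext; intro x
    simp

/-- The `k`-structure along `μ`: the scalar `c` acts as `μ(c)`. -/
instance : Module k (CoE μ α) := Module.compHom (CoE μ α) (μ.act α).toRingHom

theorem smul_def (c : k) (θ : CoE μ α) : c • θ = (μ.act α c : M.base k α) • θ := rfl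

theorem base_smul_apply (e x : M.base k α) (θ : CoE μ α) :
    toDual (e • θ) x = toDual θ (e * x) := rfl

instance : SMulCommClass k (M.base k α) (CoE μ α) where
  smul_comm c e θ := by rw [smul_def, smul_def, ← mul_smul, ← mul_smul, mul_comm]

instance : SMulCommClass (M.base k α) k (CoE μ α) := SMulCommClass.symm _ _ _

end CoE

/-- The `E_α`-module `E_α^∨ ⊗_μ X`: the tensor product over `k`, where `k` acts on `E_α^∨` via the
action map `μ`. It is viewed as a vector space over `k` via the projection `p`, that is, via the
`k`-algebra structure of `E_α`. -/
def TauV (μ : MAction M k) (α : M.I) (X : Type u) [AddCommGroup X] [Module k X] : Type u :=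
  CoE μ α ⊗[k] X

namespace TauV
variable (μ : MAction M k) (α : M.I) (X : Type u) [AddCommGroup X] [Module k X]
  {Y : Type u} [AddCommGroup Y] [Module k Y]

instance : AddCommGroup (TauV μ α X) := inferInstanceAs (AddCommGroup (CoE μ α ⊗[k] X))

instance : Module (M.base k α) (TauV μ α X) :=
  inferInstanceAs (Module (M.base k α) (CoE μ α ⊗[k] X))

instance : Module k (TauV μ α X) :=
  Module.compHom (TauV μ α X) (algebraMap k (M.base k α))

instance : IsScalarTower k (M.base k α) (TauV μ α X) :=
  IsScalarTower.of_algebraMap_smul fun _ _ => rfl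

variable {μ α X}

/-- The element `θ ⊗ x`. -/
def tmul (θ : CoE μ α) (x : X) : TauV μ α X := θ ⊗ₜ[k] x

theorem base_smul_tmul (e : M.base k α) (θ : CoE μ α) (x : X) :
    e • tmul θ x = tmul (e • θ) x := rfl

theorem smul_tmul (c : k) (θ : CoE μ α) (x : X) :
    c • tmul θ x = tmul (algebraMap k (M.base k α) c • θ) x := rfl

theorem act_smul_tmul (c : k) (θ : CoE μ α) (x : X) :
    tmul ((μ.act α c : M.base k α) • θ) x = tmul θ (c • x) :=
  TensorProduct.smul_tmul c θ x

theorem tmul_add (θ : CoE μ α) (x y : X) : tmul θ (x + y) = tmul θ x + tmul θ y :=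
  TensorProduct.tmul_add θ x y

theorem add_tmul (θ θ' : CoE μ α) (x : X) : tmul (θ + θ') x = tmul θ x + tmul θ' x :=
  TensorProduct.add_tmul θ θ' x

theorem tmul_zero (θ : CoE μ α) : tmul θ (0 : X) = 0 := TensorProduct.tmul_zero _ θ

theorem zero_tmul (x : X) : tmul (0 : CoE μ α) x = 0 := TensorProduct.zero_tmul _ x

theorem induction {p : TauV μ α X → Prop} (t : TauV μ α X) (zero : p 0)
    (tm : ∀ θ x, p (tmul θ x)) (add : ∀ s t, p s → p t → p (s + t)) : p t :=
  TensorProduct.induction_on t zero tm add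

/-- Additive maps out of `E^∨ ⊗_μ X`. -/
def lift {Z : Type u} [AddCommGroup Z] (f : CoE μ α → X → Z)
    (h₁ : ∀ θ θ' x, f (θ + θ') x = f θ x + f θ' x) (h₂ : ∀ θ x y, f θ (x + y) = f θ x + f θ y)
    (h₃ : ∀ c θ x, f ((μ.act α c : M.base k α) • θ) x = f θ (c • x)) : TauV μ α X →+ Z :=
  TensorProduct.liftAddHom
    (AddMonoidHom.mk' (fun θ => AddMonoidHom.mk' (fun x => f θ x) (h₂ θ))
      (fun θ θ' => AddMonoidHom.ext (h₁ θ θ'))) h₃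

theorem lift_tmul {Z : Type u} [AddCommGroup Z] (f : CoE μ α → X → Z) (h₁ h₂ h₃) (θ : CoE μ α)
    (x : X) : lift f h₁ h₂ h₃ (tmul θ x) = f θ x := rfl

instance [Module.Finite k X] : Module.Finite k (TauV μ α X) := by
  have := M.finite α
  obtain ⟨n, x, hx⟩ := Module.Finite.exists_fin (R := k) (M := X)
  let f : (Fin n → Module.Dual k (M.base k α)) →ₗ[k] TauV μ α X :=
    { toFun := fun θ => ∑ i, tmul (CoE.mk (θ i)) (x i)
      map_add' := fun θ θ' => by
        rw [← Finset.sum_add_distrib]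
        exact Finset.sum_congr rfl fun i _ => add_tmul _ _ _
      map_smul' := fun c θ => by
        rw [RingHom.id_apply, Finset.smul_sum]
        refine Finset.sum_congr rfl fun i _ => ?_
        rw [smul_tmul]
        congr 1
        apply LinearMap.ext
        intro e
        change c • θ i e = θ i (algebraMap k (M.base k α) c * e)
        rw [← Algebra.smul_def, map_smul] }
  refine Module.Finite.of_surjective f fun t => ?_
  induction t using induction with
  | zero => exact ⟨0, map_zero f⟩
  | add s t hs ht =>
    obtain ⟨s, rfl⟩ := hs
    obtain ⟨t, rfl⟩ := ht
    exact ⟨s + t, map_add f s t⟩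
  | tm θ y =>
    have hy : y ∈ Submodule.span k (Set.range x) := hx ▸ Submodule.mem_top
    obtain ⟨c, rfl⟩ := (Submodule.mem_span_range_iff_exists_fun k).1 hy
    refine ⟨fun i => CoE.toDual (c i • θ), ?_⟩
    change ∑ i, tmul (c i • θ) (x i) = TensorProduct.tmul k θ (∑ i, c i • x i)
    rw [TensorProduct.tmul_sum]
    exact Finset.sum_congr rfl fun i _ => TensorProduct.smul_tmul _ _ _

/-- Functoriality of `E_α^∨ ⊗_μ X` in `X`. -/
def map (f : X →ₗ[k] Y) : TauV μ α X →ₗ[M.base k α] TauV μ α Y where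
  toFun := lift (fun θ x => tmul θ (f x)) (fun _ _ _ => add_tmul _ _ _)
    (fun _ _ _ => by rw [map_add, tmul_add]) (fun _ _ _ => by rw [act_smul_tmul, map_smul])
  map_add' := map_add _
  map_smul' e t := by
    rw [RingHom.id_apply]
    induction t using induction with
    | zero => simp
    | add s t hs ht => simp only [smul_add, map_add, hs, ht]
    | tm θ x => rfl

theorem map_tmul (f : X →ₗ[k] Y) (θ : CoE μ α) (x : X) :
    map (μ := μ) (α := α) f (tmul θ x) = tmul θ (f x) := rfl

end TauV

namespace TauV
variable {μ : MAction M k} {α : M.I} {X : Type u} [AddCommGroup X] [Module k X]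
  {B : Type u} [CommRing B] [Algebra k B] [Algebra k₀ B] [IsScalarTower k₀ k B]
  {B' : Type u} [CommRing B'] [Algebra k B'] [Algebra k₀ B'] [IsScalarTower k₀ k B']

/-- For `σ : B → B' ⊗ E₀,α` semi-linear over `μ`, and a functional `θ`, the map
`X ⊗ B → (E_α^∨ ⊗_μ X) ⊗ B'`, `x ⊗ b ↦ ∑ (d_i θ ⊗ x) ⊗ b_i`, where `σ(b) = ∑ b_i ⊗ d_i`. -/
def tw (σ : B →+ B' ⊗[k₀] M.E α)
    (hσ : ∀ c b, σ (c • b) = mapL (IsScalarTower.toAlgHom k₀ k B') (M.E α) (μ.act α c) * σ b)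
    (θ : CoE μ α) : X ⊗[k] B →+ TauV μ α X ⊗[k] B' :=
  TensorProduct.liftAddHom
    (AddMonoidHom.mk' (fun x => (coeffAct B' (tmul θ x)).comp σ)
      (fun x y => AddMonoidHom.ext fun b => by
        simp only [AddMonoidHom.comp_apply, AddMonoidHom.add_apply, tmul_add, coeffAct_add]))
    (fun c x b => by
      change coeffAct B' (tmul θ (c • x)) (σ b) = coeffAct B' (tmul θ x) (σ (c • b))
      rw [hσ, coeffAct_mul, base_smul_tmul, act_smul_tmul])

theorem tw_tmul (σ : B →+ B' ⊗[k₀] M.E α) (hσ) (θ : CoE μ α) (x : X) (b : B) :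
    tw σ hσ θ (x ⊗ₜ b) = coeffAct B' (tmul θ x) (σ b) := rfl

theorem tw_add (σ : B →+ B' ⊗[k₀] M.E α) (hσ) (θ θ' : CoE μ α) (t : X ⊗[k] B) :
    tw σ hσ (θ + θ') t = tw σ hσ θ t + tw σ hσ θ' t := by
  induction t with
  | zero => simp
  | add x y hx hy => simp only [map_add, hx, hy]; abel
  | tmul x b => simp only [tw_tmul, add_tmul, coeffAct_add]

theorem tw_act (σ : B →+ B' ⊗[k₀] M.E α) (hσ) (c : k) (θ : CoE μ α) (t : X ⊗[k] B) :
    tw σ hσ ((μ.act α c : M.base k α) • θ) t = tw σ hσ θ (c • t) := by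
  induction t with
  | zero => simp
  | add x y hx hy => simp only [map_add, smul_add, hx, hy]
  | tmul x b => rw [TensorProduct.smul_tmul', tw_tmul, tw_tmul, act_smul_tmul]

theorem tw_base (σ : B →+ B' ⊗[k₀] M.E α) (hσ) (e : M.base k α) (θ : CoE μ α) (t : X ⊗[k] B) :
    tw σ hσ (e • θ) t =
      LinearMap.rTensor B' (Algebra.lsmul k k (TauV μ α X) e) (tw σ hσ θ t) := by
  induction t with
  | zero => simp
  | add x y hx hy => simp only [map_add, hx, hy]
  | tmul x b =>
    rw [tw_tmul, tw_tmul, coeffAct_map]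
    · rfl
    · intro e' n
      simp only [Algebra.lsmul_coe]
      exact smul_comm _ _ _

end TauV

namespace MGroup
variable {μ : MAction M k} (G : MGroup μ) (α : M.I)

theorem s_smul (c : k) (a : G.A) : (G.s.act α).toRingHom.toAddMonoidHom (c • a) =
    mapL (IsScalarTower.toAlgHom k₀ k G.A) (M.E α) (μ.act α c) *
      (G.s.act α).toRingHom.toAddMonoidHom a :=
  G.s.act_smul α c a

/-- The map `x ⊗ a ↦ ∑ (d_i θ ⊗ x) ⊗ a_i`, where `∑ a_i ⊗ d_i` is the image of `a` under the action of
`M₀` on `G`. -/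
def twist {X : Type u} [AddCommGroup X] [Module k X] (θ : CoE μ α) :
    X ⊗[k] G.A →+ TauV μ α X ⊗[k] G.A :=
  TauV.tw (G.s.act α).toRingHom.toAddMonoidHom (G.s_smul α) θ

theorem twist_tmul {X : Type u} [AddCommGroup X] [Module k X] (θ : CoE μ α) (x : X) (a : G.A) :
    G.twist α θ (x ⊗ₜ[k] a) = coeffAct G.A (TauV.tmul θ x) (G.s.act α a) := rfl

theorem twist_base {X : Type u} [AddCommGroup X] [Module k X] (e : M.base k α) (θ : CoE μ α)
    (t : X ⊗[k] G.A) : G.twist α (e • θ) t =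
      LinearMap.rTensor G.A (Algebra.lsmul k k (TauV μ α X) e) (G.twist α θ t) :=
  TauV.tw_base _ _ _ _ _

/-- The coaction on `E_α^∨ ⊗_μ X`, as an additive map. -/
def tauρAdd (X : RepCat k G.A) : TauV μ α X.V →+ TauV μ α X.V ⊗[k] G.A :=
  TauV.lift (fun θ x => G.twist α θ (X.ρ x))
    (fun _ _ _ => TauV.tw_add _ _ _ _ _) (fun _ _ _ => by rw [map_add, map_add])
    (fun _ _ _ => by rw [map_smul]; exact TauV.tw_act _ _ _ _ _)

theorem tauρAdd_tmul (X : RepCat k G.A) (θ : CoE μ α) (x : X.V) :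
    G.tauρAdd α X (TauV.tmul θ x) = G.twist α θ (X.ρ x) := rfl

theorem tauρAdd_base (X : RepCat k G.A) (e : M.base k α) (t : TauV μ α X.V) :
    G.tauρAdd α X (e • t) =
      LinearMap.rTensor G.A (Algebra.lsmul k k (TauV μ α X.V) e) (G.tauρAdd α X t) := by
  induction t using TauV.induction with
  | zero => simp
  | add s t hs ht => simp only [smul_add, map_add, hs, ht]
  | tm θ x => rw [TauV.base_smul_tmul, tauρAdd_tmul, tauρAdd_tmul, twist_base]

/-- The action of `G` on `E_α^∨ ⊗_μ X`: it is the composite of the action of `G(B)` on `X` with the map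
`G(B) → G(B ⊗ E₀,α)` coming from the action of `M₀` on `G`. As a coaction,
`θ ⊗ x ↦ ∑ (d_i θ ⊗ x_j) ⊗ a_i`, where `ρ(x) = ∑ x_j ⊗ a` and `∑ a_i ⊗ d_i` is the image of `a`. -/
def tauρ (X : RepCat k G.A) : TauV μ α X.V →ₗ[k] TauV μ α X.V ⊗[k] G.A where
  toFun := G.tauρAdd α X
  map_add' := map_add _
  map_smul' c t := by
    rw [RingHom.id_apply, ← algebraMap_smul (M.base k α) c t, tauρAdd_base]
    have h : Algebra.lsmul k k (TauV μ α X.V) (algebraMap k (M.base k α) c) =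
        c • LinearMap.id := LinearMap.ext fun _ => rfl
    rw [h, LinearMap.rTensor_smul, LinearMap.rTensor_id]
    rfl

theorem tauρ_tmul (X : RepCat k G.A) (θ : CoE μ α) (x : X.V) :
    G.tauρ α X (TauV.tmul θ x) = G.twist α θ (X.ρ x) := rfl

theorem tauρ_base (X : RepCat k G.A) (e : M.base k α) (t : TauV μ α X.V) :
    G.tauρ α X (e • t) =
      LinearMap.rTensor G.A (Algebra.lsmul k k (TauV μ α X.V) e) (G.tauρ α X t) :=
  G.tauρAdd_base α X e t

theorem twist_counit {X : Type u} [AddCommGroup X] [Module k X] (θ : CoE μ α)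
    (t : X ⊗[k] G.A) :
    TensorProduct.rid k (TauV μ α X) (LinearMap.lTensor (TauV μ α X)
      (Coalgebra.counit (R := k) (A := G.A)) (G.twist α θ t)) =
    TauV.tmul θ (TensorProduct.rid k X (LinearMap.lTensor X
      (Coalgebra.counit (R := k) (A := G.A)) t)) := by
  induction t with
  | zero => simp [TauV.tmul_zero]
  | add s t hs ht => simp only [map_add, hs, ht, TauV.tmul_add]
  | tmul x a =>
    rw [twist_tmul]
    have h := coeffAct_coeff (Bialgebra.counitAlgHom k G.A) (TauV.tmul θ x) (G.s.act α a)
    rw [G.counit] at h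
    refine (congrArg (TensorProduct.rid k (TauV μ α X)) h).trans ?_
    rw [rid_coeffAct, TauV.base_smul_tmul, TauV.act_smul_tmul, LinearMap.lTensor_tmul,
      TensorProduct.rid_tmul]

theorem prod_smul (c : k) (t : G.A ⊗[k] G.A) :
    MAlgebra.prodAct G.s G.s α (c • t) =
      mapL (IsScalarTower.toAlgHom k₀ k (G.A ⊗[k] G.A)) (M.E α) (μ.act α c) *
        MAlgebra.prodAct G.s G.s α t := by
  induction t with
  | zero => simp
  | add s t hs ht => simp only [smul_add, map_add, mul_add, hs, ht]
  | tmul a b =>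
    rw [TensorProduct.smul_tmul', MAlgebra.prodAct_tmul, MAlgebra.prodAct_tmul,
      MAlgebra.act_smul, map_mul, mul_assoc]
    congr 1
    rw [← AlgHom.comp_apply, ← Algebra.TensorProduct.map_comp]
    rfl

theorem lTensor_comul_twist {X : Type u} [AddCommGroup X] [Module k X] (θ : CoE μ α)
    (t : X ⊗[k] G.A) :
    LinearMap.lTensor (TauV μ α X) (Coalgebra.comul (R := k) (A := G.A)) (G.twist α θ t) =
    TauV.tw (MAlgebra.prodAct G.s G.s α) (G.prod_smul α) θ
      (LinearMap.lTensor X (Coalgebra.comul (R := k) (A := G.A)) t) := by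
  induction t with
  | zero => simp
  | add s t hs ht => simp only [map_add, hs, ht]
  | tmul x a =>
    rw [twist_tmul]
    have h := coeffAct_coeff (Bialgebra.comulAlgHom k G.A) (TauV.tmul θ x) (G.s.act α a)
    rw [G.comul] at h
    exact h

/-- The additive map `b ↦ (s(b) ⊗ 1) * (1 ⊗ r)`. -/
def leftMul (r : G.A ⊗[k₀] M.E α) : G.A →+ (G.A ⊗[k] G.A) ⊗[k₀] M.E α :=
  (AddMonoidHom.mulRight (mapL (MAlgebra.inr k₀ k G.A G.A) (M.E α) r)).comp
    ((mapL (MAlgebra.inl k₀ k G.A G.A) (M.E α)).comp (G.s.act α)).toRingHom.toAddMonoidHom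

theorem leftMul_apply (r : G.A ⊗[k₀] M.E α) (b : G.A) :
    G.leftMul α r b = mapL (MAlgebra.inl k₀ k G.A G.A) (M.E α) (G.s.act α b) *
      mapL (MAlgebra.inr k₀ k G.A G.A) (M.E α) r := rfl

theorem leftMul_smul (r : G.A ⊗[k₀] M.E α) (c : k) (b : G.A) : G.leftMul α r (c • b) =
    mapL (IsScalarTower.toAlgHom k₀ k (G.A ⊗[k] G.A)) (M.E α) (μ.act α c) *
      G.leftMul α r b := by
  rw [leftMul_apply, leftMul_apply, MAlgebra.act_smul, map_mul, mul_assoc]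
  congr 1
  rw [← AlgHom.comp_apply, ← Algebra.TensorProduct.map_comp]
  rfl

theorem tw_leftMul_tmul {X : Type u} [AddCommGroup X] [Module k X] (θ : CoE μ α)
    (b : G.A) (d : M.E α) (t : X ⊗[k] G.A) :
    TauV.tw (G.leftMul α (b ⊗ₜ d)) (G.leftMul_smul α _) θ t =
      TensorProduct.assoc k _ G.A G.A (G.twist α (((1 : k) ⊗ₜ[k₀] d : M.base k α) • θ) t ⊗ₜ b) := by
  induction t with
  | zero => simp
  | add s t hs ht => simp only [map_add, TensorProduct.add_tmul, hs, ht]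
  | tmul x a =>
    rw [twist_tmul, TauV.tw_tmul, leftMul_apply, ← TauV.base_smul_tmul, assoc_coeffAct]

theorem tw_leftMul_add {X : Type u} [AddCommGroup X] [Module k X] (θ : CoE μ α)
    (r r' : G.A ⊗[k₀] M.E α) (t : X ⊗[k] G.A) :
    TauV.tw (G.leftMul α (r + r')) (G.leftMul_smul α _) θ t =
      TauV.tw (G.leftMul α r) (G.leftMul_smul α _) θ t +
      TauV.tw (G.leftMul α r') (G.leftMul_smul α _) θ t := by
  induction t with
  | zero => simp
  | add s t hs ht => simp only [map_add, hs, ht]; abel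
  | tmul x a => simp only [TauV.tw_tmul, leftMul_apply, map_add, mul_add]

theorem tw_leftMul_zero {X : Type u} [AddCommGroup X] [Module k X] (θ : CoE μ α)
    (t : X ⊗[k] G.A) :
    TauV.tw (G.leftMul α 0) (G.leftMul_smul α _) θ t = 0 := by
  induction t with
  | zero => simp
  | add s t hs ht => simp only [map_add, hs, ht, add_zero]
  | tmul x a => simp only [TauV.tw_tmul, leftMul_apply, map_zero, mul_zero]

theorem assoc_twist (X : RepCat k G.A) (θ : CoE μ α) (y : X.V) (r : G.A ⊗[k₀] M.E α) :
    TensorProduct.assoc k _ G.A G.A (LinearMap.rTensor G.A (G.tauρ α X)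
      (coeffAct G.A (TauV.tmul θ y) r)) =
    TauV.tw (G.leftMul α r) (G.leftMul_smul α r) θ (X.ρ y) := by
  induction r with
  | zero => rw [map_zero, map_zero, map_zero, tw_leftMul_zero]
  | add s t hs ht => rw [map_add, map_add, map_add, tw_leftMul_add, hs, ht]
  | tmul b d => rw [coeffAct_tmul, TauV.base_smul_tmul, LinearMap.rTensor_tmul, tauρ_tmul,
      tw_leftMul_tmul]

theorem tw_prod_assoc {X : Type u} [AddCommGroup X] [Module k X] (θ : CoE μ α) (a : G.A)
    (t : X ⊗[k] G.A) :
    TauV.tw (MAlgebra.prodAct G.s G.s α) (G.prod_smul α) θ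
      (TensorProduct.assoc k X G.A G.A (t ⊗ₜ a)) =
    TauV.tw (G.leftMul α (G.s.act α a)) (G.leftMul_smul α _) θ t := by
  induction t with
  | zero => simp
  | add s t hs ht => simp only [map_add, TensorProduct.add_tmul, hs, ht]
  | tmul x b => rfl

theorem assoc_rTensor_twist (X : RepCat k G.A) (θ : CoE μ α) (t : X.V ⊗[k] G.A) :
    TensorProduct.assoc k _ G.A G.A (LinearMap.rTensor G.A (G.tauρ α X) (G.twist α θ t)) =
    TauV.tw (MAlgebra.prodAct G.s G.s α) (G.prod_smul α) θ
      (TensorProduct.assoc k _ G.A G.A (LinearMap.rTensor G.A X.ρ t)) := by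
  induction t with
  | zero => simp
  | add s t hs ht => simp only [map_add, hs, ht]
  | tmul x a => rw [twist_tmul, assoc_twist, LinearMap.rTensor_tmul, tw_prod_assoc]

/-- The representation `τ_α(X) = E_α^∨ ⊗_μ X` of `G`. -/
abbrev tauObj (X : RepCat k G.A) : RepCat k G.A where
  V := TauV μ α X.V
  ρ := G.tauρ α X
  counit := by
    refine LinearMap.ext fun t => ?_
    simp only [LinearMap.comp_apply, LinearEquiv.coe_coe, LinearMap.id_apply]
    induction t using TauV.induction with
    | zero => simp
    | add s t hs ht => simp only [map_add, hs, ht]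
    | tm θ x =>
      rw [tauρ_tmul, twist_counit]
      exact congrArg _ (LinearMap.congr_fun X.counit x)
  coassoc := by
    refine LinearMap.ext fun t => ?_
    simp only [LinearMap.comp_apply, LinearEquiv.coe_coe]
    induction t using TauV.induction with
    | zero => simp
    | add s t hs ht => simp only [map_add, hs, ht]
    | tm θ x =>
      rw [tauρ_tmul, assoc_rTensor_twist, lTensor_comul_twist]
      exact congrArg _ (LinearMap.congr_fun X.coassoc x)

theorem twist_map {X Y : Type u} [AddCommGroup X] [Module k X] [AddCommGroup Y] [Module k Y]
    (f : X →ₗ[k] Y) (θ : CoE μ α) (t : X ⊗[k] G.A) :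
    G.twist α θ (LinearMap.rTensor G.A f t) =
      LinearMap.rTensor G.A ((TauV.map (μ := μ) (α := α) f).restrictScalars k)
        (G.twist α θ t) := by
  induction t with
  | zero => simp
  | add s t hs ht => simp only [map_add, hs, ht]
  | tmul x a =>
    rw [LinearMap.rTensor_tmul, twist_tmul, twist_tmul, coeffAct_map]
    · rfl
    · exact fun e n => (TauV.map f).map_smul e n

/-- `τ_α` on maps. -/
def tauMap {X Y : RepCat k G.A} (f : X ⟶ Y) : G.tauObj α X ⟶ G.tauObj α Y :=
  RepCat.ofLin ((TauV.map (RepCat.lin f)).restrictScalars k) (by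
    refine LinearMap.ext fun t => ?_
    simp only [LinearMap.comp_apply]
    induction t using TauV.induction with
    | zero => simp
    | add s t hs ht => simp only [map_add, hs, ht]
    | tm θ x =>
      change G.tauρ α Y (TauV.tmul θ (RepCat.lin f x)) = _
      rw [tauρ_tmul, tauρ_tmul, RepCat.ρ_lin, twist_map])

/-- The action of `E_α` on `E_α^∨ ⊗_μ X`. -/
def tauAct (X : RepCat k G.A) : M.base k α →ₐ[k] End (G.tauObj α X) where
  toFun e := RepCat.ofLin (Algebra.lsmul k k (TauV μ α X.V) e) (LinearMap.ext fun t =>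
    G.tauρ_base α X e t)
  map_one' := RepCat.hom_ext (LinearMap.ext fun t => one_smul _ t)
  map_mul' e e' := RepCat.hom_ext (LinearMap.ext fun t => mul_smul e e' t)
  map_zero' := RepCat.hom_ext (LinearMap.ext fun t => zero_smul _ t)
  map_add' e e' := RepCat.hom_ext (LinearMap.ext fun t => add_smul e e' t)
  commutes' c := RepCat.hom_ext (LinearMap.ext fun t => algebraMap_smul _ c t)

/-- `τ_α(X)` as an `E_α`-module in the category of representations. -/
def tauMod (X : RepCat k G.A) : EMod k (M.base k α) (RepCat k G.A) where
  X := G.tauObj α X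
  act := G.tauAct α X

end MGroup

namespace TauV
variable {μ : MAction M k} {α β γ : M.I} {X : Type u} [AddCommGroup X] [Module k X]
  {B : Type u} [CommRing B] [Algebra k B] [Algebra k₀ B] [IsScalarTower k₀ k B]

/-- The transpose `E_β^∨ → E_α^∨` of `E_α → E_β`. -/
def coRes (f : α ⟶ β) (θ : CoE μ β) : CoE μ α :=
  CoE.mk (CoE.toDual θ ∘ₗ (M.baseRes k f).toLinearMap)

theorem base_smul_coRes (f : α ⟶ β) (e : M.base k α) (θ : CoE μ β) :
    e • coRes f θ = coRes f (M.baseRes k f e • θ) := by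
  change CoE.toDual θ ∘ₗ (M.baseRes k f).toLinearMap ∘ₗ LinearMap.mulLeft k e =
    CoE.toDual θ ∘ₗ LinearMap.mulLeft k (M.baseRes k f e) ∘ₗ (M.baseRes k f).toLinearMap
  congr 1
  refine LinearMap.ext fun x => ?_
  exact map_mul (M.baseRes k f) e x

theorem coRes_add (f : α ⟶ β) (θ θ' : CoE μ β) : coRes f (θ + θ') = coRes f θ + coRes f θ' := rfl

theorem baseRes_act (μ : MAction M k) (f : α ⟶ β) (c : k) :
    M.baseRes k f (μ.act α c) = μ.act β c :=
  DFunLike.congr_fun (μ.act_res f) c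

/-- The transition map `E_β^∨ ⊗_μ X → E_α^∨ ⊗_μ X`. -/
def res (f : α ⟶ β) : TauV μ β X →ₗ[k] TauV μ α X where
  toFun := lift (fun θ x => tmul (coRes f θ) x)
    (fun θ θ' x => by rw [coRes_add, add_tmul]) (fun _ _ _ => tmul_add _ _ _)
    (fun c θ x => by rw [← baseRes_act μ f, ← base_smul_coRes, act_smul_tmul])
  map_add' := map_add _
  map_smul' c t := by
    rw [RingHom.id_apply]
    induction t using induction with
    | zero => simp
    | add s t hs ht => simp only [smul_add, map_add, hs, ht]
    | tm θ x =>
      rw [smul_tmul, lift_tmul, lift_tmul, smul_tmul, base_smul_coRes, AlgHom.commutes]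

theorem res_tmul (f : α ⟶ β) (θ : CoE μ β) (x : X) : res f (tmul θ x) = tmul (coRes f θ) x := rfl

theorem res_base (f : α ⟶ β) (e : M.base k α) (t : TauV μ β X) :
    res f (M.baseRes k f e • t) = e • res f t := by
  induction t using induction with
  | zero => simp
  | add s t hs ht => simp only [smul_add, map_add, hs, ht]
  | tm θ x => rw [res_tmul, base_smul_tmul, base_smul_tmul, res_tmul, base_smul_coRes]

theorem rTensor_res (f : α ⟶ β) (n : TauV μ β X) (t : B ⊗[k₀] M.E α) :
    LinearMap.rTensor B (res f) (coeffAct B n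
      (Algebra.TensorProduct.map (AlgHom.id k₀ B) (M.res f) t)) = coeffAct B (res f n) t := by
  induction t with
  | zero => simp
  | add s t hs ht => simp only [map_add, hs, ht]
  | tmul b d =>
    rw [Algebra.TensorProduct.map_tmul, coeffAct_tmul, coeffAct_tmul, LinearMap.rTensor_tmul,
      ← res_base]
    simp

end TauV

namespace MGroup
variable {μ : MAction M k} (G : MGroup μ) {α β : M.I}

theorem rTensor_res_twist (f : α ⟶ β) {X : Type u} [AddCommGroup X] [Module k X]
    (θ : CoE μ β) (t : X ⊗[k] G.A) :
    LinearMap.rTensor G.A (TauV.res f) (G.twist β θ t) = G.twist α (TauV.coRes f θ) t := by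
  induction t with
  | zero => simp
  | add s t hs ht => simp only [map_add, hs, ht]
  | tmul x a =>
    have h : G.s.act β a = Algebra.TensorProduct.map (AlgHom.id k₀ G.A) (M.res f) (G.s.act α a) :=
      (DFunLike.congr_fun (G.s.act_res f) a).symm
    rw [twist_tmul, h]
    exact TauV.rTensor_res f _ _

/-- The transition map `τ_β(X) → τ_α(X)`. -/
def tauTr (f : α ⟶ β) (X : RepCat k G.A) : G.tauObj β X ⟶ G.tauObj α X :=
  RepCat.ofLin (TauV.res f) (by
    refine LinearMap.ext fun t => ?_
    simp only [LinearMap.comp_apply]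
    induction t using TauV.induction with
    | zero => simp
    | add s t hs ht => simp only [map_add, hs, ht]
    | tm θ x => rw [TauV.res_tmul, tauρ_tmul, tauρ_tmul, rTensor_res_twist])

/-- `τ(X) = E^∨ ⊗_μ X`, with all its structure. -/
def tauSys (X : RepCat k G.A) : ModSys M.toProFiniteAlg k (RepCat k G.A) where
  obj α := G.tauMod α X
  tr f := G.tauTr f X
  tr_linear f e := RepCat.hom_ext (LinearMap.ext fun t => TauV.res_base f e t)
  tr_id α := RepCat.hom_ext (LinearMap.ext fun t => by
    change TauV.res (𝟙 α) t = t
    induction t using TauV.induction with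
    | zero => simp
    | add s t hs ht => rw [map_add, hs, ht]
    | tm θ x =>
      rw [TauV.res_tmul]
      congr 1
      refine LinearMap.ext fun y => congrArg (CoE.toDual θ) ?_
      change M.baseRes k (𝟙 α) y = y
      have h : M.res (𝟙 α) = AlgHom.id k₀ _ := by
        simp [ProFiniteAlg.res]
      rw [ProFiniteAlg.baseRes, h, Algebra.TensorProduct.map_id]
      rfl)
  tr_comp {α β γ} f g := RepCat.hom_ext (LinearMap.ext fun t => by
    change TauV.res (f ≫ g) t = TauV.res f (TauV.res g t)
    induction t using TauV.induction with
    | zero => simp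
    | add s t hs ht => rw [map_add, hs, ht, map_add, map_add]
    | tm θ x =>
      rw [TauV.res_tmul, TauV.res_tmul, TauV.res_tmul]
      congr 1
      refine LinearMap.ext fun y => congrArg (CoE.toDual θ) ?_
      change M.baseRes k (f ≫ g) y = M.baseRes k g (M.baseRes k f y)
      have h : M.res (f ≫ g) = (M.res g).comp (M.res f) := by
        simp [ProFiniteAlg.res]
      rw [ProFiniteAlg.baseRes, h, ← AlgHom.comp_apply, ← Algebra.TensorProduct.map_comp,
        AlgHom.id_comp])

/-- The functor `X ↦ E^∨ ⊗_μ X`. -/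
def tau : RepCat k G.A ⥤ ModSys M.toProFiniteAlg k (RepCat k G.A) where
  obj X := G.tauSys X
  map f :=
    { app := fun α =>
        { hom := G.tauMap α f
          comm := fun e => RepCat.hom_ext (LinearMap.ext fun t =>
            (TauV.map (RepCat.lin f)).map_smul e t) }
      tr_app := fun {α β} g => RepCat.hom_ext (LinearMap.ext fun t => by
        change TauV.map (RepCat.lin f) (TauV.res g t) = TauV.res g (TauV.map (RepCat.lin f) t)
        induction t using TauV.induction with
        | zero => simp
        | add s t hs ht => simp only [map_add, hs, ht]
        | tm θ x => rfl) }
  map_id X := ModSys.Hom.ext (funext fun α => EMod.Hom.ext (RepCat.hom_ext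
    (LinearMap.ext fun t => by
      change TauV.map (LinearMap.id) t = t
      induction t using TauV.induction with
      | zero => simp
      | add s t hs ht => rw [map_add, hs, ht]
      | tm θ x => rfl)))
  map_comp {X Y Z} f g := ModSys.Hom.ext (funext fun α => EMod.Hom.ext (RepCat.hom_ext
    (LinearMap.ext fun t => by
      change TauV.map (RepCat.lin g ∘ₗ RepCat.lin f) t =
        TauV.map (RepCat.lin g) (TauV.map (RepCat.lin f) t)
      induction t using TauV.induction with
      | zero => simp
      | add s t hs ht => simp only [map_add, hs, ht]
      | tm θ x => rfl)))

end MGroup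

end Tau

end OpTensor

/-! That $\mathrm{Rep}_G$ is a tensor category is classical. Kernels and cokernels are those of
vector spaces, because $-\otimes_k A$ is exact. Hom spaces and chains of subobjects are bounded by
dimensions. The dual is given by the antipode of the transposed matrix of coefficients.

For $\tau$, a $k$-basis $b$ of $X$ identifies $\tau_\alpha(X)=E_\alpha^\vee\otimes_\mu X$, as an
$E_\alpha$-module, with a finite sum of copies of $E_\alpha^\vee$; the coordinates are the maps
`TauV.contractDual (b.coord i)`. So the assertions reduce to $E_\alpha^\vee$, where two facts
suffice: evaluation at 1 turns $E_\alpha$-linear maps $Z\to E_\alpha^\vee$ into functionals on $Z$;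
and, $E_\alpha$ being finite dimensional, $E_\alpha^{\vee\vee}=E_\alpha$ and $E_\alpha^\vee\otimes
E_\alpha^\vee$ is the space of bilinear forms on $E_\alpha$.

By the first fact, a map from an $F$-module $Y$ to $\tau_\gamma(X)$ exhibits $Y$ as
$f^!\tau_\gamma(X)$ as soon as elements of $Y$ correspond to families, indexed by the basis, of
functionals on $F$ (`MGroup.isCartesian_tau`). This one criterion gives the transition maps,
$i^!\tau=\mathrm{Id}$ and $\tau\tau=m^!\tau$. By reflexivity the dual of $\tau_\alpha(X)$ is a free
$E_\alpha$-module, so $\tau_\alpha(X)$ is injective (`MGroup.isInjective_tauMod`). Exactness holds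
because $E_\alpha^\vee\otimes_\mu-$ is a tensor product over a field.

The tensor structure comes from the transpose `dualComul` of the multiplication of $E_\alpha$. A
form $U$ on $E_\alpha$ is balanced exactly when $U(e,e')=U(1,ee')$, that is, when it lies in the
image of `dualComul`; hence $\tau(X\otimes Y)$ is the balanced part of $\tau(X)\otimes\tau(Y)$
(`TauV.δ_injective`, `TauV.exists_δ_eq`).

For the product, $E_\beta\otimes_k E_\alpha$ is regarded as $E_\alpha\otimes_k E_\beta$ with $k$
acting on $E_\alpha$ through $\mu_\alpha$. Functionals $\theta$ on $E_\alpha$ and $\eta$ on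
$E_\beta$ then combine to a functional `conv` with value $\theta(s\,\mu_\alpha(\eta(e)))$ at
$s\otimes e$, and $\theta\otimes(\eta\otimes x)$ is sent to its restriction along $m$, tensored with
$x$.

Equivariance of the structure maps translates the axioms on the action $s$ of $M_0$ on $G$:
$s_\alpha$ is multiplicative for the tensor structure, and the unit and product laws of the action
give the base point and the product. -/

namespace OpTensor

/-! ### Kernels, cokernels, direct sums and finiteness in $\mathrm{Rep}_G$. -/

namespace RepCat
open scoped TensorProduct
open MonoidalCategory Limits
variable {k : Type u} [Field k] {A : Type u} [CommRing A] [HopfAlgebra k A]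

/-- Extension of scalars preserves jointly injective families of linear maps. -/
theorem rTensor_jointly_injective (A : Type*) [AddCommGroup A] [Module k A] {ι : Type*}
    {U : Type*} [AddCommGroup U] [Module k U]
    {W : ι → Type*} [∀ i, AddCommGroup (W i)] [∀ i, Module k (W i)] (f : ∀ i, U →ₗ[k] W i)
    (hf : ∀ x, (∀ i, f i x = 0) → x = 0) (t : U ⊗[k] A)
    (ht : ∀ i, LinearMap.rTensor A (f i) t = 0) : t = 0 := by
  -- In a basis of `A`, a tensor is a finitely supported family in `U`, and each `f i ⊗ A` acts
  -- member by member. The family `f` may therefore be infinite.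
  let b := Module.Free.chooseBasis k A
  have key : ∀ i (s : U ⊗[k] A) j,
      TensorProduct.equivFinsuppOfBasisRight b (LinearMap.rTensor A (f i) s) j =
      f i (TensorProduct.equivFinsuppOfBasisRight b s j) := by
    intro i s j
    induction s with
    | zero => simp
    | add x y hx hy => simp only [map_add, Finsupp.add_apply, hx, hy]
    | tmul x a => simp
  apply (TensorProduct.equivFinsuppOfBasisRight b).injective
  rw [map_zero]
  ext j
  refine hf _ fun i => ?_
  rw [← key, ht, map_zero, Finsupp.zero_apply]

theorem rTensor_injective (A : Type*) [AddCommGroup A] [Module k A] {U W : Type*}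
    [AddCommGroup U] [Module k U] [AddCommGroup W] [Module k W] (f : U →ₗ[k] W)
    (hf : Function.Injective f) : Function.Injective (LinearMap.rTensor A f) :=
  Module.Flat.rTensor_preserves_injective_linearMap f hf

/-- The coaction of a representation on the image of an injective map, when it is stable. -/
abbrev sub (X : RepCat k A) (U : Type u) [AddCommGroup U] [Module k U] [Module.Finite k U]
    (j : U →ₗ[k] X.V) (hj : Function.Injective j) (r : U →ₗ[k] U ⊗[k] A)
    (h : ∀ u, LinearMap.rTensor A j (r u) = X.ρ (j u)) : RepCat k A where
  V := U
  ρ := r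
  counit := by
    have key : ∀ t : U ⊗[k] A, j (TensorProduct.rid k U (LinearMap.lTensor U
        (Coalgebra.counit (R := k) (A := A)) t)) = TensorProduct.rid k X.V (LinearMap.lTensor X.V
        (Coalgebra.counit (R := k) (A := A)) (LinearMap.rTensor A j t)) := by
      intro t
      induction t with
      | zero => simp
      | add x y hx hy => simp only [map_add, hx, hy]
      | tmul x a => simp
    refine LinearMap.ext fun u => hj ?_
    simp only [LinearMap.comp_apply, LinearEquiv.coe_coe, LinearMap.id_apply]
    rw [key, h]
    exact LinearMap.congr_fun X.counit (j u)
  coassoc := by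
    have h₁ : ∀ t : U ⊗[k] A, LinearMap.rTensor (A ⊗[k] A) j
        (LinearMap.lTensor U (Coalgebra.comul (R := k) (A := A)) t) =
        LinearMap.lTensor X.V (Coalgebra.comul (R := k) (A := A)) (LinearMap.rTensor A j t) := by
      intro t
      induction t with
      | zero => simp
      | add x y hx hy => simp only [map_add, hx, hy]
      | tmul x a => simp
    have h₃ : ∀ (t : U ⊗[k] A) (a : A), LinearMap.rTensor (A ⊗[k] A) j
        (TensorProduct.assoc k U A A (t ⊗ₜ a)) =
        TensorProduct.assoc k X.V A A (LinearMap.rTensor A j t ⊗ₜ a) := by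
      intro t a
      induction t with
      | zero => simp
      | add x y hx hy => simp only [TensorProduct.add_tmul, map_add, hx, hy]
      | tmul x a => simp
    have h₂ : ∀ t : U ⊗[k] A, LinearMap.rTensor (A ⊗[k] A) j
        (TensorProduct.assoc k U A A (LinearMap.rTensor A r t)) =
        TensorProduct.assoc k X.V A A (LinearMap.rTensor A X.ρ (LinearMap.rTensor A j t)) := by
      intro t
      induction t with
      | zero => simp
      | add x y hx hy => simp only [map_add, hx, hy]
      | tmul x a => simp only [LinearMap.rTensor_tmul, h₃, h]
    -- After applying the injective map `j ⊗ A ⊗ A`, the identity becomes the coassociativity of `X`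
    -- at `j u`.
    refine LinearMap.ext fun u => rTensor_injective (A ⊗[k] A) j hj ?_
    simp only [LinearMap.comp_apply, LinearEquiv.coe_coe]
    rw [h₁, h₂, h]
    exact LinearMap.congr_fun X.coassoc (j u)

/-- A coaction on `Q` for which the members of a jointly spanning family of linear maps from
representations are equivariant. -/
abbrev quot {ι : Type*} (X : ι → RepCat k A) (Q : Type u) [AddCommGroup Q] [Module k Q]
    [Module.Finite k Q] (q : ∀ i, (X i).V →ₗ[k] Q) (hq : ⨆ i, LinearMap.range (q i) = ⊤)
    (r : Q →ₗ[k] Q ⊗[k] A)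
    (h : ∀ i x, r (q i x) = LinearMap.rTensor A (q i) ((X i).ρ x)) : RepCat k A where
  V := Q
  ρ := r
  counit := by
    have key : ∀ i (t : (X i).V ⊗[k] A), TensorProduct.rid k Q (LinearMap.lTensor Q
        (Coalgebra.counit (R := k) (A := A)) (LinearMap.rTensor A (q i) t)) =
        q i (TensorProduct.rid k (X i).V (LinearMap.lTensor (X i).V
        (Coalgebra.counit (R := k) (A := A)) t)) := by
      intro i t
      induction t with
      | zero => simp
      | add x y hx hy => simp only [map_add, hx, hy]
      | tmul x a => simp
    refine LinearMap.ext fun y => ?_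
    have hy : y ∈ ⨆ i, LinearMap.range (q i) := hq ▸ Submodule.mem_top
    induction hy using Submodule.iSup_induction' with
    | zero => simp
    | add x y _ _ hx hy => rw [map_add, map_add, hx, hy]
    | mem i y hy =>
      obtain ⟨x, rfl⟩ := hy
      simp only [LinearMap.comp_apply, LinearEquiv.coe_coe, LinearMap.id_apply]
      rw [h, key]
      exact congrArg _ (LinearMap.congr_fun (X i).counit x)
  coassoc := by
    have h₁ : ∀ i (t : (X i).V ⊗[k] A),
        LinearMap.lTensor Q (Coalgebra.comul (R := k) (A := A)) (LinearMap.rTensor A (q i) t) =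
        LinearMap.rTensor (A ⊗[k] A) (q i)
          (LinearMap.lTensor (X i).V (Coalgebra.comul (R := k) (A := A)) t) := by
      intro i t
      induction t with
      | zero => simp
      | add x y hx hy => simp only [map_add, hx, hy]
      | tmul x a => simp
    have h₃ : ∀ i (t : (X i).V ⊗[k] A) (a : A),
        TensorProduct.assoc k Q A A (LinearMap.rTensor A (q i) t ⊗ₜ a) =
        LinearMap.rTensor (A ⊗[k] A) (q i) (TensorProduct.assoc k (X i).V A A (t ⊗ₜ a)) := by
      intro i t a
      induction t with
      | zero => simp
      | add x y hx hy => simp only [TensorProduct.add_tmul, map_add, hx, hy]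
      | tmul x a => simp
    have h₂ : ∀ i (t : (X i).V ⊗[k] A),
        TensorProduct.assoc k Q A A (LinearMap.rTensor A r (LinearMap.rTensor A (q i) t)) =
        LinearMap.rTensor (A ⊗[k] A) (q i)
          (TensorProduct.assoc k (X i).V A A (LinearMap.rTensor A (X i).ρ t)) := by
      intro i t
      induction t with
      | zero => simp
      | add x y hx hy => simp only [map_add, hx, hy]
      | tmul x a => simp only [LinearMap.rTensor_tmul, ← h₃, h]
    refine LinearMap.ext fun y => ?_
    have hy : y ∈ ⨆ i, LinearMap.range (q i) := hq ▸ Submodule.mem_top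
    induction hy using Submodule.iSup_induction' with
    | zero => simp
    | add x y _ _ hx hy => rw [map_add, map_add, hx, hy]
    | mem i y hy =>
      obtain ⟨x, rfl⟩ := hy
      simp only [LinearMap.comp_apply, LinearEquiv.coe_coe]
      rw [h, h₁, h₂]
      exact congrArg _ (LinearMap.congr_fun (X i).coassoc x)

/-- A linear map into a representation is equivariant if it is so after composition with a jointly
injective family of equivariant maps. -/
theorem comm_of_jointly_injective {ι : Type*} {W Y : RepCat k A} {X : ι → RepCat k A}
    (f : ∀ i, Y ⟶ X i) (hf : ∀ x, (∀ i, lin (f i) x = 0) → x = 0) (h : ∀ i, W ⟶ X i)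
    (l : W.V →ₗ[k] Y.V) (hl : ∀ i x, lin (f i) (l x) = lin (h i) x) :
    Y.ρ ∘ₗ l = LinearMap.rTensor A l ∘ₗ W.ρ := by
  refine LinearMap.ext fun x => sub_eq_zero.1 ?_
  -- The defect of equivariance of `l` is killed by every `f i ⊗ A`, since both `f i` and the
  -- composite `f i ∘ l = h i` are equivariant.
  refine rTensor_jointly_injective A (fun i => lin (f i)) hf _ fun i => ?_
  have : lin (f i) ∘ₗ l = lin (h i) := LinearMap.ext fun x => hl i x
  rw [map_sub, LinearMap.comp_apply, LinearMap.comp_apply, ← ρ_lin, hl, ρ_lin,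
    ← LinearMap.comp_apply (LinearMap.rTensor A (lin (f i))), ← LinearMap.rTensor_comp, this,
    sub_self]

/-- Factorization through an injective map. -/
theorem exists_lift {W Y X : RepCat k A} (f : Y ⟶ X) (hf : Function.Injective (lin f)) (h : W ⟶ X)
    (hr : ∀ w, ∃ y, lin f y = lin h w) : ∃! l : W ⟶ Y, l ≫ f = h := by
  choose l hl using hr
  let L : W.V →ₗ[k] Y.V :=
    { toFun := l
      map_add' := fun x y => hf (by rw [map_add, hl, hl, hl, map_add])
      map_smul' := fun c x => hf (by rw [RingHom.id_apply, map_smul, hl, hl, map_smul]) }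
  refine ⟨ofLin L (comm_of_jointly_injective (fun _ : Unit => f)
    (fun x hx => hf ((hx ()).trans (map_zero _).symm)) (fun _ => h) L fun _ => hl), ?_, ?_⟩
  · exact hom_ext (LinearMap.ext hl)
  · intro l' hl'
    refine hom_ext (LinearMap.ext fun x => hf ?_)
    refine (LinearMap.congr_fun (congrArg lin hl') x).trans (hl x).symm

/-- Factorization through a surjective map. -/
theorem exists_desc {W Y X : RepCat k A} (f : X ⟶ Y) (hf : Function.Surjective (lin f)) (h : X ⟶ W)
    (hr : ∀ x, lin f x = 0 → lin h x = 0) : ∃! l : Y ⟶ W, f ≫ l = h := by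
  choose s hs using hf
  have key : ∀ x x', lin f x = lin f x' → lin h x = lin h x' := fun x x' e => by
    rw [← sub_eq_zero, ← map_sub]
    exact hr _ (by rw [map_sub, e, sub_self])
  let L : Y.V →ₗ[k] W.V :=
    { toFun := fun y => lin h (s y)
      map_add' := fun x y => by
        rw [← map_add]
        exact key _ _ (by rw [map_add, hs, hs, hs])
      map_smul' := fun c x => by
        rw [RingHom.id_apply, ← map_smul]
        exact key _ _ (by rw [map_smul, hs, hs]) }
  have hL : ∀ x, L (lin f x) = lin h x := fun x => key _ _ (hs _)
  have hL' : L ∘ₗ lin f = lin h := LinearMap.ext hL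
  refine ⟨ofLin L (LinearMap.ext fun y => ?_), hom_ext hL', ?_⟩
  · rw [← hs y, LinearMap.comp_apply, LinearMap.comp_apply, hL, ρ_lin, ρ_lin,
      ← LinearMap.comp_apply (LinearMap.rTensor A L), ← LinearMap.rTensor_comp, hL']
  · intro l' hl'
    refine hom_ext (LinearMap.ext fun y => ?_)
    rw [← hs y]
    exact (LinearMap.congr_fun (congrArg lin hl') (s y)).trans (hL _).symm

/-- Flatness of `A` makes `ker f ⊗ A` the kernel of `f ⊗ A`, and for `u` in `ker f` equivariance
gives `(f ⊗ A)(ρ u) = ρ (f u) = 0`. -/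
theorem exists_kerρ {X Y : RepCat k A} (f : X ⟶ Y) :
    ∃ r : LinearMap.ker (lin f) →ₗ[k] LinearMap.ker (lin f) ⊗[k] A,
      ∀ u, LinearMap.rTensor A (LinearMap.ker (lin f)).subtype (r u) = X.ρ u := by
  have hex := Module.Flat.rTensor_exact A
    (LinearMap.exact_subtype_ker_map (lin f))
  have hinj := rTensor_injective A (LinearMap.ker (lin f)).subtype Subtype.val_injective
  have hr : ∀ u : LinearMap.ker (lin f), ∃ t,
      LinearMap.rTensor A (LinearMap.ker (lin f)).subtype t = X.ρ u := fun u => by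
    refine (hex _).1 ?_
    rw [← ρ_lin, LinearMap.mem_ker.1 u.2, map_zero]
  choose r hr using hr
  exact ⟨{ toFun := r
           map_add' := fun x y => hinj (by rw [map_add, hr, hr, hr, Submodule.coe_add, map_add])
           map_smul' := fun c x => hinj (by
            rw [RingHom.id_apply, map_smul, hr, hr, Submodule.coe_smul, map_smul]) }, hr⟩

/-- The kernel of a map of representations. -/
noncomputable abbrev kerObj {X Y : RepCat k A} (f : X ⟶ Y) : RepCat k A :=
  sub X (LinearMap.ker (lin f)) (LinearMap.ker (lin f)).subtype Subtype.val_injective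
    (exists_kerρ f).choose (exists_kerρ f).choose_spec

/-- The inclusion of the kernel. -/
noncomputable def kerι {X Y : RepCat k A} (f : X ⟶ Y) : kerObj f ⟶ X :=
  ofLin (X := kerObj f) (LinearMap.ker (lin f)).subtype
    (LinearMap.ext fun u => ((exists_kerρ f).choose_spec u).symm)

theorem kerι_injective {X Y : RepCat k A} (f : X ⟶ Y) : Function.Injective (lin (kerι f)) :=
  Subtype.val_injective

theorem kerι_comp {X Y : RepCat k A} (f : X ⟶ Y) : kerι f ≫ f = 0 :=
  hom_ext (LinearMap.ext fun u => u.2)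

/-- An injective map whose image is the kernel of `g` is a kernel of `g`. -/
theorem nonempty_isLimit_of_exact {W X Y : RepCat k A} (f : W ⟶ X) (g : X ⟶ Y)
    (w : f ≫ g = 0) (hf : Function.Injective (lin f))
    (h : ∀ x, lin g x = 0 → ∃ y, lin f y = x) : Nonempty (IsLimit (KernelFork.ofι f w)) := by
  have key : ∀ {W' : RepCat k A} (g' : W' ⟶ X) (_ : g' ≫ g = 0), ∃! l, l ≫ f = g' :=
    fun g' hg' => exists_lift f hf g' fun x => h _ (LinearMap.congr_fun (congrArg lin hg') x)
  exact ⟨KernelFork.IsLimit.ofι f w (fun g' hg' => (key g' hg').choose)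
    (fun g' hg' => (key g' hg').choose_spec.1) (fun g' hg' m hm => (key g' hg').choose_spec.2 m hm)⟩

/-- A surjective map whose kernel is the image of `f` is a cokernel of `f`. -/
theorem nonempty_isColimit_of_exact {X Y Z : RepCat k A} (f : X ⟶ Y) (g : Y ⟶ Z)
    (w : f ≫ g = 0) (hg : Function.Surjective (lin g))
    (h : ∀ y, lin g y = 0 → ∃ x, lin f x = y) :
    Nonempty (IsColimit (CokernelCofork.ofπ g w)) := by
  have key : ∀ {W' : RepCat k A} (g' : Y ⟶ W') (_ : f ≫ g' = 0), ∃! l, g ≫ l = g' :=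
    fun g' hg' => exists_desc g hg g' fun y hy => by
      obtain ⟨x, rfl⟩ := h y hy
      exact LinearMap.congr_fun (congrArg lin hg') x
  exact ⟨CokernelCofork.IsColimit.ofπ g w (fun g' hg' => (key g' hg').choose)
    (fun g' hg' => (key g' hg').choose_spec.1) (fun g' hg' m hm => (key g' hg').choose_spec.2 m hm)⟩

theorem kerι_isLimit {X Y : RepCat k A} (f : X ⟶ Y) :
    Nonempty (IsLimit (KernelFork.ofι (kerι f) (kerι_comp f))) :=
  nonempty_isLimit_of_exact _ _ _ (kerι_injective f) fun x hx => ⟨⟨x, hx⟩, rfl⟩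

/-- By equivariance of `f`, the coaction followed by the projection vanishes on the image of `f`, so
it descends to the quotient. -/
theorem exists_cokρ {X Y : RepCat k A} (f : X ⟶ Y) :
    ∃ r : (Y.V ⧸ LinearMap.range (lin f)) →ₗ[k] (Y.V ⧸ LinearMap.range (lin f)) ⊗[k] A,
      ∀ y, r ((LinearMap.range (lin f)).mkQ y) =
        LinearMap.rTensor A (LinearMap.range (lin f)).mkQ (Y.ρ y) := by
  refine ⟨(LinearMap.range (lin f)).liftQ
    (LinearMap.rTensor A (LinearMap.range (lin f)).mkQ ∘ₗ Y.ρ) ?_, fun y => rfl⟩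
  rintro _ ⟨x, rfl⟩
  have : (LinearMap.range (lin f)).mkQ ∘ₗ lin f = 0 := LinearMap.range_mkQ_comp _
  rw [LinearMap.mem_ker, LinearMap.comp_apply, ρ_lin, ← LinearMap.comp_apply,
    ← LinearMap.rTensor_comp, this, LinearMap.rTensor_zero, LinearMap.zero_apply]

/-- The cokernel of a map of representations. -/
noncomputable abbrev cokObj {X Y : RepCat k A} (f : X ⟶ Y) : RepCat k A :=
  quot (fun _ : Unit => Y) (Y.V ⧸ LinearMap.range (lin f)) (fun _ => (LinearMap.range (lin f)).mkQ)
    (by simp) (exists_cokρ f).choose (fun _ => (exists_cokρ f).choose_spec)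

/-- The projection to the cokernel. -/
noncomputable def cokπ {X Y : RepCat k A} (f : X ⟶ Y) : Y ⟶ cokObj f :=
  ofLin (Y := cokObj f) (LinearMap.range (lin f)).mkQ
    (LinearMap.ext fun u => ((exists_cokρ f).choose_spec u))

theorem cokπ_surjective {X Y : RepCat k A} (f : X ⟶ Y) : Function.Surjective (lin (cokπ f)) :=
  Submodule.mkQ_surjective _

theorem cokπ_eq_zero {X Y : RepCat k A} (f : X ⟶ Y) (y : Y.V) :
    lin (cokπ f) y = 0 ↔ ∃ x, lin f x = y :=
  Submodule.Quotient.mk_eq_zero _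

theorem comp_cokπ {X Y : RepCat k A} (f : X ⟶ Y) : f ≫ cokπ f = 0 :=
  hom_ext (LinearMap.ext fun x => (cokπ_eq_zero f _).2 ⟨x, rfl⟩)

theorem cokπ_isColimit {X Y : RepCat k A} (f : X ⟶ Y) :
    Nonempty (IsColimit (CokernelCofork.ofπ (cokπ f) (comp_cokπ f))) :=
  nonempty_isColimit_of_exact _ _ _ (cokπ_surjective f) fun y hy => (cokπ_eq_zero f y).1 hy

/-- The kernel inclusion is killed by `f`, so it vanishes when `f` is mono. This translates the
categorical notion into linear algebra. -/
theorem injective_of_mono {X Y : RepCat k A} (f : X ⟶ Y) [Mono f] :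
    Function.Injective (lin f) := by
  rw [← LinearMap.ker_eq_bot, LinearMap.ker_eq_bot']
  intro x hx
  have h : kerι f = 0 := by
    rw [← cancel_mono f, kerι_comp, zero_comp]
  exact LinearMap.congr_fun (congrArg lin h) ⟨x, hx⟩

theorem mono_of_injective {X Y : RepCat k A} (f : X ⟶ Y) (hf : Function.Injective (lin f)) :
    Mono f := ⟨fun _ _ e => hom_ext (LinearMap.ext fun x =>
      hf (LinearMap.congr_fun (congrArg lin e) x))⟩

theorem surjective_of_epi {X Y : RepCat k A} (f : X ⟶ Y) [Epi f] :
    Function.Surjective (lin f) := fun y => by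
  have h : cokπ f = 0 := by
    rw [← cancel_epi f, comp_cokπ, comp_zero]
  exact (cokπ_eq_zero f y).1 (LinearMap.congr_fun (congrArg lin h) y)

theorem hasKernels : HasKernels (RepCat k A) :=
  ⟨fun f => HasLimit.mk ⟨_, (kerι_isLimit f).some⟩⟩

theorem hasCokernels : HasCokernels (RepCat k A) :=
  ⟨fun f => HasColimit.mk ⟨_, (cokπ_isColimit f).some⟩⟩

theorem isNormalMonoCategory : IsNormalMonoCategory (RepCat k A) :=
  ⟨fun f _ => ⟨{
    Z := cokObj f
    g := cokπ f
    w := comp_cokπ f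
    isLimit := (nonempty_isLimit_of_exact _ _ _ (injective_of_mono f)
      fun x hx => (cokπ_eq_zero f x).1 hx).some }⟩⟩

theorem isNormalEpiCategory : IsNormalEpiCategory (RepCat k A) :=
  ⟨fun f _ => ⟨{
    W := kerObj f
    g := kerι f
    w := kerι_comp f
    isColimit := (nonempty_isColimit_of_exact (kerι f) f (kerι_comp f) (surjective_of_epi f)
      fun x hx => ⟨⟨x, hx⟩, rfl⟩).some }⟩⟩

/-- The zero representation. -/
abbrev zeroObj : RepCat k A where
  V := PUnit
  ρ := 0
  counit := LinearMap.ext fun _ => rfl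
  coassoc := by simp

/-- The direct sum of two representations. -/
abbrev prodObj (X Y : RepCat k A) : RepCat k A :=
  quot (fun b : Bool => cond b X Y) (X.V × Y.V)
    (fun b => match b with
      | true => LinearMap.inl k X.V Y.V
      | false => LinearMap.inr k X.V Y.V)
    (by
      rw [iSup_bool_eq]
      exact LinearMap.sup_range_inl_inr)
    (LinearMap.coprod (LinearMap.rTensor A (LinearMap.inl k X.V Y.V) ∘ₗ X.ρ)
      (LinearMap.rTensor A (LinearMap.inr k X.V Y.V) ∘ₗ Y.ρ))
    (fun b x => by cases b <;> simp)

/-- The biproduct diagram of the direct sum. -/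
def prodBicone (X Y : RepCat k A) : BinaryBicone X Y where
  pt := prodObj X Y
  fst := ofLin (X := prodObj X Y) (LinearMap.fst k X.V Y.V) (by
    ext x
    · simp [← LinearMap.rTensor_comp_apply]
    · simp [← LinearMap.rTensor_comp_apply])
  snd := ofLin (X := prodObj X Y) (LinearMap.snd k X.V Y.V) (by
    ext x
    · simp [← LinearMap.rTensor_comp_apply]
    · simp [← LinearMap.rTensor_comp_apply])
  inl := ofLin (Y := prodObj X Y) (LinearMap.inl k X.V Y.V) (by ext x; simp)
  inr := ofLin (Y := prodObj X Y) (LinearMap.inr k X.V Y.V) (by ext x; simp)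
  inl_fst := hom_ext (by ext; simp)
  inl_snd := hom_ext (by ext; simp)
  inr_fst := hom_ext (by ext; simp)
  inr_snd := hom_ext (by ext; simp)

theorem hasFiniteProducts : HasFiniteProducts (RepCat k A) := by
  have : HasBinaryBiproducts (RepCat k A) := ⟨fun X Y =>
    ⟨⟨⟨prodBicone X Y, isBinaryBilimitOfTotal _ (hom_ext (LinearMap.ext fun x => by
      change ((x : X.V × Y.V).1, (0 : Y.V)) + ((0 : X.V), (x : X.V × Y.V).2) = x
      rw [Prod.mk_add_mk, add_zero, zero_add]
      rfl))⟩⟩⟩⟩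
  have : HasTerminal (RepCat k A) := IsTerminal.hasTerminal (X := zeroObj)
    (IsTerminal.ofUniqueHom (fun X => 0) fun X m => hom_ext (LinearMap.ext fun x => rfl))
  exact hasFiniteProducts_of_has_binary_and_terminal

theorem finite_hom (X Y : RepCat k A) : Module.Finite k (X ⟶ Y) :=
  Module.Finite.of_injective
    ({ toFun := lin, map_add' := fun _ _ => rfl, map_smul' := fun _ _ => rfl } :
      (X ⟶ Y) →ₗ[k] (X.V →ₗ[k] Y.V)) (lin_injective X Y)

/-- Subobjects embed into the subspaces of `X.V` as an ordered set, so a strict chain is no longer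
than the dimension. -/
theorem finite_length (X : RepCat k A) :
    ∃ n : ℕ, ∀ s : LTSeries (Subobject X), s.length ≤ n := by
  refine ⟨Module.finrank k X.V, fun s => ?_⟩
  let R : Subobject X → Submodule k X.V := fun S => LinearMap.range (lin S.arrow)
  -- An inclusion of images gives a factorization of linear maps, and this factorization is
  -- automatically equivariant by `exists_lift`.
  have hle : ∀ {S T : Subobject X}, S ≤ T ↔ R S ≤ R T := by
    intro S T
    constructor
    · rintro h _ ⟨x, rfl⟩
      exact ⟨lin (Subobject.ofLE S T h) x,
        LinearMap.congr_fun (congrArg lin (Subobject.ofLE_arrow h)) x⟩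
    · intro h
      obtain ⟨l, hl, -⟩ := exists_lift T.arrow (injective_of_mono _) S.arrow
        fun w => h ⟨w, rfl⟩
      exact Subobject.le_of_comm l hl
  have hR : StrictMono R := fun S T h => lt_of_le_not_ge (hle.1 h.le) fun h' => h.not_ge (hle.2 h')
  have hd : StrictMono fun S => Module.finrank k (R S) := fun S T h =>
    Submodule.finrank_lt_finrank_of_lt (hR h)
  have h := LTSeries.head_add_length_le_nat (s.map _ hd)
  have h' : (s.map _ hd).last ≤ Module.finrank k X.V := Submodule.finrank_le _
  have h'' : (s.map _ hd).length = s.length := rfl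
  omega

instance : MonoidalPreadditive (RepCat k A) where
  whiskerLeft_zero := hom_ext (TensorProduct.map_zero_right _)
  zero_whiskerRight := hom_ext (TensorProduct.map_zero_left _)
  whiskerLeft_add _ _ := hom_ext (TensorProduct.map_add_right _ _ _)
  add_whiskerRight _ _ := hom_ext (TensorProduct.map_add_left _ _ _)

theorem monoidalLinear : MonoidalLinear k (RepCat k A) where
  whiskerLeft_smul _ _ _ r _ := hom_ext (TensorProduct.map_smul_right r _ _)
  smul_whiskerRight r _ _ _ _ := hom_ext (TensorProduct.map_smul_left r _ _)

theorem unit_end : Function.Bijective (algebraMap k (End (𝟙_ (RepCat k A)))) := by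
  have h : ∀ c : k, lin (algebraMap k (End (𝟙_ (RepCat k A))) c) (1 : k) = c :=
    fun c => mul_one c
  constructor
  · intro c c' e
    rw [← h c, e, h]
  · intro f
    refine ⟨lin f (1 : k), hom_ext (LinearMap.ext_ring ?_)⟩
    exact h _

end RepCat

/-! ### Matrix coefficients and dual representations. -/

namespace RepCat
open scoped TensorProduct
open MonoidalCategory Limits
variable {k : Type u} [Field k] {A : Type u} [CommRing A] [HopfAlgebra k A]

theorem sum_tmul_coord {ι V : Type*} [Fintype ι] [AddCommGroup V] [Module k V]
    (e : Module.Basis ι k V) (W : Type*) [AddCommGroup W] [Module k W] (t : V ⊗[k] W) :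
    ∑ i, e i ⊗ₜ[k] TensorProduct.lid k W (LinearMap.rTensor W (e.coord i) t) = t := by
  induction t with
  | zero => simp
  | add x y hx hy => simp only [map_add, TensorProduct.tmul_add, Finset.sum_add_distrib, hx, hy]
  | tmul x w =>
    simp only [LinearMap.rTensor_tmul, TensorProduct.lid_tmul, ← TensorProduct.smul_tmul,
      ← TensorProduct.sum_tmul, Module.Basis.coord_apply, e.sum_repr]

/-- Coefficients along a basis of the first factor may be compared one by one; this turns the
comodule axioms into matrix identities. -/
theorem sum_tmul_injective {ι V : Type*} [Fintype ι] [AddCommGroup V] [Module k V]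
    (e : Module.Basis ι k V) {W : Type*} [AddCommGroup W] [Module k W] {f g : ι → W}
    (h : ∑ i, e i ⊗ₜ[k] f i = ∑ i, e i ⊗ₜ[k] g i) : f = g := by
  classical
  funext i
  have := congrArg (fun t => TensorProduct.lid k W (LinearMap.rTensor W (e.coord i) t)) h
  simpa [map_sum, Finsupp.single_apply] using this

section Matrix
variable (X : RepCat k A) {ι : Type*} [Fintype ι] [DecidableEq ι] (e : Module.Basis ι k X.V)

/-- The matrix coefficients of a representation in a basis. -/
noncomputable def coeffMatrix : Matrix ι ι A := fun i j =>
  TensorProduct.lid k A (LinearMap.rTensor A (e.coord i) (X.ρ (e j)))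

omit [DecidableEq ι] in
theorem ρ_basis (j : ι) : X.ρ (e j) = ∑ i, e i ⊗ₜ[k] coeffMatrix X e i j :=
  (sum_tmul_coord e A (X.ρ (e j))).symm

omit [DecidableEq ι] in
-- Coassociativity at `e j`, read off at the coefficient of `e i`.
theorem comul_coeffMatrix (i j : ι) : Coalgebra.comul (R := k) (coeffMatrix X e i j) =
    ∑ l, coeffMatrix X e i l ⊗ₜ[k] coeffMatrix X e l j := by
  refine congrFun (sum_tmul_injective e (W := A ⊗[k] A)
    (f := fun i => Coalgebra.comul (R := k) (coeffMatrix X e i j))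
    (g := fun i => ∑ l, coeffMatrix X e i l ⊗ₜ[k] coeffMatrix X e l j) ?_) i
  have h := LinearMap.congr_fun X.coassoc (e j)
  simp only [LinearMap.comp_apply, LinearEquiv.coe_coe, ρ_basis X e j, map_sum,
    LinearMap.rTensor_tmul, LinearMap.lTensor_tmul] at h
  rw [← h]
  simp only [ρ_basis, TensorProduct.tmul_sum, TensorProduct.sum_tmul, map_sum,
    TensorProduct.assoc_tmul]
  exact Finset.sum_comm

theorem counit_coeffMatrix (i j : ι) : Coalgebra.counit (R := k) (coeffMatrix X e i j) =
    (1 : Matrix ι ι k) i j := by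
  refine congrFun (sum_tmul_injective e (W := k) (f := fun i => Coalgebra.counit (R := k)
    (coeffMatrix X e i j)) (g := fun i => (1 : Matrix ι ι k) i j) ?_) i
  have h := LinearMap.congr_fun X.counit (e j)
  simp only [LinearMap.comp_apply, LinearEquiv.coe_coe, ρ_basis X e j, map_sum,
    LinearMap.lTensor_tmul] at h
  apply (TensorProduct.rid k X.V).injective
  rw [map_sum, h]
  simp [Matrix.one_apply]

/-- The antipode axiom for the entry `(i, j)`, after substituting the formulas for its
comultiplication and counit. -/
theorem coeffMatrix_mul_antipode :
    coeffMatrix X e * (coeffMatrix X e).map (HopfAlgebra.antipode k) = 1 := by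
  ext i j
  have h := HopfAlgebra.mul_antipode_lTensor_comul_apply (R := k) (coeffMatrix X e i j)
  rw [comul_coeffMatrix, counit_coeffMatrix] at h
  simp only [map_sum, LinearMap.lTensor_tmul, LinearMap.mul'_apply] at h
  rw [Matrix.mul_apply]
  simp only [Matrix.map_apply, h, Matrix.one_apply]
  split_ifs <;> simp

theorem antipode_mul_coeffMatrix :
    (coeffMatrix X e).map (HopfAlgebra.antipode k) * coeffMatrix X e = 1 := by
  ext i j
  have h := HopfAlgebra.mul_antipode_rTensor_comul_apply (R := k) (coeffMatrix X e i j)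
  rw [comul_coeffMatrix, counit_coeffMatrix] at h
  simp only [map_sum, LinearMap.rTensor_tmul, LinearMap.mul'_apply] at h
  rw [Matrix.mul_apply]
  simp only [Matrix.map_apply, h, Matrix.one_apply]
  split_ifs <;> simp

/-- The anti-comultiplicativity of the antipode follows here from uniqueness of inverses of matrices
over `A ⊗ A`. With `a` the coefficient matrix, `b` its inverse and `p`, `q` the two inclusions of
`A`, one has `Δ a = p a * q a`; both `q b * p b` and `Δ b` are inverse to it. -/
theorem comul_antipode_coeffMatrix (i j : ι) :
    Coalgebra.comul (R := k) (HopfAlgebra.antipode k (coeffMatrix X e i j)) =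
    ∑ l, HopfAlgebra.antipode k (coeffMatrix X e l j) ⊗ₜ[k]
      HopfAlgebra.antipode k (coeffMatrix X e i l) := by
  let a := coeffMatrix X e
  let b := a.map (HopfAlgebra.antipode k)
  let Δ : A →+* A ⊗[k] A := (Bialgebra.comulAlgHom k A).toRingHom
  let p : A →+* A ⊗[k] A := (Algebra.TensorProduct.includeLeft : A →ₐ[k] A ⊗[k] A).toRingHom
  let q : A →+* A ⊗[k] A := (Algebra.TensorProduct.includeRight : A →ₐ[k] A ⊗[k] A).toRingHom
  have hab : a * b = 1 := coeffMatrix_mul_antipode X e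
  have hba : b * a = 1 := antipode_mul_coeffMatrix X e
  have h₁ : Δ.mapMatrix a = p.mapMatrix a * q.mapMatrix a := by
    ext i j
    rw [Matrix.mul_apply]
    refine (comul_coeffMatrix X e i j).trans (Finset.sum_congr rfl fun l _ => ?_)
    change _ = (coeffMatrix X e i l ⊗ₜ[k] (1 : A)) * ((1 : A) ⊗ₜ[k] coeffMatrix X e l j)
    rw [Algebra.TensorProduct.tmul_mul_tmul, one_mul, mul_one]
  have h₂ : (q.mapMatrix b * p.mapMatrix b) * Δ.mapMatrix a = 1 := by
    rw [h₁, mul_assoc, ← mul_assoc (p.mapMatrix b), ← map_mul, hba, map_one, one_mul, ← map_mul,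
      hba, map_one]
  have h₃ : Δ.mapMatrix a * Δ.mapMatrix b = 1 := by rw [← map_mul, hab, map_one]
  have h₄ : q.mapMatrix b * p.mapMatrix b = Δ.mapMatrix b := left_inv_eq_right_inv h₂ h₃
  have h := congrFun (congrFun h₄ i) j
  rw [Matrix.mul_apply] at h
  refine h.symm.trans (Finset.sum_congr rfl fun l _ => ?_)
  change ((1 : A) ⊗ₜ[k] HopfAlgebra.antipode k (coeffMatrix X e i l)) *
    (HopfAlgebra.antipode k (coeffMatrix X e l j) ⊗ₜ[k] (1 : A)) = _
  rw [Algebra.TensorProduct.tmul_mul_tmul, one_mul, mul_one]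

/-- The coaction on the dual space. -/
noncomputable def dualρ : Module.Dual k X.V →ₗ[k] Module.Dual k X.V ⊗[k] A :=
  e.dualBasis.constr k fun i => ∑ j, e.coord j ⊗ₜ[k] HopfAlgebra.antipode k (coeffMatrix X e i j)

theorem dualρ_coord (i : ι) : dualρ X e (e.coord i) =
    ∑ j, e.coord j ⊗ₜ[k] HopfAlgebra.antipode k (coeffMatrix X e i j) := by
  rw [dualρ, ← Module.Basis.coe_dualBasis, Module.Basis.constr_basis]

/-- The dual representation, given by the inverse transpose of the matrix of coefficients. -/
noncomputable abbrev dualOfBasis : RepCat k A where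
  V := Module.Dual k X.V
  ρ := dualρ X e
  counit := by
    refine e.dualBasis.ext fun i => ?_
    simp only [LinearMap.comp_apply, LinearEquiv.coe_coe, LinearMap.id_apply,
      Module.Basis.coe_dualBasis, dualρ_coord, map_sum, LinearMap.lTensor_tmul,
      HopfAlgebra.counit_antipode, counit_coeffMatrix, TensorProduct.rid_tmul]
    simp [Matrix.one_apply]
  coassoc := by
    refine e.dualBasis.ext fun i => ?_
    simp only [LinearMap.comp_apply, LinearEquiv.coe_coe,
      Module.Basis.coe_dualBasis, dualρ_coord, map_sum, LinearMap.lTensor_tmul,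
      LinearMap.rTensor_tmul, comul_antipode_coeffMatrix, TensorProduct.sum_tmul,
      TensorProduct.tmul_sum, TensorProduct.assoc_tmul]
    exact Finset.sum_comm

end Matrix

/-- The dual representation. -/
noncomputable abbrev dual (X : RepCat k A) : RepCat k A :=
  letI := Classical.decEq (Module.Basis.ofVectorSpaceIndex k X.V)
  dualOfBasis X (Module.Basis.ofVectorSpace k X.V)

/-- The coevaluation, as a map of representations. -/
noncomputable def coev (X : RepCat k A) : triv ⟶ tensor X (dual X) :=
  ofLin (X := triv) (Y := tensor X (dual X)) (coevaluation k X.V) (by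
    let := Classical.decEq (Module.Basis.ofVectorSpaceIndex k X.V)
    let e := Module.Basis.ofVectorSpace k X.V
    refine LinearMap.ext_ring ?_
    rw [LinearMap.comp_apply, LinearMap.comp_apply, coevaluation_apply_one]
    change (tensor X (dual X)).ρ (∑ i, e i ⊗ₜ[k] e.coord i) =
      LinearMap.rTensor A (coevaluation k X.V) ((1 : k) ⊗ₜ[k] (1 : A))
    rw [LinearMap.rTensor_tmul, coevaluation_apply_one, map_sum]
    have h : ∀ i, (tensor X (dual X)).ρ (e i ⊗ₜ[k] e.coord i) =
        ∑ j, ∑ l, (e l ⊗ₜ[k] e.coord j) ⊗ₜ[k]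
          (coeffMatrix X e l i * HopfAlgebra.antipode k (coeffMatrix X e i j)) := by
      intro i
      rw [tensorρ_tmul]
      change LinearMap.lTensor _ (LinearMap.mul' k A)
        (TensorProduct.tensorTensorTensorComm k X.V A (Module.Dual k X.V) A
          (X.ρ (e i) ⊗ₜ dualρ X e (e.coord i))) = _
      rw [ρ_basis X e, dualρ_coord]
      simp only [TensorProduct.sum_tmul, TensorProduct.tmul_sum, map_sum,
        TensorProduct.tensorTensorTensorComm_tmul, LinearMap.lTensor_tmul, LinearMap.mul'_apply]
    simp only [h]
    rw [Finset.sum_comm]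
    simp only [Finset.sum_comm (s := Finset.univ (α := Module.Basis.ofVectorSpaceIndex k X.V))
      (f := fun i l => _ ⊗ₜ[k] (coeffMatrix X e l i * _))]
    simp only [← TensorProduct.tmul_sum]
    -- The coefficient of `e l ⊗ e.coord j` in the coaction on `∑ e i ⊗ e.coord i` is an entry of
    -- the matrix times its inverse, so this vector is invariant.
    have h' : ∀ l j, ∑ i, coeffMatrix X e l i * HopfAlgebra.antipode k (coeffMatrix X e i j) =
        (1 : Matrix _ _ A) l j := fun l j => by
      rw [← coeffMatrix_mul_antipode X e, Matrix.mul_apply]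
      rfl
    simp only [h', Matrix.one_apply, TensorProduct.tmul_ite,
      Finset.sum_ite_eq', Finset.mem_univ, if_true, TensorProduct.sum_tmul]
    rfl)

/-- The evaluation, as a map of representations. -/
noncomputable def ev (X : RepCat k A) : tensor (dual X) X ⟶ triv :=
  ofLin (X := tensor (dual X) X) (Y := triv) (contractLeft k X.V) (by
    let := Classical.decEq (Module.Basis.ofVectorSpaceIndex k X.V)
    let e := Module.Basis.ofVectorSpace k X.V
    refine (e.dualBasis.tensorProduct e).ext ?_
    rintro ⟨i, j⟩
    rw [Module.Basis.tensorProduct_apply, Module.Basis.coe_dualBasis, LinearMap.comp_apply,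
      LinearMap.comp_apply, contractLeft_apply, tensorρ_tmul]
    change (e.coord i (e j)) ⊗ₜ[k] (1 : A) = LinearMap.rTensor A (contractLeft k X.V)
      (LinearMap.lTensor _ (LinearMap.mul' k A)
        (TensorProduct.tensorTensorTensorComm k (Module.Dual k X.V) A X.V A
          (dualρ X e (e.coord i) ⊗ₜ X.ρ (e j))))
    rw [ρ_basis X e, dualρ_coord]
    simp only [TensorProduct.sum_tmul, TensorProduct.tmul_sum, map_sum,
        TensorProduct.tensorTensorTensorComm_tmul, LinearMap.lTensor_tmul, LinearMap.mul'_apply,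
        LinearMap.rTensor_tmul, contractLeft_apply, Module.Basis.coord_apply,
        Module.Basis.repr_self, Finsupp.single_apply, TensorProduct.ite_tmul,
        Finset.sum_ite_eq, Finset.mem_univ, if_true]
    rw [← TensorProduct.tmul_sum]
    -- Evaluation is invariant because of the inverse on the other side.
    have h := congrFun (congrFun (antipode_mul_coeffMatrix X e) i) j
    rw [Matrix.mul_apply] at h
    simp only [Matrix.map_apply] at h
    rw [h, Matrix.one_apply]
    simp only [TensorProduct.tmul_ite, eq_comm])

/-- The dual representation is a dual. -/
noncomputable abbrev exactPairing (X : RepCat k A) : ExactPairing X (dual X) where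
  coevaluation' := coev X
  evaluation' := ev X
  coevaluation_evaluation' := hom_ext (contractLeft_assoc_coevaluation k X.V)
  evaluation_coevaluation' := hom_ext (contractLeft_assoc_coevaluation' k X.V)

theorem isTensorCategory : IsTensorCategory k (RepCat k A) where
  hasFiniteProducts := hasFiniteProducts
  hasKernels := hasKernels
  hasCokernels := hasCokernels
  isNormalMono := isNormalMonoCategory
  isNormalEpi := isNormalEpiCategory
  finite_hom := finite_hom
  finite_length := finite_length
  monoidalPreadditive := inferInstance
  monoidalLinear := monoidalLinear
  rigid X := ⟨dual X, ⟨exactPairing X⟩⟩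
  unit_end := unit_end

end RepCat

/-! ### Flat and injective modules in $\mathrm{Rep}_G$ from those of ordinary algebra. -/

namespace RepCat
open scoped TensorProduct
open MonoidalCategory Limits
variable {k : Type u} [Field k] {A : Type u} [CommRing A] [HopfAlgebra k A]
  {E : Type u} [CommRing E] [Algebra k E]

/-- The module underlying an `E`-module in the category of representations. -/
abbrev modV (X : EMod k E (RepCat k A)) : Module E X.X.V where
  smul e x := lin (X.smul e) x
  one_smul x := LinearMap.congr_fun (congrArg lin (map_one X.act)) x
  mul_smul e e' x := LinearMap.congr_fun (congrArg lin (map_mul X.act e e')) x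
  smul_zero e := map_zero (lin (X.smul e))
  smul_add e := map_add (lin (X.smul e))
  add_smul e e' x := LinearMap.congr_fun (congrArg lin (map_add X.act e e')) x
  zero_smul x := LinearMap.congr_fun (congrArg lin (map_zero X.act)) x

attribute [local instance] modV

theorem modV_smul (X : EMod k E (RepCat k A)) (e : E) (x : X.X.V) :
    e • x = lin (X.smul e) x := rfl

instance modV_tower (X : EMod k E (RepCat k A)) : IsScalarTower k E X.X.V :=
  IsScalarTower.of_algebraMap_smul fun c x => by
    rw [modV_smul]
    have h := LinearMap.congr_fun (congrArg lin (X.act.commutes c)) x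
    exact h

section Tens
variable (X : EMod k E (RepCat k A)) (M : Type u) [AddCommGroup M] [Module E M]

/-- The coaction, as an `E`-linear map. -/
def ρE : X.X.V →ₗ[E] X.X.V ⊗[k] A where
  toFun := X.X.ρ
  map_add' := map_add _
  map_smul' e x := by
    rw [modV_smul, ρ_lin, RingHom.id_apply]
    generalize X.X.ρ x = t
    induction t with
    | zero => simp
    | add x y hx hy => simp only [map_add, smul_add, hx, hy]
    | tmul x a => rfl

/-- The coaction on `X ⊗_E M`. -/
def tensρ : X.X.V ⊗[E] M →ₗ[k] (X.X.V ⊗[E] M) ⊗[k] A :=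
  ((TensorProduct.AlgebraTensorModule.rightComm k E E X.X.V M A).symm.toLinearMap ∘ₗ
    LinearMap.rTensor M (ρE X)).restrictScalars k

/-- The map `X → X ⊗_E M` given by an element of `M`. -/
def tensMk (m : M) : X.X.V →ₗ[k] X.X.V ⊗[E] M where
  toFun x := x ⊗ₜ m
  map_add' x y := TensorProduct.add_tmul x y m
  map_smul' _ _ := rfl

theorem tensρ_mk (m : M) (x : X.X.V) :
    tensρ X M (tensMk X M m x) = LinearMap.rTensor A (tensMk X M m) (X.X.ρ x) := by
  change (TensorProduct.AlgebraTensorModule.rightComm k E E X.X.V M A).symm (X.X.ρ x ⊗ₜ m) = _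
  generalize X.X.ρ x = t
  induction t with
  | zero => simp
  | add x y hx hy => simp only [map_add, TensorProduct.add_tmul, hx, hy]
  | tmul x a => rfl

theorem iSup_range_tensMk : ⨆ m, LinearMap.range (tensMk X M m) = ⊤ := by
  rw [eq_top_iff]
  rintro t -
  induction t with
  | zero => exact zero_mem _
  | add x y hx hy => exact add_mem hx hy
  | tmul x m => exact Submodule.mem_iSup_of_mem m ⟨x, rfl⟩

variable [Module.Finite k E] [Module.Finite E M]

theorem tens_finite : Module.Finite k (X.X.V ⊗[E] M) :=
  have : Module.Finite E X.X.V := Module.Finite.of_restrictScalars_finite k E X.X.V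
  Module.Finite.trans E _

/-- The representation `X ⊗_E M`. -/
abbrev tens : RepCat k A :=
  have := tens_finite X M
  quot (fun _ : M => X.X) (X.X.V ⊗[E] M) (tensMk X M) (iSup_range_tensMk X M) (tensρ X M)
    (tensρ_mk X M)

/-- The universal map to `X ⊗_E M`. -/
def tensι : M →+ (X.X ⟶ tens X M) where
  toFun m := ofLin (X := X.X) (Y := tens X M) (tensMk X M m) (LinearMap.ext (tensρ_mk X M m))
  map_zero' := hom_ext (LinearMap.ext fun x => TensorProduct.tmul_zero _ x)
  map_add' m m' := hom_ext (LinearMap.ext fun x => TensorProduct.tmul_add x m m')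

theorem tensι_smul (e : E) (m : M) : tensι X M (e • m) = X.smul e ≫ tensι X M m :=
  hom_ext (LinearMap.ext fun x => (TensorProduct.smul_tmul e x m).symm)

/-- The linear map exists by the usual tensor product, and it is equivariant because it is so on
each slice `x ↦ x ⊗ m`. Only existence is recorded: `isFlat_of_flat` takes uniqueness from the
abstract tensor products that it is given. -/
theorem exists_tens_desc {T : RepCat k A} (t : M →+ (X.X ⟶ T))
    (ht : ∀ (e : E) m, t (e • m) = X.smul e ≫ t m) :
    ∃ l : tens X M ⟶ T, ∀ m x, lin l (x ⊗ₜ[E] m) = lin (t m) x := by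
  let L₀ : X.X.V ⊗[E] M →+ T.V := TensorProduct.liftAddHom
    (AddMonoidHom.mk' (fun x => AddMonoidHom.mk' (fun m => lin (t m) x)
      (fun m m' => by rw [map_add, lin_add, LinearMap.add_apply]))
      (fun x y => AddMonoidHom.ext fun m => map_add (lin (t m)) x y))
    (fun e x m => (LinearMap.congr_fun (congrArg lin (ht e m)) x).symm)
  let L : X.X.V ⊗[E] M →ₗ[k] T.V :=
    { toFun := L₀
      map_add' := map_add _
      map_smul' := fun c s => by
        rw [RingHom.id_apply]
        induction s with
        | zero => simp
        | add x y hx hy => simp only [map_add, smul_add, hx, hy]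
        | tmul x m => exact map_smul (lin (t m)) c x }
  refine ⟨ofLin (X := tens X M) L (LinearMap.ext fun (s : X.X.V ⊗[E] M) => ?_), fun m x => rfl⟩
  induction s with
  | zero => simp
  | add x y hx hy => rw [map_add, map_add, hx, hy]
  | tmul x m =>
    have h : L ∘ₗ tensMk X M m = lin (t m) := LinearMap.ext fun x => rfl
    rw [LinearMap.comp_apply, LinearMap.comp_apply]
    change T.ρ (lin (t m) x) = LinearMap.rTensor A L (tensρ X M (tensMk X M m x))
    rw [tensρ_mk, ← LinearMap.rTensor_comp_apply, h, ρ_lin]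

end Tens

/-- Any object `T` with the universal property maps to the concrete `tens X M` by a split
monomorphism `a`. On the concrete side the induced map `l'` is injective by flatness, and then `l ≫
a' = a ≫ l'` is mono, so `l` is. -/
theorem isFlat_of_flat [Module.Finite k E] (X : EMod k E (RepCat k A))
    (hX : Module.Flat E X.X.V) : X.IsFlat := by
  intro M N _ _ _ _ _ _ j hj T T' t t' hT hT' l hl
  obtain ⟨a, ha, -⟩ := hT.universal _ (tensι X M) (fun e m => tensι_smul X M e m)
  obtain ⟨a', ha', -⟩ := hT'.universal _ (tensι X N) (fun e m => tensι_smul X N e m)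
  obtain ⟨b, hb⟩ := exists_tens_desc X M t hT.linear
  obtain ⟨l', hl'⟩ := exists_tens_desc X M ((tensι X N).comp j.toAddMonoidHom)
    (fun e m => by
      change tensι X N (j (e • m)) = _
      rw [map_smul, tensι_smul]
      rfl)
  -- Uniqueness in the universal property of `T` gives the splitting.
  have hab : a ≫ b = 𝟙 T := by
    refine (hT.universal T t hT.linear).unique (fun m => ?_) (fun m => Category.comp_id _)
    rw [← Category.assoc, ha]
    exact hom_ext (LinearMap.ext fun x => hb m x)
  have hsq : l ≫ a' = a ≫ l' := by
    refine (hT.universal _ ((tensι X N).comp j.toAddMonoidHom) ?_).unique (fun m => ?_)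
      (fun m => ?_)
    · intro e m
      change tensι X N (j (e • m)) = _
      rw [map_smul, tensι_smul]
      rfl
    · rw [← Category.assoc, hl, ha']
      rfl
    · rw [← Category.assoc, ha]
      exact hom_ext (LinearMap.ext fun x => hl' m x)
  have hinj : Function.Injective (LinearMap.lTensor X.X.V j) :=
    Module.Flat.lTensor_preserves_injective_linearMap j hj
  have : Mono l' := by
    refine mono_of_injective l' fun x y h => hinj ?_
    have key : ∀ s : X.X.V ⊗[E] M, lin l' s = LinearMap.lTensor X.X.V j s := by
      intro s
      induction s with
      | zero => exact (map_zero (lin l')).trans (map_zero _).symm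
      | add x y hx hy =>
        exact (map_add (lin l') x y).trans ((congrArg₂ _ hx hy).trans (map_add _ x y).symm)
      | tmul x m => exact hl' m x
    rw [← key, ← key, h]
  have : Mono a := by
    have : Mono (a ≫ b) := hab ▸ inferInstance
    exact mono_of_mono a b
  have : Mono (l ≫ a') := hsq ▸ mono_comp a l'
  exact mono_of_mono l a'

section Dual

/-- The chosen dual, as an instance. -/
noncomputable abbrev hasRightDual (X : RepCat k A) : HasRightDual X where
  rightDual := dual X
  exact := exactPairing X

attribute [local instance] hasRightDual

theorem coevaluation_mate {X : RepCat k A} (f : X ⟶ X) :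
    coev X ≫ (f ▷ dual X) = coev X ≫ (X ◁ (rightAdjointMate f : dual X ⟶ dual X)) :=
  (coevaluation_comp_rightAdjointMate f).symm

/-- The mate is determined by its compatibility with `∑ e i ⊗ e.coord i`. Pairing the first factor
of that identity with `φ` isolates the value of the mate at `φ`, since `φ = ∑ φ (e i) • e.coord i`.
-/
theorem lin_mate {X : RepCat k A} (f : X ⟶ X) :
    lin (rightAdjointMate f : dual X ⟶ dual X) = (lin f).dualMap := by
  refine LinearMap.ext fun φ => ?_
  have h := LinearMap.congr_fun (congrArg lin (coevaluation_mate f)) (1 : k)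
  replace h : LinearMap.rTensor (Module.Dual k X.V) (lin f) (coevaluation k X.V 1) =
    LinearMap.lTensor X.V (lin (rightAdjointMate f : dual X ⟶ dual X)) (coevaluation k X.V 1) := h
  rw [coevaluation_apply_one] at h
  have h' := congrArg (fun t => TensorProduct.lid k _ (LinearMap.rTensor (Module.Dual k X.V) φ t)) h
  simp only [map_sum, LinearMap.rTensor_tmul, LinearMap.lTensor_tmul, TensorProduct.lid_tmul] at h'
  have h₁ := (Module.Basis.ofVectorSpace k X.V).sum_dual_apply_smul_coord (φ ∘ₗ lin f)
  have h₂ := (Module.Basis.ofVectorSpace k X.V).sum_dual_apply_smul_coord φ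
  refine Eq.trans ?_ (h'.symm.trans h₁)
  conv_lhs => rw [← h₂, map_sum]
  simp only [map_smul]

/-- The dual of an `E`-module, with the transposed action. -/
noncomputable def dualMod (X : EMod k E (RepCat k A)) : EMod k E (RepCat k A) where
  X := dual X.X
  act :=
    { toFun := fun e => (rightAdjointMate (X.smul e) : dual X.X ⟶ dual X.X)
      map_one' := hom_ext (by
        rw [lin_mate, EMod.smul, map_one]
        rfl)
      map_mul' := fun e e' => hom_ext (by
        change _ = lin (rightAdjointMate (X.smul e)) ∘ₗ lin (rightAdjointMate (X.smul e'))
        -- Transposition reverses products; commutativity of `E` makes the transposed action an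
        -- action again.
        rw [lin_mate, lin_mate, lin_mate, mul_comm, EMod.smul, map_mul]
        rfl)
      map_zero' := hom_ext (by
        rw [lin_mate, EMod.smul, map_zero]
        exact map_zero Module.Dual.transpose)
      map_add' := fun e e' => hom_ext (by
        change _ = lin (rightAdjointMate (X.smul e)) + lin (rightAdjointMate (X.smul e'))
        rw [lin_mate, lin_mate, lin_mate, EMod.smul, map_add]
        exact map_add Module.Dual.transpose _ _)
      commutes' := fun c => hom_ext (by
        rw [lin_mate, EMod.smul, X.act.commutes]
        refine LinearMap.ext fun φ => LinearMap.ext fun x => ?_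
        exact map_smul φ c x) }

theorem dualMod_smul (X : EMod k E (RepCat k A)) (e : E) (φ : Module.Dual k X.X.V) (x : X.X.V) :
    (show Module.Dual k X.X.V from lin ((dualMod X).smul e) φ) x = φ (lin (X.smul e) x) :=
  congrArg (fun ψ : Module.Dual k X.X.V => ψ x) (LinearMap.congr_fun (lin_mate (X.smul e)) φ)

/-- A module whose dual is free is injective. -/
theorem isInjective_of_bijective [Module.Finite k E] (X : EMod k E (RepCat k A))
    {ι : Type*} [Finite ι] (F : (ι → E) →+ Module.Dual k X.X.V)
    (hF : ∀ (e : E) u x, F (e • u) x = F u (lin (X.smul e) x)) (hb : Function.Bijective F) :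
    X.IsInjective := by
  refine ⟨dualMod X, exactPairing X.X, fun e => coevaluation_mate (X.smul e), ?_⟩
  let L : (ι → E) →ₗ[E] (dualMod X).X.V :=
    { toFun := F
      map_add' := map_add F
      map_smul' := fun e u => LinearMap.ext fun x =>
        (hF e u x).trans (dualMod_smul X e (F u) x).symm }
  exact isFlat_of_flat _ (Module.Flat.of_linearEquiv (LinearEquiv.ofBijective L hb).symm)

end Dual

end RepCat

/-! ### A linear criterion for the universal property of $f^!$. -/

namespace RepCat
open scoped TensorProduct
open MonoidalCategory Limits
variable {k : Type u} [Field k] {A : Type u} [CommRing A] [HopfAlgebra k A]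
  {E F : Type u} [CommRing E] [Algebra k E] [CommRing F] [Algebra k F]

theorem smul_mul (Y : EMod k F (RepCat k A)) (w w' : F) (y : Y.X.V) :
    lin (Y.smul (w * w')) y = lin (Y.smul w) (lin (Y.smul w') y) :=
  LinearMap.congr_fun (congrArg lin (map_mul Y.act w w')) y

theorem smul_add' (Y : EMod k F (RepCat k A)) (w w' : F) (y : Y.X.V) :
    lin (Y.smul (w + w')) y = lin (Y.smul w) y + lin (Y.smul w') y :=
  LinearMap.congr_fun (congrArg lin (map_add Y.act w w')) y

theorem smul_smul' (Y : EMod k F (RepCat k A)) (c : k) (w : F) (y : Y.X.V) :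
    lin (Y.smul (c • w)) y = c • lin (Y.smul w) y :=
  LinearMap.congr_fun (congrArg lin (map_smul Y.act c w)) y

/-- The action map of a module on an element. -/
def orbit (Y : EMod k F (RepCat k A)) (y : Y.X.V) : F →ₗ[k] Y.X.V where
  toFun w := lin (Y.smul w) y
  map_add' w w' := smul_add' Y w w' y
  map_smul' c w := smul_smul' Y c w y

/-- The hypotheses say that `y ↦ (w ↦ g (w y))` identifies `Y` with the linear space `Hom_E(F, X)`.
No coaction on that space has to be constructed: the maps `y ↦ g (w y)` are equivariant and jointly
injective, so the lift of an equivariant map is equivariant. -/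
theorem isCartesian_of_bijective (f : E →ₐ[k] F) (Y : EMod k F (RepCat k A))
    (X : EMod k E (RepCat k A)) (g : Y.X ⟶ X.X)
    (linear : ∀ e : E, Y.smul (f e) ≫ g = g ≫ X.smul e)
    (inj : ∀ y, (∀ w, lin g (lin (Y.smul w) y) = 0) → y = 0)
    (surj : ∀ h : F →ₗ[k] X.X.V, (∀ e w, h (f e * w) = lin (X.smul e) (h w)) →
      ∃ y, ∀ w, lin g (lin (Y.smul w) y) = h w) : EMod.IsCartesian f Y X g := by
  refine ⟨linear, fun Z h hh => ?_⟩
  have inj' : ∀ y y', (∀ w, lin g (lin (Y.smul w) y) = lin g (lin (Y.smul w) y')) → y = y' :=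
    fun y y' e => sub_eq_zero.1 (inj _ fun w => by rw [map_sub, map_sub, e, sub_self])
  -- The lift must send `z` to the element that represents `w ↦ h (w z)`.
  have key : ∀ z : Z.X.V, ∃ y, ∀ w, lin g (lin (Y.smul w) y) = lin h (lin (Z.smul w) z) := by
    intro z
    refine surj (lin h ∘ₗ orbit Z z) fun e w => ?_
    change lin h (lin (Z.smul (f e * w)) z) = lin (X.smul e) (lin h (lin (Z.smul w) z))
    rw [smul_mul]
    exact LinearMap.congr_fun (congrArg lin (hh e)) _
  choose l hl using key
  let L : Z.X.V →ₗ[k] Y.X.V :=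
    { toFun := l
      map_add' := fun x y => inj' _ _ fun w => by simp only [map_add, hl]
      map_smul' := fun c x => inj' _ _ fun w => by simp only [map_smul, hl, RingHom.id_apply] }
  have hL : Y.X.ρ ∘ₗ L = LinearMap.rTensor A L ∘ₗ Z.X.ρ :=
    comm_of_jointly_injective (fun w => Y.smul w ≫ g) inj (fun w => Z.smul w ≫ h) L
      (fun w z => hl z w)
  refine ⟨⟨ofLin L hL, fun e => hom_ext (LinearMap.ext fun z => inj' _ _ fun w => ?_)⟩,
    hom_ext (LinearMap.ext fun z => ?_), fun l' hl' => ?_⟩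
  · change lin g (lin (Y.smul w) (l (lin (Z.smul e) z))) =
      lin g (lin (Y.smul w) (lin (Y.smul e) (l z)))
    rw [hl, ← smul_mul, ← smul_mul, hl]
  -- Taking `w = 1` in the defining property shows that the lift composes with `g` to `h`.
  · have h₁ : ∀ y, lin (Y.smul 1) y = y :=
      fun y => LinearMap.congr_fun (congrArg lin (map_one Y.act)) y
    have h₂ : ∀ y, lin (Z.smul 1) y = y :=
      fun y => LinearMap.congr_fun (congrArg lin (map_one Z.act)) y
    have := hl z 1
    rwa [h₁, h₂] at this
  · refine EMod.Hom.ext (hom_ext (LinearMap.ext fun z => inj' _ _ fun w => ?_))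
    change _ = lin g (lin (Y.smul w) (l z))
    rw [hl]
    have h₁ := LinearMap.congr_fun (congrArg lin (l'.comm w)) z
    have h₂ := LinearMap.congr_fun (congrArg lin hl') (lin (Z.smul w) z)
    exact (congrArg (lin g) h₁.symm).trans h₂

end RepCat

/-! ### Coordinates on $E_\alpha^\vee\otimes_\mu X$; values in prolongations. -/

section Tau
open scoped TensorProduct
variable {k₀ : Type u} [CommRing k₀] {k : Type u} [Field k] [Algebra k₀ k]
  {M : FormalMonoid k₀}

instance base_finite (M : FormalMonoid k₀) (α : M.I) : Module.Finite k (M.base k α) :=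
  have := M.finite α
  inferInstance

namespace TauV
variable {μ : MAction M k} {α β : M.I} {X : Type u} [AddCommGroup X] [Module k X]
  {Y : Type u} [AddCommGroup Y] [Module k Y]

/-- The contraction `θ ⊗ x ↦ μ(φ(x)) θ`. -/
def contract (φ : X →ₗ[k] k) : TauV μ α X →ₗ[M.base k α] CoE μ α where
  toFun := lift (fun θ x => (μ.act α (φ x) : M.base k α) • θ)
    (fun _ _ _ => smul_add _ _ _) (fun _ _ _ => by rw [map_add, map_add, add_smul])
    (fun _ _ _ => by rw [map_smul, smul_eq_mul, map_mul, mul_comm, mul_smul])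
  map_add' := map_add _
  map_smul' e t := by
    rw [RingHom.id_apply]
    induction t using induction with
    | zero => simp
    | add s t hs ht => simp only [smul_add, map_add, hs, ht]
    | tm θ x => exact smul_comm (μ.act α (φ x) : M.base k α) e θ

theorem contract_tmul (φ : X →ₗ[k] k) (θ : CoE μ α) (x : X) :
    contract φ (tmul θ x) = (μ.act α (φ x) : M.base k α) • θ := rfl

/-- Every element is `∑ θ i ⊗ y i` with explicit functionals `θ i`. Vectors and functionals are
allowed instead of a basis, so that the statement also applies to `τ_β(X)` in place of `X`, with the
family of `sum_evalDual_smul`. -/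
theorem sum_tmul_contract {ι : Type*} [Fintype ι] (y : ι → X) (φ : ι → X →ₗ[k] k)
    (h : ∀ s, ∑ i, φ i s • y i = s) (t : TauV μ α X) :
    ∑ i, tmul (contract (φ i) t) (y i) = t := by
  induction t using induction with
  | zero => simp [zero_tmul]
  | add s t hs ht => simp only [map_add, add_tmul, Finset.sum_add_distrib, hs, ht]
  | tm θ x =>
    simp only [contract_tmul, act_smul_tmul]
    conv_rhs => rw [← h x]
    exact (TensorProduct.tmul_sum θ _ _).symm

theorem contract_sum {ι : Type*} [Fintype ι] [DecidableEq ι] (y : ι → X) (φ : ι → X →ₗ[k] k)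
    (h : ∀ i j, φ i (y j) = if i = j then 1 else 0) (θ : ι → CoE μ α) (i : ι) :
    contract (φ i) (∑ j, tmul (θ j) (y j)) = θ i := by
  rw [map_sum]
  simp only [contract_tmul, h]
  rw [Finset.sum_eq_single i]
  · rw [if_pos rfl, map_one, one_smul]
  · intro j _ hj
    rw [if_neg (Ne.symm hj), map_zero, zero_smul]
  · simp

/-- The contraction with a linear functional, as a map to the dual of `E_α`. -/
def contractDual (φ : X →ₗ[k] k) : TauV μ α X →ₗ[k] Module.Dual k (M.base k α) where
  toFun t := CoE.toDual (contract φ t)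
  map_add' s t := map_add (contract φ) s t
  map_smul' c t := by
    -- The scalar `c` acts on `TauV` through the projection, but on `CoE` through `μ`; the two are
    -- reconciled by passing through the action of `E_α`.
    rw [← algebraMap_smul (M.base k α) c t, map_smul]
    refine LinearMap.ext fun e => ?_
    rw [CoE.base_smul_apply, ← Algebra.smul_def, map_smul]
    rfl

theorem contractDual_tmul (φ : X →ₗ[k] k) (θ : CoE μ α) (x : X) (e : M.base k α) :
    contractDual φ (tmul θ x) e = CoE.toDual θ (μ.act α (φ x) * e) := rfl

theorem contractDual_base_smul (φ : X →ₗ[k] k) (t : TauV μ α X) (e e' : M.base k α) :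
    contractDual φ (e • t) e' = contractDual φ t (e * e') := by
  change CoE.toDual (contract φ (e • t)) e' = _
  rw [map_smul]
  rfl

theorem contractDual_res (f : α ⟶ β) (φ : X →ₗ[k] k) (t : TauV μ β X) (e : M.base k α) :
    contractDual φ (res f t) e = contractDual φ t (M.baseRes k f e) := by
  induction t using induction with
  | zero => simp
  | add s t hs ht => simp only [map_add, LinearMap.add_apply, hs, ht]
  | tm θ x =>
    rw [res_tmul, contractDual_tmul, contractDual_tmul]
    change CoE.toDual θ (M.baseRes k f (μ.act α (φ x) * e)) = _
    rw [map_mul, baseRes_act]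

variable (μ α) in
/-- The map `θ ↦ θ ⊗ x`, which is linear for the `k`-structure along the projection. -/
def tmulDual (x : X) : Module.Dual k (M.base k α) →ₗ[k] TauV μ α X where
  toFun θ := tmul (CoE.mk θ) x
  map_add' θ θ' := add_tmul (CoE.mk θ) (CoE.mk θ') x
  map_smul' c θ := by
    rw [RingHom.id_apply, smul_tmul]
    refine congrArg (fun θ => tmul θ x) (LinearMap.ext fun e => ?_)
    change c • θ e = θ (algebraMap k _ c * e)
    rw [← Algebra.smul_def, map_smul]

section Basis
variable {ι : Type*} [Fintype ι] (b : Module.Basis ι k X)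

/-- An element is rebuilt from its coordinates by `sum_tmul_contract`; with `contractDual_ofCoord`
this makes `τ_α(X)` a sum of copies of `E_α^∨`. -/
theorem ext_contractDual {s t : TauV μ α X}
    (h : ∀ i e, contractDual (b.coord i) s e = contractDual (b.coord i) t e) : s = t := by
  rw [← sum_tmul_contract b b.coord b.sum_repr s, ← sum_tmul_contract b b.coord b.sum_repr t]
  refine Finset.sum_congr rfl fun i _ => congrArg (fun θ => tmul θ (b i)) ?_
  exact LinearMap.ext (h i)

/-- The element of `E^∨ ⊗_μ X` with given coordinates. -/
noncomputable def ofCoord (θ : ι → Module.Dual k (M.base k α)) : TauV μ α X := ∑ i, tmul (CoE.mk (θ i)) (b i)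

theorem contractDual_ofCoord (θ : ι → Module.Dual k (M.base k α)) (i : ι) :
    contractDual (b.coord i) (ofCoord (μ := μ) b θ) = θ i := by
  classical
  exact contract_sum b b.coord (fun i j => by
    rw [Module.Basis.coord_apply, Module.Basis.repr_self, Finsupp.single_apply]
    simp only [eq_comm]) (fun i => CoE.mk (θ i)) i

end Basis

/-- The right side is linear for the `k`-structure along `μ`, the one over which the tensor product
is formed. Injectivity, surjectivity and exactness are transported from it. -/
theorem map_tmul_eq (f : X →ₗ[k] Y) (t : TauV μ α X) :
    TauV.map (μ := μ) (α := α) f t = TensorProduct.map LinearMap.id f t := by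
  induction t using induction with
  | zero => exact (map_zero _).trans (map_zero (TensorProduct.map LinearMap.id f)).symm
  | add s t hs ht =>
    exact (map_add _ s t).trans ((congrArg₂ _ hs ht).trans
      (map_add (TensorProduct.map LinearMap.id f) s t).symm)
  | tm θ x => rfl

theorem map_injective (f : X →ₗ[k] Y) (hf : Function.Injective f) :
    Function.Injective (TauV.map (μ := μ) (α := α) f) := fun s t h => by
  rw [map_tmul_eq, map_tmul_eq] at h
  exact Module.Flat.lTensor_preserves_injective_linearMap (M := CoE μ α) f hf h

theorem map_surjective (f : X →ₗ[k] Y) (hf : Function.Surjective f) :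
    Function.Surjective (TauV.map (μ := μ) (α := α) f) := fun t => by
  obtain ⟨s, hs⟩ := LinearMap.lTensor_surjective (CoE μ α) hf t
  exact ⟨s, (map_tmul_eq f s).trans hs⟩

theorem map_exact {Z : Type u} [AddCommGroup Z] [Module k Z] (f : X →ₗ[k] Y) (g : Y →ₗ[k] Z)
    (h : Function.Exact f g) (t : TauV μ α Y) (ht : TauV.map g t = 0) :
    ∃ s, TauV.map (μ := μ) (α := α) f s = t := by
  rw [map_tmul_eq] at ht
  obtain ⟨s, hs⟩ := (Module.Flat.lTensor_exact (CoE μ α) h t).1 ht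
  exact ⟨s, (map_tmul_eq f s).trans hs⟩

end TauV

namespace MGroup
open RepCat Limits
variable {μ : MAction M k} (G : MGroup μ)

/-- A criterion for a map to `τ_γ(X)` to be cartesian, in coordinates. -/
theorem isCartesian_tau {γ : M.I} {F : Type u} [CommRing F] [Algebra k F]
    (f : M.base k γ →ₐ[k] F) (Y : EMod k F (RepCat k G.A)) (X : RepCat k G.A)
    (g : Y.X ⟶ G.tauObj γ X) (linear : ∀ e, Y.smul (f e) ≫ g = g ≫ (G.tauMod γ X).smul e)
    {ι : Type*} [Fintype ι] (b : Module.Basis ι k X.V)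
    (inj : ∀ y, (∀ i w, TauV.contractDual (b.coord i) (lin g (lin (Y.smul w) y)) 1 = 0) → y = 0)
    (surj : ∀ Θ : ι → Module.Dual k F, ∃ y, ∀ i w,
      TauV.contractDual (b.coord i) (lin g (lin (Y.smul w) y)) 1 = Θ i w) :
    EMod.IsCartesian f Y (G.tauMod γ X) g := by
  let T := G.tauMod γ X
  let g' : Y.X ⟶ T.X := g
  let C : ι → T.X.V →ₗ[k] Module.Dual k (M.base k γ) := fun i => TauV.contractDual (b.coord i)
  -- A functional on `E_γ` is recovered from the values at 1 of its `E_γ`-multiples; hence the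
  -- hypotheses only mention values at 1.
  have h₁ : ∀ i (t : T.X.V) e, C i t e = C i (lin (T.smul e) t) 1 := fun i t e => by
    refine Eq.trans ?_ (TauV.contractDual_base_smul (b.coord i) t e 1).symm
    rw [mul_one]
    rfl
  have surj' : ∀ Θ : ι → Module.Dual k F, ∃ y, ∀ i w, C i (lin g' (lin (Y.smul w) y)) 1 = Θ i w :=
    surj
  refine isCartesian_of_bijective f Y T g' linear (fun y hy => inj y fun i w => ?_) fun h hh => ?_
  · change C i (lin g' (lin (Y.smul w) y)) 1 = 0
    rw [hy, map_zero, LinearMap.zero_apply]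
  -- The functionals attached to `h` are the values at 1 of the coordinates of `h w`. The values at
  -- other `e` then agree because both sides are `E_γ`-linear.
  · obtain ⟨y, hy⟩ := surj' fun i => (LinearMap.applyₗ 1) ∘ₗ C i ∘ₗ h
    refine ⟨y, fun w => TauV.ext_contractDual b fun i e => ?_⟩
    change C i (lin g' (lin (Y.smul w) y)) e = C i (h w) e
    have h₂ : lin g' (lin (Y.smul (f e * w)) y) = lin (T.smul e) (lin g' (lin (Y.smul w) y)) := by
      rw [smul_mul]
      exact LinearMap.congr_fun (congrArg lin (linear e)) (lin (Y.smul w) y)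
    rw [h₁, ← h₂, hy, h₁, ← hh]
    rfl

/-- A coordinate of the image of `w • y`, evaluated at 1, is the same coordinate of `y` evaluated at
`w`. So the functionals in the criterion are just the coordinates of `y`. -/
theorem isCartesian_tauTr {α β : M.I} (f : α ⟶ β) (X : RepCat k G.A) :
    EMod.IsCartesian (M.baseRes k f) (G.tauMod β X) (G.tauMod α X) (G.tauTr f X) := by
  have h : ∀ φ (w : M.base k β) (y : TauV μ β X.V),
      TauV.contractDual φ (TauV.res f (w • y)) 1 = TauV.contractDual φ y w := fun φ w y => by
    rw [TauV.contractDual_res, TauV.contractDual_base_smul, map_one, mul_one]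
  refine G.isCartesian_tau _ _ _ _ ((G.tauSys X).tr_linear f) (Module.finBasis k X.V)
    (fun y hy => TauV.ext_contractDual (Module.finBasis k X.V) fun i w => ?_)
    fun Θ => ⟨TauV.ofCoord (Module.finBasis k X.V) Θ, fun i w => ?_⟩
  · exact (h _ w y).symm.trans ((hy i w).trans (congrFun (congrArg DFunLike.coe (map_zero (TauV.contractDual _))) w).symm)
  · exact (h _ w _).trans (by rw [TauV.contractDual_ofCoord])

/-- Pairing coordinates with elements of `E_α` identifies the dual of `τ_α(X)` with a free
`E_α`-module whose rank is the dimension of `X`. -/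
theorem isInjective_tauMod (α : M.I) (X : RepCat k G.A) : (G.tauMod α X).IsInjective := by
  let b := Module.finBasis k X.V
  let F : (Fin (Module.finrank k X.V) → M.base k α) →+ Module.Dual k (TauV μ α X.V) :=
    { toFun := fun u =>
        { toFun := fun t => ∑ i, TauV.contractDual (b.coord i) t (u i)
          map_add' := fun s t => by
            simp only [map_add, LinearMap.add_apply, Finset.sum_add_distrib]
          map_smul' := fun c t => by
            simp only [map_smul, LinearMap.smul_apply, ← Finset.smul_sum, RingHom.id_apply] }
      map_zero' := LinearMap.ext fun t => by simp
      map_add' := fun u v => LinearMap.ext fun t => by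
        simp [Finset.sum_add_distrib] }
  have hF : ∀ u t, F u t = ∑ i, TauV.contractDual (b.coord i) t (u i) := fun _ _ => rfl
  have hF' : ∀ u θ, F u (TauV.ofCoord b θ) = ∑ i, θ i (u i) := fun u θ => by
    simp only [hF, TauV.contractDual_ofCoord]
  have hlin : ∀ (e : M.base k α) u (t : TauV μ α X.V), F (e • u) t = F u (e • t) := by
    intro e u t
    rw [hF, hF]
    refine Finset.sum_congr rfl fun i _ => ?_
    rw [Pi.smul_apply, smul_eq_mul, TauV.contractDual_base_smul]
  have hinj : Function.Injective F := by
    rw [injective_iff_map_eq_zero]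
    intro u hu
    funext i
    refine (Module.forall_dual_apply_eq_zero_iff k (u i)).1 fun θ => ?_
    have h := hF' u (Pi.single i θ)
    rw [hu, Finset.sum_eq_single i] at h
    · rw [Pi.single_eq_same] at h
      exact h.symm
    · intro j _ hj
      rw [Pi.single_eq_of_ne hj, LinearMap.zero_apply]
    · simp
  have hsurj : Function.Surjective F := by
    intro φ
    -- The restriction of `φ` to the `i`-th copy of `E_α^∨` is, by reflexivity, evaluation at an
    -- element of `E_α`.
    let Φ : Fin (Module.finrank k X.V) → Module.Dual k (Module.Dual k (M.base k α)) := fun i =>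
      φ ∘ₗ TauV.tmulDual μ α (b i)
    refine ⟨fun i => (Module.evalEquiv k (M.base k α)).symm (Φ i), LinearMap.ext fun t => ?_⟩
    conv_rhs => rw [← TauV.sum_tmul_contract b b.coord b.sum_repr t, map_sum]
    rw [hF]
    refine Finset.sum_congr rfl fun i _ => ?_
    exact Module.apply_evalEquiv_symm_apply k (M.base k α) _ (Φ i)
  exact isInjective_of_bijective (G.tauMod α X) F hlin ⟨hinj, hsurj⟩

theorem isProlongation_tau (X : RepCat k G.A) : (G.tau.obj X).IsProlongation :=
  ⟨fun f => G.isCartesian_tauTr f X, fun α => G.isInjective_tauMod α X⟩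

/-- The functor `τ`, with values in prolongations. -/
def tauP : RepCat k G.A ⥤ Plng M.toProFiniteAlg k (RepCat k G.A) :=
  ObjectProperty.lift _ G.tau G.isProlongation_tau

/-- The maps `μ` and the projection agree on `k₀`, both being `k₀`-algebra maps. This is why `τ` is
`k₀`-linear; over `k` it is only linear along `μ`. -/
theorem act_algebraMap (μ : MAction M k) (α : M.I) (r : k₀) :
    μ.act α (algebraMap k₀ k r) = algebraMap k (M.base k α) (algebraMap k₀ k r) := by
  have h : algebraMap k₀ k r = r • (1 : k) := Algebra.algebraMap_eq_smul_one r
  rw [h, map_smul, map_one, ← IsScalarTower.algebraMap_smul k r (1 : k), smul_eq_mul, mul_one,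
    Algebra.algebraMap_eq_smul_one (A := M.base k α), algebraMap_smul]

theorem isLinearOver (α : M.I) :
    IsLinearOver (k := k) k₀ (G.tauP ⋙ Plng.und M.toProFiniteAlg k (RepCat k G.A) α) where
  map_add {X Y} f g := hom_ext (LinearMap.ext fun t => by
    change TauV.map (lin (f + g)) t = TauV.map (lin f) t + TauV.map (lin g) t
    induction t using TauV.induction with
    | zero => simp
    | add s t hs ht => simp only [map_add, hs, ht]; abel
    | tm θ x => exact TauV.tmul_add _ _ _)
  map_smul {X Y} r f := hom_ext (LinearMap.ext fun t => by
    change TauV.map (lin (algebraMap k₀ k r • f)) t = algebraMap k₀ k r • TauV.map (lin f) t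
    induction t using TauV.induction with
    | zero => simp
    | add s t hs ht => simp only [map_add, hs, ht, smul_add]
    | tm θ x =>
      change TauV.tmul θ (algebraMap k₀ k r • lin f x) = _
      rw [← TauV.act_smul_tmul, act_algebraMap]
      rfl)

end MGroup

/-! ### Exactness of $\tau$ as a functor to $E$-modules. -/

namespace EMod
open Limits
universe v w
variable {k : Type u} [Field k] {E : Type u} [CommRing E] [Algebra k E]
  {C : Type v} [Category.{w} C] [Preadditive C] [Linear k C]

/-- The lift in `C` is automatically `E`-linear: this can be tested after the projections, which are
themselves `E`-linear. -/
theorem reflectsLimitsOfShape_forget (J : Type*) [Category* J] :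
    ReflectsLimitsOfShape J (forget k E C) where
  reflectsLimit {K} := ⟨fun {c} hc => ⟨by
    let L (s : Cone K) : s.pt.X ⟶ c.pt.X := hc.lift ((forget k E C).mapCone s)
    have hL (s : Cone K) (j : J) : L s ≫ (c.π.app j).hom = (s.π.app j).hom :=
      hc.fac ((forget k E C).mapCone s) j
    have comm (s : Cone K) (e : E) : s.pt.smul e ≫ L s = L s ≫ c.pt.smul e := by
      refine hc.hom_ext fun j => ?_
      change (s.pt.smul e ≫ L s) ≫ (c.π.app j).hom = (L s ≫ c.pt.smul e) ≫ (c.π.app j).hom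
      have h₂ : c.pt.smul e ≫ (c.π.app j).hom = (c.π.app j).hom ≫ (K.obj j).smul e :=
        (c.π.app j).comm e
      have h₃ : s.pt.smul e ≫ (s.π.app j).hom = (s.π.app j).hom ≫ (K.obj j).smul e :=
        (s.π.app j).comm e
      rw [Category.assoc, Category.assoc, h₂, hL, ← Category.assoc, hL, h₃]
    exact {
      lift := fun s => ⟨L s, comm s⟩
      fac := fun s j => Hom.ext (hL s j)
      uniq := fun s m hm => Hom.ext (hc.uniq ((forget k E C).mapCone s) m.hom
        fun j => congrArg Hom.hom (hm j)) }⟩⟩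

theorem reflectsColimitsOfShape_forget (J : Type*) [Category* J] :
    ReflectsColimitsOfShape J (forget k E C) where
  reflectsColimit {K} := ⟨fun {c} hc => ⟨by
    let L (s : Cocone K) : c.pt.X ⟶ s.pt.X := hc.desc ((forget k E C).mapCocone s)
    have hL (s : Cocone K) (j : J) : (c.ι.app j).hom ≫ L s = (s.ι.app j).hom :=
      hc.fac ((forget k E C).mapCocone s) j
    have comm (s : Cocone K) (e : E) : c.pt.smul e ≫ L s = L s ≫ s.pt.smul e := by
      refine hc.hom_ext fun j => ?_
      change (c.ι.app j).hom ≫ c.pt.smul e ≫ L s = (c.ι.app j).hom ≫ L s ≫ s.pt.smul e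
      have h₂ : (K.obj j).smul e ≫ (c.ι.app j).hom = (c.ι.app j).hom ≫ c.pt.smul e :=
        (c.ι.app j).comm e
      have h₃ : (K.obj j).smul e ≫ (s.ι.app j).hom = (s.ι.app j).hom ≫ s.pt.smul e :=
        (s.ι.app j).comm e
      rw [← Category.assoc, ← Category.assoc, ← h₂, Category.assoc, hL, h₃]
    exact {
      desc := fun s => ⟨L s, comm s⟩
      fac := fun s j => Hom.ext (hL s j)
      uniq := fun s m hm => Hom.ext (hc.uniq ((forget k E C).mapCocone s) m.hom
        fun j => congrArg Hom.hom (hm j)) }⟩⟩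

end EMod

namespace MGroup
open RepCat Limits
variable {μ : MAction M k} (G : MGroup μ)

/-- On underlying representations the functor is additive and preserves kernels and cokernels, hence
all finite limits and colimits. The forgetful functor from `E_α`-modules reflects these, which gives
the result with values in modules. -/
theorem exact_tau (α : M.I) :
    PreservesFiniteLimits (G.tauP ⋙ Plng.proj M.toProFiniteAlg k (RepCat k G.A) α) ∧
    PreservesFiniteColimits (G.tauP ⋙ Plng.proj M.toProFiniteAlg k (RepCat k G.A) α) := by
  let F := G.tauP ⋙ Plng.proj M.toProFiniteAlg k (RepCat k G.A) α
  let U := EMod.forget k (M.base k α) (RepCat k G.A)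
  let : HasFiniteProducts (RepCat k G.A) := hasFiniteProducts
  let : HasKernels (RepCat k G.A) := hasKernels
  let : HasCokernels (RepCat k G.A) := hasCokernels
  let : HasBinaryBiproducts (RepCat k G.A) := HasBinaryBiproducts.of_hasBinaryProducts
  let : HasZeroObject (RepCat k G.A) := hasZeroObject_of_hasTerminal_object
  let : HasEqualizers (RepCat k G.A) := Preadditive.hasEqualizers_of_hasKernels
  let : HasCoequalizers (RepCat k G.A) := Preadditive.hasCoequalizers_of_hasCokernels
  let : HasFiniteBiproducts (RepCat k G.A) := HasFiniteBiproducts.of_hasFiniteProducts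
  have hadd : (F ⋙ U).Additive := ⟨fun {X Y f g} => (G.isLinearOver α).map_add f g⟩
  have hker : ∀ {X Y : RepCat k G.A} (f : X ⟶ Y), PreservesLimit (parallelPair f 0) (F ⋙ U) := by
    intro X Y f
    refine preservesLimit_of_preserves_limit_cone (kerι_isLimit f).some ?_
    refine (KernelFork.isLimitMapConeEquiv _ (F ⋙ U)).symm ?_
    exact (nonempty_isLimit_of_exact ((F ⋙ U).map (kerι f)) ((F ⋙ U).map f)
      (by rw [← Functor.map_comp, kerι_comp, Functor.map_zero])
      (TauV.map_injective _ (kerι_injective f))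
      fun t ht => TauV.map_exact _ _ (LinearMap.exact_subtype_ker_map (lin f)) t ht).some
  have hcok : ∀ {X Y : RepCat k G.A} (f : X ⟶ Y),
      PreservesColimit (parallelPair f 0) (F ⋙ U) := by
    intro X Y f
    refine preservesColimit_of_preserves_colimit_cocone (cokπ_isColimit f).some ?_
    refine (CokernelCofork.isColimitMapCoconeEquiv _ (F ⋙ U)).symm ?_
    exact (nonempty_isColimit_of_exact ((F ⋙ U).map f) ((F ⋙ U).map (cokπ f))
      (by rw [← Functor.map_comp, comp_cokπ, Functor.map_zero])
      (TauV.map_surjective _ (cokπ_surjective f))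
      fun t ht => TauV.map_exact _ _ (fun y => (cokπ_eq_zero f y)) t ht).some
  have h₁ : PreservesFiniteLimits (F ⋙ U) := (F ⋙ U).preservesFiniteLimits_of_preservesKernels
  have h₂ : PreservesFiniteColimits (F ⋙ U) :=
    (F ⋙ U).preservesFiniteColimits_of_preservesCokernels
  refine ⟨⟨fun J _ _ => ?_⟩, ⟨fun J _ _ => ?_⟩⟩
  · have := EMod.reflectsLimitsOfShape_forget (k := k) (E := M.base k α) (C := RepCat k G.A) J
    exact preservesLimitsOfShape_of_reflects_of_preserves F U
  · have := EMod.reflectsColimitsOfShape_forget (k := k) (E := M.base k α) (C := RepCat k G.A) J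
    exact preservesColimitsOfShape_of_reflects_of_preserves F U

end MGroup

end Tau

/-! ### The coalgebra dual to a finite dimensional algebra. -/

section DualComul
open scoped TensorProduct
variable (k : Type u) [Field k] {E : Type u} [CommRing E] [Algebra k E]

/-- The transpose of the multiplication by an element. -/
def mulDual (e : E) : Module.Dual k E →ₗ[k] Module.Dual k E := (LinearMap.mulLeft k e).dualMap

theorem mulDual_apply (e e' : E) (θ : Module.Dual k E) : mulDual k e θ e' = θ (e * e') := rfl

theorem mulDual_mul (e e' : E) (θ : Module.Dual k E) :
    mulDual k e (mulDual k e' θ) = mulDual k (e * e') θ :=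
  LinearMap.ext fun x => by
    rw [mulDual_apply, mulDual_apply, mulDual_apply, mul_left_comm, mul_assoc]

variable {k} in
-- Finite dimension identifies tensors of functionals with bilinear forms, so identities about
-- `dualComul` are checked on pairs of elements.
theorem dualDistrib_ext [Module.Finite k E] {E' : Type u} [AddCommGroup E'] [Module k E']
    [Module.Finite k E'] {s t : Module.Dual k E ⊗[k] Module.Dual k E'}
    (h : ∀ e e', TensorProduct.dualDistrib k E E' s (e ⊗ₜ e') =
      TensorProduct.dualDistrib k E E' t (e ⊗ₜ e')) : s = t :=
  (TensorProduct.dualDistribEquiv k E E').injective (TensorProduct.ext' h)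

variable (E) [Module.Finite k E]

/-- The comultiplication of the dual of a finite dimensional algebra. -/
noncomputable def dualComul : Module.Dual k E →ₗ[k] Module.Dual k E ⊗[k] Module.Dual k E :=
  (TensorProduct.dualDistribEquiv k E E).symm.toLinearMap ∘ₗ (LinearMap.mul' k E).dualMap

variable {k E}

theorem dualDistrib_dualComul (θ : Module.Dual k E) (e e' : E) :
    TensorProduct.dualDistrib k E E (dualComul k E θ) (e ⊗ₜ e') = θ (e * e') :=
  congrArg (fun f : Module.Dual k (E ⊗[k] E) => f (e ⊗ₜ e'))
    ((TensorProduct.dualDistribEquiv k E E).apply_symm_apply ((LinearMap.mul' k E).dualMap θ))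

omit [Module.Finite k E] in
theorem dualDistrib_map {E' F F' : Type u} [AddCommGroup E'] [Module k E'] [AddCommGroup F]
    [Module k F] [AddCommGroup F'] [Module k F'] (f : F →ₗ[k] E) (g : F' →ₗ[k] E')
    (t : Module.Dual k E ⊗[k] Module.Dual k E') (e : F) (e' : F') :
    TensorProduct.dualDistrib k F F' (TensorProduct.map f.dualMap g.dualMap t) (e ⊗ₜ e') =
      TensorProduct.dualDistrib k E E' t (f e ⊗ₜ g e') := by
  induction t with
  | zero => simp
  | add x y hx hy => simp only [map_add, LinearMap.add_apply, hx, hy]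
  | tmul x y => simp

/-- As forms, both sides are `(x, x') ↦ θ (e e' x x')`, because `E` is commutative. Consequently the
two actions of `E` agree on the image of `dualComul`. -/
theorem map_mulDual_dualComul (e e' : E) (θ : Module.Dual k E) :
    TensorProduct.map (mulDual k e) (mulDual k e') (dualComul k E θ) =
      dualComul k E (mulDual k (e * e') θ) := dualDistrib_ext fun x x' => by
  rw [mulDual, mulDual, dualDistrib_map, dualDistrib_dualComul, dualDistrib_dualComul,
    mulDual_apply, LinearMap.mulLeft_apply, LinearMap.mulLeft_apply]
  congr 1
  ring

omit [Module.Finite k E] in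
theorem mulDual_one : mulDual k (1 : E) = LinearMap.id :=
  LinearMap.ext fun θ => LinearMap.ext fun e => by rw [mulDual_apply, one_mul, LinearMap.id_apply]

theorem rTensor_mulDual_dualComul (e : E) (θ : Module.Dual k E) :
    LinearMap.rTensor _ (mulDual k e) (dualComul k E θ) = dualComul k E (mulDual k e θ) := by
  have h := map_mulDual_dualComul e 1 θ
  rwa [mul_one, mulDual_one] at h

theorem lTensor_mulDual_dualComul (e : E) (θ : Module.Dual k E) :
    LinearMap.lTensor _ (mulDual k e) (dualComul k E θ) = dualComul k E (mulDual k e θ) := by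
  have h := map_mulDual_dualComul 1 e θ
  rwa [one_mul, mulDual_one] at h

theorem comm_dualComul (θ : Module.Dual k E) :
    TensorProduct.comm k _ _ (dualComul k E θ) = dualComul k E θ := dualDistrib_ext fun e e' => by
  have h : ∀ t, TensorProduct.dualDistrib k E E (TensorProduct.comm k _ _ t) (e ⊗ₜ e') =
      TensorProduct.dualDistrib k E E t (e' ⊗ₜ e) := fun t => by
    induction t with
    | zero => simp
    | add x y hx hy => simp only [map_add, LinearMap.add_apply, hx, hy]
    | tmul x y => simp [mul_comm]
  rw [h, dualDistrib_dualComul, dualDistrib_dualComul, mul_comm]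

theorem map_dualMap_dualComul {F : Type u} [CommRing F] [Algebra k F] [Module.Finite k F]
    (f : E →ₐ[k] F) (θ : Module.Dual k F) :
    TensorProduct.map f.toLinearMap.dualMap f.toLinearMap.dualMap (dualComul k F θ) =
      dualComul k E (f.toLinearMap.dualMap θ) := dualDistrib_ext fun e e' => by
  rw [dualDistrib_map, dualDistrib_dualComul, dualDistrib_dualComul, LinearMap.dualMap_apply,
    AlgHom.toLinearMap_apply, AlgHom.toLinearMap_apply, AlgHom.toLinearMap_apply, map_mul f]

omit [Module.Finite k E] in
theorem lid_rTensor_eval {E' : Type u} [AddCommGroup E'] [Module k E'] (e : E) (e' : E')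
    (t : Module.Dual k E ⊗[k] Module.Dual k E') :
    TensorProduct.lid k (Module.Dual k E') (LinearMap.rTensor _ (Module.Dual.eval k E e) t) e' =
      TensorProduct.dualDistrib k E E' t (e ⊗ₜ e') := by
  induction t with
  | zero => simp
  | add x y hx hy => simp only [map_add, LinearMap.add_apply, hx, hy]
  | tmul x y => simp

/-- For `e = 1` this is the counit law. The unit law for `τ` needs it at `e = μ(c)`. -/
theorem lid_rTensor_eval_dualComul (e : E) (θ : Module.Dual k E) :
    TensorProduct.lid k _ (LinearMap.rTensor _ (Module.Dual.eval k E e) (dualComul k E θ)) =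
      mulDual k e θ := LinearMap.ext fun e' => by
  rw [lid_rTensor_eval, dualDistrib_dualComul, mulDual_apply]

theorem dualComul_coassoc (θ : Module.Dual k E) :
    TensorProduct.assoc k _ _ _ (LinearMap.rTensor _ (dualComul k E) (dualComul k E θ)) =
      LinearMap.lTensor _ (dualComul k E) (dualComul k E θ) := by
  have h₁ : ∀ (e e' e'' : E) (t : (Module.Dual k E ⊗[k] Module.Dual k E) ⊗[k] Module.Dual k E),
      TensorProduct.dualDistrib k E (E ⊗[k] E) (LinearMap.lTensor _
        (TensorProduct.dualDistrib k E E) (TensorProduct.assoc k _ _ _ t)) (e ⊗ₜ (e' ⊗ₜ e'')) =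
      TensorProduct.dualDistrib k (E ⊗[k] E) E (LinearMap.rTensor _
        (TensorProduct.dualDistrib k E E) t) ((e ⊗ₜ e') ⊗ₜ e'') := by
    intro e e' e'' t
    induction t with
    | zero => simp
    | add x y hx hy => simp only [map_add, LinearMap.add_apply, hx, hy]
    | tmul x z =>
      induction x with
      | zero => simp
      | add x y hx hy =>
        simp only [TensorProduct.add_tmul, map_add, LinearMap.add_apply, hx, hy]
      | tmul x y => simp [mul_assoc]
  have h₂ : ∀ (e e' e'' : E) (t : Module.Dual k E ⊗[k] Module.Dual k E),
      TensorProduct.dualDistrib k (E ⊗[k] E) E (LinearMap.rTensor _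
        (TensorProduct.dualDistrib k E E) (LinearMap.rTensor _ (dualComul k E) t))
          ((e ⊗ₜ e') ⊗ₜ e'') =
      TensorProduct.dualDistrib k E E t ((e * e') ⊗ₜ e'') := by
    intro e e' e'' t
    induction t with
    | zero => simp
    | add x y hx hy => simp only [map_add, LinearMap.add_apply, hx, hy]
    | tmul x y => simp [dualDistrib_dualComul]
  have h₃ : ∀ (e e' e'' : E) (t : Module.Dual k E ⊗[k] Module.Dual k E),
      TensorProduct.dualDistrib k E (E ⊗[k] E) (LinearMap.lTensor _
        (TensorProduct.dualDistrib k E E) (LinearMap.lTensor _ (dualComul k E) t))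
          (e ⊗ₜ (e' ⊗ₜ e'')) =
      TensorProduct.dualDistrib k E E t (e ⊗ₜ (e' * e'')) := by
    intro e e' e'' t
    induction t with
    | zero => simp
    | add x y hx hy => simp only [map_add, LinearMap.add_apply, hx, hy]
    | tmul x y => simp [dualDistrib_dualComul]
  -- Turning the last two factors into forms on `E ⊗ E` allows testing on triples, where both sides
  -- are `θ (e e' e'')`.
  refine (LinearEquiv.lTensor (Module.Dual k E) (TensorProduct.dualDistribEquiv k E E)).injective ?_
  refine dualDistrib_ext fun e t => ?_
  induction t with
  | zero => simp
  | add x y hx hy => simp only [TensorProduct.tmul_add, map_add, hx, hy]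
  | tmul e' e'' =>
    refine (h₁ e e' e'' _).trans ((h₂ e e' e'' _).trans (Eq.trans ?_ (h₃ e e' e'' _).symm))
    rw [dualDistrib_dualComul, dualDistrib_dualComul, mul_assoc]

end DualComul

/-! ### The comparison map $\delta$ from $\tau(X\otimes Y)$ to $\tau(X)\otimes\tau(Y)$ and its
image. -/

section Tau
open scoped TensorProduct
variable {k₀ : Type u} [CommRing k₀] {k : Type u} [Field k] [Algebra k₀ k]
  {M : FormalMonoid k₀}

namespace TauV
variable {μ : MAction M k} {α β : M.I} {X : Type u} [AddCommGroup X] [Module k X]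
  {Y : Type u} [AddCommGroup Y] [Module k Y]

theorem tmulDual_add (x x' : X) : tmulDual μ α (x + x') = tmulDual μ α x + tmulDual μ α x' :=
  LinearMap.ext fun θ => tmul_add (CoE.mk θ) x x'

theorem base_smul_tmulDual (e : M.base k α) (x : X) (θ : Module.Dual k (M.base k α)) :
    e • tmulDual μ α x θ = tmulDual μ α x (mulDual k e θ) := rfl

theorem lsmul_comp_tmulDual (e : M.base k α) (x : X) :
    (Algebra.lsmul k k (TauV μ α X) e : _ →ₗ[k] _) ∘ₗ tmulDual μ α x =
      tmulDual μ α x ∘ₗ mulDual k e := rfl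

theorem tmulDual_smul (c : k) (x : X) :
    tmulDual μ α (c • x) = tmulDual μ α x ∘ₗ mulDual k (μ.act α c : M.base k α) :=
  LinearMap.ext fun θ => (act_smul_tmul c (CoE.mk θ) x).symm

theorem contractDual_comp_tmulDual (φ : X →ₗ[k] k) (x : X) :
    contractDual φ ∘ₗ tmulDual μ α x = mulDual k (μ.act α (φ x) : M.base k α) := rfl

theorem map_comp_tmulDual (f : X →ₗ[k] Y) (x : X) :
    (TauV.map f).restrictScalars k ∘ₗ tmulDual μ α x = tmulDual μ α (f x) := rfl

theorem res_comp_tmulDual (f : α ⟶ β) (x : X) :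
    res f ∘ₗ tmulDual μ β x = tmulDual μ α x ∘ₗ (M.baseRes k f).toLinearMap.dualMap := rfl

theorem contractDual_comp_lsmul (φ : X →ₗ[k] k) (e : M.base k α) :
    contractDual φ ∘ₗ (Algebra.lsmul k k (TauV μ α X) e : _ →ₗ[k] _) =
      mulDual k e ∘ₗ contractDual φ :=
  LinearMap.ext fun t => LinearMap.ext fun e' => contractDual_base_smul φ t e e'

theorem linearMap_ext {Z : Type*} [AddCommMonoid Z] [Module k Z]
    {f g : TauV μ α (X ⊗[k] Y) →ₗ[k] Z}
    (h : ∀ θ x y, f (tmul θ (x ⊗ₜ y)) = g (tmul θ (x ⊗ₜ y))) : f = g := by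
  refine LinearMap.ext fun t => ?_
  induction t using induction with
  | zero => simp
  | add s t hs ht => simp only [map_add, hs, ht]
  | tm θ s =>
    induction s with
    | zero => rw [tmul_zero, map_zero, map_zero]
    | add s t hs ht => simp only [tmul_add, map_add, hs, ht]
    | tmul x y => exact h θ x y

/-- The pairing `(x, y) ↦ δ(θ ⊗ (x ⊗ y))`. -/
noncomputable def δAux (θ : Module.Dual k (M.base k α)) : X ⊗[k] Y →+ TauV μ α X ⊗[k] TauV μ α Y :=
  TensorProduct.liftAddHom
    (AddMonoidHom.mk' (fun x => AddMonoidHom.mk' (fun y =>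
        TensorProduct.map (tmulDual μ α x) (tmulDual μ α y) (dualComul k _ θ))
      (fun y y' => by rw [tmulDual_add, TensorProduct.map_add_right]; rfl))
      (fun x x' => AddMonoidHom.ext fun y => by
        simp only [AddMonoidHom.mk'_apply, AddMonoidHom.add_apply, tmulDual_add,
          TensorProduct.map_add_left, LinearMap.add_apply]))
    (fun c x y => by
      -- A scalar on `x` or on `y` becomes `μ(c)` on the left or the right factor of `dualComul θ`,
      -- where these agree.
      change TensorProduct.map (tmulDual μ α (c • x)) (tmulDual μ α y) (dualComul k _ θ) =
        TensorProduct.map (tmulDual μ α x) (tmulDual μ α (c • y)) (dualComul k _ θ)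
      rw [tmulDual_smul, tmulDual_smul, ← LinearMap.map_comp_rTensor, ← LinearMap.map_comp_lTensor,
        LinearMap.comp_apply, LinearMap.comp_apply, rTensor_mulDual_dualComul,
        lTensor_mulDual_dualComul])

theorem δAux_tmul (θ : Module.Dual k (M.base k α)) (x : X) (y : Y) :
    δAux (μ := μ) θ (x ⊗ₜ y) =
      TensorProduct.map (tmulDual μ α x) (tmulDual μ α y) (dualComul k _ θ) := rfl

theorem δAux_mulDual (e : M.base k α) (θ : Module.Dual k (M.base k α)) (s : X ⊗[k] Y) :
    δAux (μ := μ) (mulDual k e θ) s =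
      LinearMap.rTensor _ (Algebra.lsmul k k (TauV μ α X) e) (δAux (μ := μ) θ s) := by
  induction s with
  | zero => simp
  | add s t hs ht => simp only [map_add, hs, ht]
  | tmul x y =>
    rw [δAux_tmul, δAux_tmul, ← LinearMap.comp_apply (LinearMap.rTensor _ _),
      LinearMap.rTensor_comp_map, lsmul_comp_tmulDual, ← LinearMap.map_comp_rTensor,
      LinearMap.comp_apply, rTensor_mulDual_dualComul]

/-- The map `τ(X ⊗ Y) → τ(X) ⊗ τ(Y)` that is given by the comultiplication of `E_α^∨`. -/
noncomputable def δ : TauV μ α (X ⊗[k] Y) →ₗ[k] TauV μ α X ⊗[k] TauV μ α Y where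
  toFun := lift (fun θ s => δAux (CoE.toDual θ) s)
    (fun θ θ' s => by
      induction s with
      | zero => simp
      | add s t hs ht => simp only [map_add, hs, ht]; abel
      | tmul x y =>
        rw [δAux_tmul, δAux_tmul, δAux_tmul, ← map_add, ← map_add]
        rfl)
    (fun θ s t => map_add _ s t)
    (fun c θ s => by
      induction s with
      | zero => simp
      | add s t hs ht => simp only [map_add, smul_add, hs, ht]
      | tmul x y =>
        rw [TensorProduct.smul_tmul', δAux_tmul, δAux_tmul, tmulDual_smul,
          ← LinearMap.map_comp_rTensor, LinearMap.comp_apply, rTensor_mulDual_dualComul]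
        rfl)
  map_add' := map_add _
  map_smul' c t := by
    rw [RingHom.id_apply, ← algebraMap_smul (M.base k α) c t]
    induction t using induction with
    | zero => simp
    | add s t hs ht => simp only [smul_add, map_add, hs, ht]
    | tm θ s =>
      change δAux (mulDual k _ (CoE.toDual θ)) s = c • δAux (CoE.toDual θ) s
      rw [δAux_mulDual]
      have h : Algebra.lsmul k k (TauV μ α X) (algebraMap k (M.base k α) c) =
        c • LinearMap.id := LinearMap.ext fun _ => rfl
      rw [h, LinearMap.rTensor_smul, LinearMap.rTensor_id]
      rfl

theorem δ_tmul (θ : CoE μ α) (x : X) (y : Y) : δ (tmul θ (x ⊗ₜ[k] y)) =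
    TensorProduct.map (tmulDual μ α x) (tmulDual μ α y) (dualComul k _ (CoE.toDual θ)) := rfl

theorem δ_tmulDual (θ : Module.Dual k (M.base k α)) (x : X) (y : Y) :
    δ (tmulDual μ α (x ⊗ₜ[k] y) θ) =
    TensorProduct.map (tmulDual μ α x) (tmulDual μ α y) (dualComul k _ θ) := rfl

theorem δ_base_smul (e : M.base k α) (t : TauV μ α (X ⊗[k] Y)) :
    δ (e • t) = LinearMap.rTensor _ (Algebra.lsmul k k (TauV μ α X) e) (δ t) := by
  induction t using induction with
  | zero => simp
  | add s t hs ht => simp only [smul_add, map_add, hs, ht]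
  | tm θ s => exact δAux_mulDual e (CoE.toDual θ) s

theorem δ_balanced (e : M.base k α) (t : TauV μ α (X ⊗[k] Y)) :
    LinearMap.rTensor _ (Algebra.lsmul k k (TauV μ α X) e) (δ t) =
      LinearMap.lTensor _ (Algebra.lsmul k k (TauV μ α Y) e) (δ t) := by
  refine LinearMap.congr_fun (linearMap_ext
    (f := LinearMap.rTensor _ (Algebra.lsmul k k (TauV μ α X) e : _ →ₗ[k] _) ∘ₗ δ)
    (g := LinearMap.lTensor _ (Algebra.lsmul k k (TauV μ α Y) e : _ →ₗ[k] _) ∘ₗ δ)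
    fun θ x y => ?_) t
  rw [LinearMap.comp_apply, LinearMap.comp_apply]
  rw [δ_tmul, ← LinearMap.comp_apply (LinearMap.rTensor _ _), LinearMap.rTensor_comp_map,
    ← LinearMap.comp_apply (LinearMap.lTensor _ _), LinearMap.lTensor_comp_map,
    lsmul_comp_tmulDual, lsmul_comp_tmulDual, ← LinearMap.map_comp_rTensor,
    ← LinearMap.map_comp_lTensor, LinearMap.comp_apply, LinearMap.comp_apply,
    rTensor_mulDual_dualComul, lTensor_mulDual_dualComul]

/-- In coordinates `δ` is `dualComul`, so that its injectivity and its image are questions about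
`E_α^∨` alone. -/
theorem map_contractDual_δ (φ : X →ₗ[k] k) (ψ : Y →ₗ[k] k) (t : TauV μ α (X ⊗[k] Y)) :
    TensorProduct.map (contractDual φ) (contractDual ψ) (δ t) =
      dualComul k _ (contractDual (TensorProduct.dualDistrib k X Y (φ ⊗ₜ ψ)) t) := by
  refine LinearMap.congr_fun (linearMap_ext
    (f := TensorProduct.map (contractDual φ) (contractDual ψ) ∘ₗ δ)
    (g := dualComul k (M.base k α) ∘ₗ contractDual (TensorProduct.dualDistrib k X Y (φ ⊗ₜ ψ)))
    fun θ x y => ?_) t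
  rw [LinearMap.comp_apply, LinearMap.comp_apply]
  rw [δ_tmul, TensorProduct.map_map, contractDual_comp_tmulDual, contractDual_comp_tmulDual,
    map_mulDual_dualComul, ← map_mul]
  rfl

theorem ext_map_contractDual {ι κ : Type*} [Fintype ι] [Fintype κ] (b : Module.Basis ι k X)
    (c : Module.Basis κ k Y) {s t : TauV μ α X ⊗[k] TauV μ α Y}
    (h : ∀ i j, TensorProduct.map (contractDual (b.coord i)) (contractDual (c.coord j)) s =
      TensorProduct.map (contractDual (b.coord i)) (contractDual (c.coord j)) t) : s = t := by
  have key : ∀ t : TauV μ α X ⊗[k] TauV μ α Y, ∑ i, ∑ j, TensorProduct.map (tmulDual μ α (b i))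
      (tmulDual μ α (c j)) (TensorProduct.map (contractDual (b.coord i))
        (contractDual (c.coord j)) t) = t := by
    intro t
    induction t with
    | zero => simp
    | add s t hs ht => simp only [map_add, Finset.sum_add_distrib, hs, ht]
    | tmul s t =>
      simp only [TensorProduct.map_tmul, ← TensorProduct.tmul_sum, ← TensorProduct.sum_tmul]
      exact congrArg₂ _ (sum_tmul_contract b b.coord b.sum_repr s)
        (sum_tmul_contract c c.coord c.sum_repr t)
  rw [← key s, ← key t]
  simp only [h]

theorem dualDistrib_coord {ι κ : Type*} (b : Module.Basis ι k X)
    (c : Module.Basis κ k Y) (i : ι) (j : κ) :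
    TensorProduct.dualDistrib k X Y (b.coord i ⊗ₜ c.coord j) = (b.tensorProduct c).coord (i, j) :=
  TensorProduct.ext' fun x y => by simp [mul_comm]

/-- Each coordinate `θ` is recovered from the form `(e, e') ↦ θ (e e')` by setting the first
variable to 1. -/
theorem δ_injective [Module.Finite k X] [Module.Finite k Y] :
    Function.Injective (δ : TauV μ α (X ⊗[k] Y) →ₗ[k] _) := fun s t h => by
  let b := Module.finBasis k X
  let c := Module.finBasis k Y
  refine ext_contractDual (b.tensorProduct c) ?_
  rintro ⟨i, j⟩ e
  have h' := congrArg (TensorProduct.map (contractDual (b.coord i)) (contractDual (c.coord j))) h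
  rw [map_contractDual_δ, map_contractDual_δ, dualDistrib_coord] at h'
  have h'' := congrArg (fun u => TensorProduct.dualDistrib k _ _ u (1 ⊗ₜ[k] e)) h'
  simpa only [dualDistrib_dualComul, one_mul] using h''

/-- The coordinates of a balanced tensor are forms `U i j` with `U(e, e') = U(1, e e')`. Such a form
is `dualComul` of the functional `U(1, -)`, and these functionals are the coordinates of the
preimage. -/
theorem exists_δ_eq [Module.Finite k X] [Module.Finite k Y] (T : TauV μ α X ⊗[k] TauV μ α Y)
    (hT : ∀ e : M.base k α, LinearMap.rTensor _ (Algebra.lsmul k k (TauV μ α X) e) T =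
      LinearMap.lTensor _ (Algebra.lsmul k k (TauV μ α Y) e) T) : ∃ t, δ t = T := by
  let b := Module.finBasis k X
  let c := Module.finBasis k Y
  let U : ∀ _ _, Module.Dual k (M.base k α) ⊗[k] Module.Dual k (M.base k α) := fun i j =>
    TensorProduct.map (contractDual (b.coord i)) (contractDual (c.coord j)) T
  have hU : ∀ i j e, LinearMap.rTensor _ (mulDual k e) (U i j) =
      LinearMap.lTensor _ (mulDual k e) (U i j) := by
    intro i j e
    have h := congrArg (TensorProduct.map (contractDual (b.coord i)) (contractDual (c.coord j)))
      (hT e)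
    rw [← LinearMap.comp_apply (TensorProduct.map _ _),
      ← LinearMap.comp_apply (TensorProduct.map _ _), LinearMap.map_comp_rTensor,
      LinearMap.map_comp_lTensor, contractDual_comp_lsmul, contractDual_comp_lsmul,
      ← LinearMap.rTensor_comp_map, ← LinearMap.lTensor_comp_map] at h
    exact h
  have hU' : ∀ i j e e', TensorProduct.dualDistrib k _ _ (U i j) (e ⊗ₜ e') =
      TensorProduct.dualDistrib k _ _ (U i j) (1 ⊗ₜ (e * e')) := by
    intro i j e e'
    have h := congrArg (fun u => TensorProduct.dualDistrib k _ _ u (1 ⊗ₜ[k] e')) (hU i j e)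
    have h₁ := dualDistrib_map (LinearMap.mulLeft k e) LinearMap.id (U i j) 1 e'
    have h₂ := dualDistrib_map LinearMap.id (LinearMap.mulLeft k e) (U i j) 1 e'
    rw [LinearMap.dualMap_id] at h₁ h₂
    rw [LinearMap.mulLeft_apply, mul_one] at h₁
    exact h₁.symm.trans (h.trans h₂)
  let t : TauV μ α (X ⊗[k] Y) := ofCoord (b.tensorProduct c) fun p =>
    TensorProduct.dualDistrib k _ _ (U p.1 p.2) ∘ₗ TensorProduct.mk k _ _ 1
  refine ⟨t, ext_map_contractDual b c fun i j => ?_⟩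
  rw [map_contractDual_δ, dualDistrib_coord, contractDual_ofCoord]
  refine dualDistrib_ext fun e e' => ?_
  rw [dualDistrib_dualComul]
  exact (hU' i j e e').symm

end TauV
end Tau

/-! ### The unit, equivariance of $\delta$, and the axioms of a tensor functor. -/

section Tau
open scoped TensorProduct
variable {k₀ : Type u} [CommRing k₀] {k : Type u} [Field k] [Algebra k₀ k]
  {M : FormalMonoid k₀}

/-- The map `B ⊗ D → N ⊗ B` of `coeffAct`, as a function of the vector. -/
def coeffActL {D : Type u} [CommRing D] [Algebra k₀ D] (N : Type u) [AddCommGroup N] [Module k N]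
    [Module (k ⊗[k₀] D) N] [IsScalarTower k (k ⊗[k₀] D) N]
    {B : Type u} [CommRing B] [Algebra k B] [Algebra k₀ B] [IsScalarTower k₀ k B]
    (t : B ⊗[k₀] D) : N →ₗ[k] N ⊗[k] B where
  toFun n := coeffAct B n t
  map_add' n n' := coeffAct_add n n' t
  map_smul' c n := coeffAct_smul n c t

namespace TauV
variable {μ : MAction M k} {α β : M.I} {X : Type u} [AddCommGroup X] [Module k X]

/-- The map `τ_α(1) → 1`: evaluation at the unit of `E_α`. -/
def ε : TauV μ α k →ₗ[k] k := Module.Dual.eval k (M.base k α) 1 ∘ₗ contractDual LinearMap.id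

theorem ε_apply (t : TauV μ α k) : ε t = contractDual LinearMap.id t 1 := rfl

theorem ε_tmul (θ : CoE μ α) (c : k) : ε (tmul θ c) = CoE.toDual θ (μ.act α c) := by
  rw [ε_apply, contractDual_tmul, LinearMap.id_apply, mul_one]

theorem ε_comp_tmulDual (c : k) : ε ∘ₗ tmulDual μ α c = Module.Dual.eval k _ (μ.act α c) :=
  LinearMap.ext fun θ => ε_tmul (CoE.mk θ) c

theorem ε_base_smul (w : M.base k α) (t : TauV μ α k) :
    ε (w • t) = contractDual LinearMap.id t w := by
  rw [ε_apply, contractDual_base_smul, mul_one]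

theorem ε_algebraMap_smul (c : k) (t : TauV μ α k) :
    ε (algebraMap k (M.base k α) c • t) = c • ε t := by
  rw [algebraMap_smul, map_smul]

theorem ε_res (f : α ⟶ β) (t : TauV μ β k) : ε (res f t) = ε t := by
  rw [ε_apply, ε_apply, contractDual_res, map_one]

theorem coord_singleton : (Module.Basis.singleton Unit k).coord () = LinearMap.id :=
  LinearMap.ext fun c => by simp

/-- The functional `w ↦ ε (w • t)` is the single coordinate of `t`. With `exists_ε` this identifies
`τ_α(1)` with `E_α^∨`, as the universal property of the unit requires. -/
theorem eq_zero_of_ε (t : TauV μ α k) (h : ∀ w : M.base k α, ε (w • t) = 0) : t = 0 := by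
  refine ext_contractDual (Module.Basis.singleton Unit k) fun i e => ?_
  rw [coord_singleton, ← ε_base_smul, h, map_zero, LinearMap.zero_apply]

theorem exists_ε (h : M.base k α →ₗ[k] k) :
    ∃ t : TauV μ α k, ∀ w : M.base k α, ε (w • t) = h w := by
  refine ⟨tmul (CoE.mk h) (1 : k), fun w => ?_⟩
  rw [ε_base_smul, contractDual_tmul, LinearMap.id_apply, map_one, one_mul]
  rfl

/-- On the vectors `θ ⊗ c`, the map `ε` is evaluation at `μ(c)`. Contracting `dualComul θ` with it
gives `μ(c) θ`, and this scalar moves across `⊗_μ` to `x`. -/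
theorem lid_rTensor_ε_δ (θ : CoE μ α) (c : k) (x : X) :
    TensorProduct.lid k _ (LinearMap.rTensor _ ε (δ (tmul θ (c ⊗ₜ[k] x)))) = tmul θ (c • x) := by
  have h : ∀ T, TensorProduct.lid k _ (LinearMap.lTensor k (tmulDual μ α x) T) =
      tmulDual μ α x (TensorProduct.lid k _ T) := fun T => by
    induction T with
    | zero => simp
    | add s t hs ht => simp only [map_add, hs, ht]
    | tmul c θ => simp
  rw [δ_tmul, ← LinearMap.comp_apply (LinearMap.rTensor _ _), LinearMap.rTensor_comp_map,
    ε_comp_tmulDual, ← LinearMap.lTensor_comp_rTensor, LinearMap.comp_apply, h,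
    lid_rTensor_eval_dualComul, ← act_smul_tmul]
  rfl

theorem rid_lTensor_ε_δ (θ : CoE μ α) (c : k) (x : X) :
    TensorProduct.rid k _ (LinearMap.lTensor _ ε (δ (tmul θ (x ⊗ₜ[k] c)))) = tmul θ (c • x) := by
  rw [← lid_rTensor_ε_δ, δ_tmul, δ_tmul]
  -- Cocommutativity reduces the right unit law to the left one.
  conv_rhs => rw [← comm_dualComul]
  generalize dualComul k _ (CoE.toDual θ) = T
  induction T with
  | zero => simp
  | add s t hs ht => simp only [map_add, hs, ht]
  | tmul c θ => simp

end TauV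

namespace MGroup
open RepCat
variable {μ : MAction M k} (G : MGroup μ) (α : M.I) {X : Type u} [AddCommGroup X] [Module k X]
  {Y : Type u} [AddCommGroup Y] [Module k Y]

/-- The multiplication of coefficients in a tensor product. -/
def mulCoeff (A : Type u) [CommRing A] [Algebra k A] (U W : Type u) [AddCommGroup U] [Module k U]
    [AddCommGroup W] [Module k W] : (U ⊗[k] A) ⊗[k] (W ⊗[k] A) →ₗ[k] (U ⊗[k] W) ⊗[k] A :=
  LinearMap.lTensor (U ⊗[k] W) (LinearMap.mul' k A) ∘ₗ
    (TensorProduct.tensorTensorTensorComm k U A W A).toLinearMap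

theorem mulCoeff_tmul (A : Type u) [CommRing A] [Algebra k A] (U W : Type u) [AddCommGroup U]
    [Module k U] [AddCommGroup W] [Module k W] (x : U) (y : W) (a b : A) :
    mulCoeff A U W ((x ⊗ₜ a) ⊗ₜ (y ⊗ₜ b)) = (x ⊗ₜ y) ⊗ₜ[k] (a * b) := rfl

/-- For pure tensors `p = a ⊗ d` and `q = b ⊗ d'` this is `map_mulDual_dualComul` at the elements `1
⊗ d` and `1 ⊗ d'`; both sides are biadditive in `p` and `q`. -/
theorem mulCoeff_coeffAct (θ : Module.Dual k (M.base k α)) (x : X) (y : Y)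
    (p q : G.A ⊗[k₀] M.E α) :
    mulCoeff G.A _ _ (TensorProduct.map (coeffActL (TauV μ α X) p ∘ₗ TauV.tmulDual μ α x)
        (coeffActL (TauV μ α Y) q ∘ₗ TauV.tmulDual μ α y) (dualComul k _ θ)) =
      LinearMap.rTensor G.A TauV.δ (coeffAct G.A (TauV.tmulDual μ α (x ⊗ₜ[k] y) θ) (p * q)) := by
  have hadd : ∀ (N : Type u) [AddCommGroup N] [Module k N] [Module (k ⊗[k₀] M.E α) N]
      [IsScalarTower k (k ⊗[k₀] M.E α) N] (p p' : G.A ⊗[k₀] M.E α),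
      coeffActL N (p + p') = coeffActL (k := k) N p + coeffActL N p' := fun N _ _ _ _ p p' =>
    LinearMap.ext fun n => map_add (coeffAct (k₀ := k₀) (k := k) G.A n) p p'
  have hzero : ∀ (N : Type u) [AddCommGroup N] [Module k N] [Module (k ⊗[k₀] M.E α) N]
      [IsScalarTower k (k ⊗[k₀] M.E α) N],
      coeffActL N (0 : G.A ⊗[k₀] M.E α) = (0 : N →ₗ[k] N ⊗[k] G.A) := fun N _ _ _ _ =>
    LinearMap.ext fun n => map_zero (coeffAct (k₀ := k₀) (k := k) (D := M.E α) G.A n)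
  induction p with
  | zero =>
    rw [hzero, LinearMap.zero_comp, TensorProduct.map_zero_left, zero_mul, map_zero, map_zero,
      LinearMap.zero_apply, map_zero]
  | add p p' hp hp' =>
    rw [hadd, LinearMap.add_comp, TensorProduct.map_add_left, add_mul, map_add, map_add,
      LinearMap.add_apply, map_add, hp, hp']
  | tmul a d =>
    induction q with
    | zero =>
      rw [hzero, LinearMap.zero_comp, TensorProduct.map_zero_right, mul_zero, map_zero, map_zero,
        LinearMap.zero_apply, map_zero]
    | add p p' hp hp' =>
      rw [hadd, LinearMap.add_comp, TensorProduct.map_add_right, mul_add, map_add, map_add,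
        LinearMap.add_apply, map_add, hp, hp']
    | tmul b d' =>
      have key : ∀ T, mulCoeff G.A _ _ (TensorProduct.map
          (coeffActL (TauV μ α X) (a ⊗ₜ[k₀] d) ∘ₗ TauV.tmulDual μ α x)
          (coeffActL (TauV μ α Y) (b ⊗ₜ[k₀] d') ∘ₗ TauV.tmulDual μ α y) T) =
          (TensorProduct.map (TauV.tmulDual μ α x) (TauV.tmulDual μ α y)
            (TensorProduct.map (mulDual k ((1 : k) ⊗ₜ[k₀] d)) (mulDual k ((1 : k) ⊗ₜ[k₀] d')) T))
            ⊗ₜ[k] (a * b) := by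
        intro T
        induction T with
        | zero => simp
        | add s t hs ht => simp only [map_add, TensorProduct.add_tmul, hs, ht]
        | tmul θ θ' => rfl
      rw [key, map_mulDual_dualComul, Algebra.TensorProduct.tmul_mul_tmul,
        Algebra.TensorProduct.tmul_mul_tmul, one_mul, coeffAct_tmul, LinearMap.rTensor_tmul,
        TauV.base_smul_tmulDual, TauV.δ_tmulDual]

/-- The map `twist`, as a linear function of the functional. -/
def twistL (t : X ⊗[k] G.A) : Module.Dual k (M.base k α) →ₗ[k] TauV μ α X ⊗[k] G.A where
  toFun θ := G.twist α (CoE.mk θ) t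
  map_add' _ _ := TauV.tw_add _ _ _ _ _
  map_smul' c θ := by
    rw [RingHom.id_apply]
    induction t with
    | zero => simp
    | add s t hs ht => simp only [map_add, smul_add, hs, ht]
    | tmul x a =>
      rw [twist_tmul, twist_tmul, ← coeffAct_smul]
      exact congrArg (fun n => coeffAct G.A n (G.s.act α a)) ((TauV.tmulDual μ α x).map_smul c θ)

theorem twistL_add (s t : X ⊗[k] G.A) : G.twistL α (s + t) = G.twistL α s + G.twistL α t :=
  LinearMap.ext fun θ => map_add (G.twist α (CoE.mk θ)) s t

theorem twistL_zero : G.twistL α (0 : X ⊗[k] G.A) = 0 :=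
  LinearMap.ext fun θ => map_zero (G.twist α (CoE.mk θ))

/-- This is the equivariance of `δ`. It holds because the action of `M₀` on the Hopf algebra is by
ring maps, so that the twist of a product of coefficients is the product of the twists. -/
theorem mulCoeff_twist (θ : Module.Dual k (M.base k α)) (s : X ⊗[k] G.A) (t : Y ⊗[k] G.A) :
    mulCoeff G.A _ _ (TensorProduct.map (G.twistL α s) (G.twistL α t) (dualComul k _ θ)) =
      LinearMap.rTensor G.A TauV.δ (G.twist α (CoE.mk θ) (mulCoeff G.A _ _ (s ⊗ₜ t))) := by
  induction s with
  | zero =>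
    rw [twistL_zero, TensorProduct.map_zero_left, TensorProduct.zero_tmul, map_zero, map_zero,
      LinearMap.zero_apply, map_zero, map_zero]
  | add s s' hs hs' =>
    rw [twistL_add, TensorProduct.map_add_left, TensorProduct.add_tmul, map_add, map_add,
      LinearMap.add_apply, map_add, map_add, hs, hs']
  | tmul x a =>
    induction t with
    | zero =>
      rw [twistL_zero, TensorProduct.map_zero_right, TensorProduct.tmul_zero, map_zero, map_zero,
        LinearMap.zero_apply, map_zero, map_zero]
    | add s s' hs hs' =>
      rw [twistL_add, TensorProduct.map_add_right, TensorProduct.tmul_add, map_add, map_add,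
        LinearMap.add_apply, map_add, map_add, hs, hs']
    | tmul y b =>
      rw [mulCoeff_tmul, twist_tmul, map_mul]
      exact G.mulCoeff_coeffAct α θ x y (G.s.act α a) (G.s.act α b)

/-- The map `τ_α(X ⊗ Y) → τ_α(X) ⊗ τ_α(Y)`. -/
noncomputable def tauδ (X Y : RepCat k G.A) :
    G.tauObj α (tensor X Y) ⟶ tensor (G.tauObj α X) (G.tauObj α Y) :=
  ofLin (X := G.tauObj α (tensor X Y)) (Y := tensor (G.tauObj α X) (G.tauObj α Y)) TauV.δ
    (TauV.linearMap_ext fun θ x y => by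
      change mulCoeff G.A _ _ (TensorProduct.map (G.tauρ α X) (G.tauρ α Y)
        (TensorProduct.map (TauV.tmulDual μ α x) (TauV.tmulDual μ α y) (dualComul k _ θ))) =
        LinearMap.rTensor G.A TauV.δ (G.twist α θ (mulCoeff G.A _ _ (X.ρ x ⊗ₜ Y.ρ y)))
      refine Eq.trans ?_ (G.mulCoeff_twist α θ (X.ρ x) (Y.ρ y))
      rw [TensorProduct.map_map]
      rfl)

/-- The map `τ_α(1) → 1`. -/
def tauε : G.tauObj α triv ⟶ triv :=
  ofLin (X := G.tauObj α triv) (Y := triv) TauV.ε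
    (LinearMap.ext fun t => by
      induction t using TauV.induction with
      | zero => simp
      | add s t hs ht => exact (map_add _ s t).trans ((congrArg₂ _ hs ht).trans (map_add _ s t).symm)
      | tm θ c =>
        change TauV.ε (TauV.tmul θ c) ⊗ₜ 1 = LinearMap.rTensor G.A TauV.ε (G.twist α θ (c ⊗ₜ 1))
        rw [twist_tmul, map_one (G.s.act α), Algebra.TensorProduct.one_def, coeffAct_tmul,
          ← Algebra.TensorProduct.one_def, one_smul]
        rfl)

theorem isTensor_tauδ (X Y : RepCat k G.A) :
    EMod.IsTensor (G.tauMod α X) (G.tauMod α Y) (G.tauMod α (tensor X Y)) (G.tauδ α X Y) where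
  linear e := hom_ext (LinearMap.ext fun t => TauV.δ_base_smul e t)
  balanced e := hom_ext (LinearMap.ext fun t => TauV.δ_balanced e t)
  universal _ h hh := exists_lift (G.tauδ α X Y) TauV.δ_injective h fun w =>
    TauV.exists_δ_eq (lin h w) fun e => LinearMap.congr_fun (congrArg lin (hh e)) w

theorem isUnit_tauε : EMod.IsCartesian (Algebra.ofId k (M.base k α)) (G.tauMod α triv)
    (EMod.ofObj triv) (G.tauε α) :=
  isCartesian_of_bijective _ (G.tauMod α triv) (EMod.ofObj triv) (G.tauε α)
    (fun c => hom_ext (LinearMap.ext fun t => TauV.ε_algebraMap_smul c t))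
    (fun t ht => TauV.eq_zero_of_ε t ht) (fun h _ => TauV.exists_ε h)

open MonoidalCategory in
/-- The structure of a tensor functor on `τ`. -/
noncomputable def tauTensor : TensorStructure G.tauP where
  δ α X Y := G.tauδ α X Y
  ε α := G.tauε α
  isTensor α X Y := G.isTensor_tauδ α X Y
  isUnit α := G.isUnit_tauε α
  δ_natural α {X X' Y Y'} f g := hom_ext (TauV.linearMap_ext fun θ x y => by
    change TauV.δ (TauV.tmul θ (lin f x ⊗ₜ[k] lin g y)) =
      TensorProduct.map ((TauV.map (lin f)).restrictScalars k) ((TauV.map (lin g)).restrictScalars k)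
        (TauV.δ (TauV.tmul θ (x ⊗ₜ[k] y)))
    rw [TauV.δ_tmul, TauV.δ_tmul, TensorProduct.map_map, TauV.map_comp_tmulDual,
      TauV.map_comp_tmulDual])
  δ_assoc α X Y Z := by
    refine hom_ext (TauV.linearMap_ext fun θ (s : X.V ⊗[k] Y.V) z => ?_)
    induction s with
    | zero =>
      rw [TensorProduct.zero_tmul, TauV.tmul_zero]
      exact (map_zero _).trans (map_zero _).symm
    | add s t hs ht =>
      rw [TensorProduct.add_tmul, TauV.tmul_add]
      exact (map_add _ _ _).trans ((congrArg₂ _ hs ht).trans (map_add _ _ _).symm)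
    | tmul x y =>
      change TensorProduct.assoc k _ _ _ (LinearMap.rTensor _ TauV.δ
        (TauV.δ (TauV.tmul θ ((x ⊗ₜ[k] y) ⊗ₜ[k] z)))) =
        LinearMap.lTensor _ TauV.δ (TauV.δ (TauV.tmul θ (x ⊗ₜ[k] (y ⊗ₜ[k] z))))
      have h₁ : TauV.δ ∘ₗ TauV.tmulDual μ α (x ⊗ₜ[k] y) = TensorProduct.map
        (TauV.tmulDual μ α x) (TauV.tmulDual μ α y) ∘ₗ dualComul k _ := rfl
      have h₂ : TauV.δ ∘ₗ TauV.tmulDual μ α (y ⊗ₜ[k] z) = TensorProduct.map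
        (TauV.tmulDual μ α y) (TauV.tmulDual μ α z) ∘ₗ dualComul k _ := rfl
      have h₃ : ∀ T, TensorProduct.assoc k _ _ _ (TensorProduct.map (TensorProduct.map
          (TauV.tmulDual μ α x) (TauV.tmulDual μ α y)) (TauV.tmulDual μ α z) T) =
          TensorProduct.map (TauV.tmulDual μ α x) (TensorProduct.map
            (TauV.tmulDual μ α y) (TauV.tmulDual μ α z)) (TensorProduct.assoc k _ _ _ T) :=
        fun T => LinearMap.congr_fun (TensorProduct.map_map_comp_assoc_eq _ _ _).symm T
      rw [TauV.δ_tmul, TauV.δ_tmul, ← LinearMap.comp_apply (LinearMap.rTensor _ _),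
        ← LinearMap.comp_apply (LinearMap.lTensor _ _), LinearMap.rTensor_comp_map,
        LinearMap.lTensor_comp_map, h₁, h₂, ← LinearMap.map_comp_rTensor,
        ← LinearMap.map_comp_lTensor, LinearMap.comp_apply, LinearMap.comp_apply, h₃,
        dualComul_coassoc]
  δ_left_unit α X := hom_ext (TauV.linearMap_ext fun θ c x => TauV.lid_rTensor_ε_δ θ c x)
  δ_right_unit α X := hom_ext (TauV.linearMap_ext fun θ x c => TauV.rid_lTensor_ε_δ θ c x)
  δ_braiding α X Y := hom_ext (TauV.linearMap_ext fun θ x y => by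
    change TensorProduct.comm k _ _ (TauV.δ (TauV.tmul θ (x ⊗ₜ[k] y))) =
      TauV.δ (TauV.tmul θ (y ⊗ₜ[k] x))
    rw [TauV.δ_tmul, TauV.δ_tmul, ← TensorProduct.map_comm, comm_dualComul])
  δ_tr {α β} f X Y := hom_ext (TauV.linearMap_ext fun θ x y => by
    change TauV.δ (TauV.tmul (TauV.coRes f θ) (x ⊗ₜ[k] y)) =
      TensorProduct.map (TauV.res f) (TauV.res f) (TauV.δ (TauV.tmul θ (x ⊗ₜ[k] y)))
    rw [TauV.δ_tmul, TauV.δ_tmul, TensorProduct.map_map, TauV.res_comp_tmulDual,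
      TauV.res_comp_tmulDual, ← TensorProduct.map_map, map_dualMap_dualComul]
    rfl)
  ε_tr {α β} f := hom_ext (LinearMap.ext fun t => TauV.ε_res f t)

end MGroup
end Tau

/-! ### The base point and the isomorphism $i^!\tau=\mathrm{Id}$. -/

section Tau
open scoped TensorProduct
variable {k₀ : Type u} [CommRing k₀] {k : Type u} [Field k] [Algebra k₀ k]
  {M : FormalMonoid k₀}

variable (k M) in
/-- The base point, as a functional. -/
def unitDual : Module.Dual k (M.base k M.unitIdx) := (M.baseUnit k).toLinearMap

/-- The base point is a character of `E`, so `E` acts on it by scalars; for the same reason it is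
group-like for `dualComul`. -/
theorem mulDual_unitDual (e : M.base k M.unitIdx) :
    mulDual k e (unitDual k M) = M.baseUnit k e • unitDual k M :=
  LinearMap.ext fun x => map_mul (M.baseUnit k) e x

theorem dualComul_unitDual :
    dualComul k _ (unitDual k M) = unitDual k M ⊗ₜ[k] unitDual k M :=
  dualDistrib_ext fun e e' => by
    rw [dualDistrib_dualComul, TensorProduct.dualDistrib_apply]
    exact map_mul (M.baseUnit k) e e'

theorem baseUnit_act (μ : MAction M k) (c : k) : M.baseUnit k (μ.act M.unitIdx c) = c :=
  DFunLike.congr_fun μ.act_unit c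

namespace TauV
variable {μ : MAction M k} {X : Type u} [AddCommGroup X] [Module k X]
  {Y : Type u} [AddCommGroup Y] [Module k Y]

variable (μ X) in
/-- The map `X → i^! τ(X)`. -/
def ofUnit : X →ₗ[k] TauV μ M.unitIdx X where
  toFun x := tmulDual μ M.unitIdx x (unitDual k M)
  map_add' x y := by rw [tmulDual_add, LinearMap.add_apply]
  map_smul' c x := by
    rw [tmulDual_smul, LinearMap.comp_apply, mulDual_unitDual, baseUnit_act, map_smul,
      RingHom.id_apply]

theorem ofUnit_apply (x : X) : ofUnit μ X x = tmulDual μ M.unitIdx x (unitDual k M) := rfl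

theorem base_smul_ofUnit (e : M.base k M.unitIdx) (x : X) :
    e • ofUnit μ X x = M.baseUnit k e • ofUnit μ X x := by
  rw [ofUnit_apply, base_smul_tmulDual, mulDual_unitDual, map_smul]

/-- Since `E` acts on `ofUnit x` through the base point, coefficients are simply specialized there.
As the base point acts trivially on `G`, `ofUnit` is equivariant. -/
theorem coeffAct_ofUnit {B : Type u} [CommRing B] [Algebra k B] [Algebra k₀ B]
    [IsScalarTower k₀ k B] (x : X) (p : B ⊗[k₀] M.E M.unitIdx) :
    coeffAct B (ofUnit μ X x) p = ofUnit μ X x ⊗ₜ[k] Algebra.TensorProduct.rid k₀ k₀ B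
      (Algebra.TensorProduct.map (AlgHom.id k₀ B) M.unit p) := by
  induction p with
  | zero => simp
  | add p q hp hq => simp only [map_add, TensorProduct.tmul_add, hp, hq]
  | tmul b d =>
    rw [coeffAct_tmul, base_smul_ofUnit, Algebra.TensorProduct.map_tmul,
      Algebra.TensorProduct.rid_tmul, TensorProduct.smul_tmul]
    simp

theorem contractDual_ofUnit (φ : X →ₗ[k] k) (x : X) :
    contractDual φ (ofUnit μ X x) 1 = φ x := by
  change M.baseUnit k (μ.act _ (φ x) * 1) = _
  rw [mul_one, baseUnit_act]

theorem δ_ofUnit (s : X ⊗[k] Y) :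
    δ (ofUnit μ _ s) = TensorProduct.map (ofUnit μ X) (ofUnit μ Y) s := by
  induction s with
  | zero => simp
  | add s t hs ht => simp only [map_add, hs, ht]
  | tmul x y =>
    rw [ofUnit_apply, δ_tmulDual, dualComul_unitDual]
    rfl

theorem ε_ofUnit (c : k) : ε (ofUnit μ k c) = c := by
  rw [ε_apply, contractDual_ofUnit, LinearMap.id_apply]

end TauV

namespace MGroup
open RepCat
variable {μ : MAction M k} (G : MGroup μ)

theorem twist_unitDual {X : Type u} [AddCommGroup X] [Module k X] (t : X ⊗[k] G.A) :
    G.twist M.unitIdx (CoE.mk (unitDual k M)) t = LinearMap.rTensor G.A (TauV.ofUnit μ X) t := by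
  induction t with
  | zero => simp
  | add s t hs ht => simp only [map_add, hs, ht]
  | tmul x a =>
    refine (TauV.coeffAct_ofUnit x (G.s.act M.unitIdx a)).trans ?_
    exact congrArg (fun a => TauV.ofUnit μ X x ⊗ₜ[k] a) (DFunLike.congr_fun G.s.act_unit a)

/-- The map `X → i^! τ(X)` of representations. -/
def tauUnit (X : RepCat k G.A) : X ⟶ G.tauObj M.unitIdx X :=
  ofLin (Y := G.tauObj M.unitIdx X) (TauV.ofUnit μ X.V) (LinearMap.ext fun x =>
    G.twist_unitDual (X.ρ x))

theorem isCartesian_tauUnit (X : RepCat k G.A) : EMod.IsCartesian (M.baseUnit k) (EMod.ofObj X)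
    (G.tauMod M.unitIdx X) (G.tauUnit X) := by
  let b := Module.finBasis k X.V
  have h : ∀ φ (w : k) (x : X.V), TauV.contractDual φ (TauV.ofUnit μ X.V (w • x)) 1 = w * φ x :=
    fun φ w x => by rw [TauV.contractDual_ofUnit, map_smul, smul_eq_mul]
  refine G.isCartesian_tau _ _ _ _ (fun e => hom_ext (LinearMap.ext fun x => ?_)) b
    -- Here `F = k`, so each functional is its value at 1, and these values are the coordinates of
    -- the vector sought.
    (fun y hy => ?_) fun Θ => ⟨∑ i, Θ i 1 • b i, fun i w => ?_⟩
  · exact ((TauV.ofUnit μ X.V).map_smul _ x).trans (TauV.base_smul_ofUnit e x).symm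
  · refine b.forall_coord_eq_zero_iff.1 fun i => ?_
    have h' := (h (b.coord i) 1 y).symm.trans (hy i 1)
    rwa [one_mul] at h'
  · refine (h (b.coord i) w _).trans ?_
    have h' : b.coord i (∑ i, Θ i 1 • b i) = Θ i 1 := by
      rw [Module.Basis.coord_apply, b.repr_sum_self]
    refine (congrArg (w * ·) h').trans ?_
    rw [← smul_eq_mul, ← map_smul, smul_eq_mul, mul_one]

end MGroup
end Tau

/-! ### The product of functionals on $k\otimes R$ and $k\otimes S$, twisted by $m:k\to k\otimes S$.
-/

section Conv
open scoped TensorProduct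
variable {k₀ : Type u} [CommRing k₀] {k : Type u} [Field k] [Algebra k₀ k]
  {R : Type u} [CommRing R] [Algebra k₀ R] {S : Type u} [CommRing S] [Algebra k₀ S]

variable (k₀ k R S) in
/-- The map `k ⊗ S → k ⊗ (R ⊗ S)`. -/
abbrev inS : k ⊗[k₀] S →ₐ[k] k ⊗[k₀] (R ⊗[k₀] S) :=
  Algebra.TensorProduct.map (AlgHom.id k k) Algebra.TensorProduct.includeRight

variable (m : k →ₐ[k₀] k ⊗[k₀] S)

variable (R) in
/-- The map `k ⊗ R → k ⊗ (R ⊗ S)` that is given on `k` by a map `m : k → k ⊗ S`. -/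
abbrev inR : k ⊗[k₀] R →ₐ[k₀] k ⊗[k₀] (R ⊗[k₀] S) :=
  Algebra.TensorProduct.productMap (((inS k₀ k R S).restrictScalars k₀).comp m)
    ((Algebra.TensorProduct.includeRight : R ⊗[k₀] S →ₐ[k₀] k ⊗[k₀] (R ⊗[k₀] S)).comp
      Algebra.TensorProduct.includeLeft)

theorem inR_tmul (c : k) (r : R) :
    inR R m (c ⊗ₜ r) = inS k₀ k R S (m c) * (1 ⊗ₜ (r ⊗ₜ 1)) :=
  Algebra.TensorProduct.productMap_apply_tmul _ _ _ _

/-- A scalar of `k ⊗ R` becomes `m c` in `k ⊗ S`: this relation presents `k ⊗ (R ⊗ S)` as the tensor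
product of `k ⊗ S` and `k ⊗ R` over `k`, with `k` acting on the first through `m`. -/
theorem inR_algebraMap (c : k) :
    inR R m (algebraMap k (k ⊗[k₀] R) c) = inS k₀ k R S (m c) := by
  rw [Algebra.TensorProduct.algebraMap_apply, inR_tmul, Algebra.algebraMap_self, RingHom.id_apply,
    ← Algebra.TensorProduct.one_def, ← Algebra.TensorProduct.one_def, mul_one]

theorem tmul_eq_inS_mul_inR (c : k) (r : R) (s : S) :
    c ⊗ₜ[k₀] (r ⊗ₜ[k₀] s) = inS k₀ k R S (c ⊗ₜ s) * inR R m (1 ⊗ₜ r) := by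
  rw [inR_tmul, map_one, map_one, one_mul, Algebra.TensorProduct.map_tmul,
    Algebra.TensorProduct.tmul_mul_tmul, Algebra.TensorProduct.includeRight_apply,
    Algebra.TensorProduct.tmul_mul_tmul, one_mul, mul_one, AlgHom.id_apply, mul_one]

/-- Products `inS s * inR e` span, and on them the twisted formulas are simple, unlike on the
tensors `c ⊗ (r ⊗ s)`. -/
theorem conv_induction {p : k ⊗[k₀] (R ⊗[k₀] S) → Prop} (w : k ⊗[k₀] (R ⊗[k₀] S)) (zero : p 0)
    (add : ∀ v w, p v → p w → p (v + w)) (mul : ∀ s e, p (inS k₀ k R S s * inR R m e)) : p w := by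
  induction w with
  | zero => exact zero
  | add v w hv hw => exact add v w hv hw
  | tmul c t =>
    induction t with
    | zero => rwa [TensorProduct.tmul_zero]
    | add v w hv hw => rw [TensorProduct.tmul_add]; exact add _ _ hv hw
    | tmul r s => rw [tmul_eq_inS_mul_inR m]; exact mul _ _

/-- Scalars of `k ⊗ R` can be absorbed into `k ⊗ S` by `inR_algebraMap`, so `e` need only run over a
basis. -/
theorem conv_induction_basis {κ : Type*} [Finite κ] (b : Module.Basis κ k (k ⊗[k₀] R))
    {p : k ⊗[k₀] (R ⊗[k₀] S) → Prop} (w : k ⊗[k₀] (R ⊗[k₀] S)) (zero : p 0)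
    (add : ∀ v w, p v → p w → p (v + w)) (mul : ∀ s j, p (inS k₀ k R S s * inR R m (b j))) : p w := by
  refine conv_induction m w zero add fun s e => ?_
  induction b.mem_span e using Submodule.span_induction generalizing s with
  | mem x h => obtain ⟨j, rfl⟩ := h; exact mul s j
  | zero => rwa [map_zero, mul_zero]
  | add x y _ _ hx hy => rw [map_add, mul_add]; exact add _ _ (hx s) (hy s)
  | smul c x _ hx =>
    rw [Algebra.smul_def, map_mul, inR_algebraMap, ← mul_assoc, ← map_mul]
    exact hx _

/-- For a functional `η` on `k ⊗ R`, the map `k ⊗ (R ⊗ S) → k ⊗ S` that is `k ⊗ S`-linear and is given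
by `m ∘ η` on the image of `k ⊗ R`. -/
noncomputable def convQ (η : Module.Dual k (k ⊗[k₀] R)) : k ⊗[k₀] (R ⊗[k₀] S) →ₗ[k] k ⊗[k₀] S :=
  LinearMap.liftBaseChange k (LinearMap.mul' k₀ (k ⊗[k₀] S) ∘ₗ TensorProduct.map
    (m.toLinearMap ∘ₗ η.restrictScalars k₀ ∘ₗ TensorProduct.mk k₀ k R 1)
    (TensorProduct.mk k₀ k S 1))

theorem convQ_tmul (η : Module.Dual k (k ⊗[k₀] R)) (c : k) (r : R) (s : S) :
    convQ m η (c ⊗ₜ (r ⊗ₜ s)) = (c ⊗ₜ s) * m (η (1 ⊗ₜ r)) := by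
  refine (LinearMap.liftBaseChange_tmul _ _ _ _).trans ?_
  change c • (m (η (1 ⊗ₜ r)) * (1 ⊗ₜ s)) = _
  rw [mul_comm, ← smul_mul_assoc, TensorProduct.smul_tmul', smul_eq_mul, mul_one]

theorem convQ_inS_mul (η : Module.Dual k (k ⊗[k₀] R)) (s : k ⊗[k₀] S)
    (w : k ⊗[k₀] (R ⊗[k₀] S)) : convQ m η (inS k₀ k R S s * w) = s * convQ m η w := by
  induction s with
  | zero => simp
  | add x y hx hy => simp only [map_add, add_mul, hx, hy]
  | tmul c s =>
    induction w with
    | zero => simp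
    | add x y hx hy => simp only [map_add, mul_add, hx, hy]
    | tmul c' t =>
      induction t with
      | zero => simp
      | add x y hx hy => simp only [TensorProduct.tmul_add, map_add, mul_add, hx, hy]
      | tmul r' s' =>
        rw [Algebra.TensorProduct.map_tmul, Algebra.TensorProduct.includeRight_apply,
          Algebra.TensorProduct.tmul_mul_tmul, Algebra.TensorProduct.tmul_mul_tmul, convQ_tmul,
          convQ_tmul, one_mul, ← mul_assoc, Algebra.TensorProduct.tmul_mul_tmul, AlgHom.id_apply]

theorem convQ_inR (η : Module.Dual k (k ⊗[k₀] R)) (e : k ⊗[k₀] R) :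
    convQ m η (inR R m e) = m (η e) := by
  induction e with
  | zero => simp
  | add x y hx hy => simp only [map_add, hx, hy]
  | tmul c r =>
    have h : c ⊗ₜ[k₀] r = c • ((1 : k) ⊗ₜ[k₀] r) := by
      rw [TensorProduct.smul_tmul', smul_eq_mul, mul_one]
    rw [inR_tmul, convQ_inS_mul, convQ_tmul, ← Algebra.TensorProduct.one_def, one_mul, h, map_smul,
      smul_eq_mul, map_mul]

theorem convQ_inS_mul_inR (η : Module.Dual k (k ⊗[k₀] R)) (s : k ⊗[k₀] S) (e : k ⊗[k₀] R) :
    convQ m η (inS k₀ k R S s * inR R m e) = s * m (η e) := by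
  rw [convQ_inS_mul, convQ_inR]

theorem convQ_mulDual (η : Module.Dual k (k ⊗[k₀] R)) (e : k ⊗[k₀] R)
    (w : k ⊗[k₀] (R ⊗[k₀] S)) : convQ m (mulDual k e η) w = convQ m η (inR R m e * w) := by
  induction w using conv_induction m with
  | zero => simp
  | add x y hx hy => simp only [map_add, mul_add, hx, hy]
  | mul s e' => rw [mul_left_comm, ← map_mul, convQ_inS_mul_inR, convQ_inS_mul_inR, mulDual_apply]

theorem convQ_add (η η' : Module.Dual k (k ⊗[k₀] R)) :
    convQ m (η + η') = convQ m η + convQ m η' := LinearMap.ext fun w => by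
  induction w using conv_induction m with
  | zero => simp
  | add x y hx hy => simp only [map_add, hx, hy]
  | mul s e => rw [LinearMap.add_apply, convQ_inS_mul_inR, convQ_inS_mul_inR, convQ_inS_mul_inR,
      LinearMap.add_apply, map_add, mul_add]

theorem convQ_smul (c : k) (η : Module.Dual k (k ⊗[k₀] R)) (w : k ⊗[k₀] (R ⊗[k₀] S)) :
    convQ m (c • η) w = m c * convQ m η w := by
  have h : c • η = mulDual k (algebraMap k (k ⊗[k₀] R) c) η := LinearMap.ext fun e => by
    rw [mulDual_apply, ← Algebra.smul_def, map_smul, LinearMap.smul_apply]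
  rw [h, convQ_mulDual, inR_algebraMap, convQ_inS_mul]

/-- The functional on `k ⊗ (R ⊗ S)` that is the product of functionals on `k ⊗ S` and `k ⊗ R`. -/
noncomputable def conv (η : Module.Dual k (k ⊗[k₀] R)) :
    Module.Dual k (k ⊗[k₀] S) →ₗ[k] Module.Dual k (k ⊗[k₀] (R ⊗[k₀] S)) :=
  (convQ m η).dualMap

theorem conv_apply (θ : Module.Dual k (k ⊗[k₀] S)) (η : Module.Dual k (k ⊗[k₀] R))
    (w : k ⊗[k₀] (R ⊗[k₀] S)) : conv m η θ w = θ (convQ m η w) := rfl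

theorem conv_add (η η' : Module.Dual k (k ⊗[k₀] R)) :
    conv m (η + η') = conv m η + conv m η' := by
  rw [conv, convQ_add]
  exact LinearMap.ext fun θ => LinearMap.ext fun w => map_add θ _ _

/-- This is the balancing that lets `conv` descend to the outer tensor product in `τ_α τ_β(X)`,
which is formed along `μ_α`. -/
theorem conv_smul (c : k) (η : Module.Dual k (k ⊗[k₀] R)) (θ : Module.Dual k (k ⊗[k₀] S)) :
    conv m (c • η) θ = conv m η (mulDual k (m c) θ) := LinearMap.ext fun w => by
  rw [conv_apply, convQ_smul, conv_apply, mulDual_apply]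

theorem conv_mulDual_right (e : k ⊗[k₀] R) (η : Module.Dual k (k ⊗[k₀] R))
    (θ : Module.Dual k (k ⊗[k₀] S)) :
    conv m (mulDual k e η) θ = mulDual k (inR R m e) (conv m η θ) := LinearMap.ext fun w => by
  rw [conv_apply, convQ_mulDual, mulDual_apply, conv_apply]

theorem conv_mulDual_left (s : k ⊗[k₀] S) (η : Module.Dual k (k ⊗[k₀] R))
    (θ : Module.Dual k (k ⊗[k₀] S)) :
    conv m η (mulDual k s θ) = mulDual k (inS k₀ k R S s) (conv m η θ) := LinearMap.ext fun w => by
  rw [mulDual_apply, conv_apply, conv_apply, convQ_inS_mul, mulDual_apply]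

/-- On products of generators it reduces to the hypothesis on `η`, to which `m` is applied. It is
the dual form of `dualComul_conv`, the compatibility of `conv` with comultiplication. -/
theorem sum_convQ_mul {J : Finset (Module.Dual k (k ⊗[k₀] R) × Module.Dual k (k ⊗[k₀] R))}
    {η : Module.Dual k (k ⊗[k₀] R)} (h : ∀ e e', ∑ j ∈ J, j.1 e * j.2 e' = η (e * e'))
    (v w : k ⊗[k₀] (R ⊗[k₀] S)) :
    ∑ j ∈ J, convQ m j.1 v * convQ m j.2 w = convQ m η (v * w) := by
  induction v using conv_induction m with
  | zero => simp
  | add x y hx hy => simp only [map_add, add_mul, Finset.sum_add_distrib, hx, hy]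
  | mul s e =>
    induction w using conv_induction m with
    | zero => simp
    | add x y hx hy => simp only [map_add, mul_add, Finset.sum_add_distrib, hx, hy]
    | mul s' e' =>
      rw [mul_mul_mul_comm, ← map_mul, ← map_mul, convQ_inS_mul_inR, ← h, map_sum, Finset.mul_sum]
      refine Finset.sum_congr rfl fun j _ => ?_
      rw [convQ_inS_mul_inR, convQ_inS_mul_inR, mul_mul_mul_comm, map_mul]

theorem dualComul_conv [Module.Finite k₀ R] [Module.Finite k₀ S]
    {J : Finset (Module.Dual k (k ⊗[k₀] R) × Module.Dual k (k ⊗[k₀] R))}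
    {η : Module.Dual k (k ⊗[k₀] R)} (h : dualComul k _ η = ∑ j ∈ J, j.1 ⊗ₜ j.2)
    (θ : Module.Dual k (k ⊗[k₀] S)) :
    dualComul k _ (conv m η θ) =
      ∑ j ∈ J, TensorProduct.map (conv m j.1) (conv m j.2) (dualComul k _ θ) := by
  refine dualDistrib_ext fun v w => ?_
  rw [dualDistrib_dualComul, conv_apply, ← sum_convQ_mul m (J := J) (fun e e' => ?_), map_sum,
    map_sum, LinearMap.sum_apply]
  · refine Finset.sum_congr rfl fun j _ => ?_
    rw [← dualDistrib_dualComul]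
    exact (dualDistrib_map (convQ m j.1) (convQ m j.2) (dualComul k _ θ) v w).symm
  · rw [← dualDistrib_dualComul, h, map_sum, LinearMap.sum_apply]
    rfl

theorem conv_dualMap {R' : Type u} [CommRing R'] [Algebra k₀ R'] {S' : Type u} [CommRing S']
    [Algebra k₀ S'] (m' : k →ₐ[k₀] k ⊗[k₀] S') (f : S →ₐ[k₀] S') (g : R →ₐ[k₀] R')
    (hm : ∀ c, Algebra.TensorProduct.map (AlgHom.id k k) f (m c) = m' c)
    (θ : Module.Dual k (k ⊗[k₀] S')) (η : Module.Dual k (k ⊗[k₀] R'))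
    (w : k ⊗[k₀] (R ⊗[k₀] S)) :
    conv m ((Algebra.TensorProduct.map (AlgHom.id k k) g).toLinearMap.dualMap η)
      ((Algebra.TensorProduct.map (AlgHom.id k k) f).toLinearMap.dualMap θ) w =
    conv m' η θ (Algebra.TensorProduct.map (AlgHom.id k k) (Algebra.TensorProduct.map g f) w) := by
  have h₁ : ∀ s, Algebra.TensorProduct.map (AlgHom.id k k) (Algebra.TensorProduct.map g f)
      (inS k₀ k R S s) = inS k₀ k R' S' (Algebra.TensorProduct.map (AlgHom.id k k) f s) := fun s => by
    induction s with
    | zero => simp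
    | add x y hx hy => simp only [map_add, hx, hy]
    | tmul c s => simp
  have h₂ : ∀ e, Algebra.TensorProduct.map (AlgHom.id k k) (Algebra.TensorProduct.map g f)
      (inR R m e) = inR R' m' (Algebra.TensorProduct.map (AlgHom.id k k) g e) := fun e => by
    induction e with
    | zero => simp
    | add x y hx hy => simp only [map_add, hx, hy]
    | tmul c r =>
      rw [inR_tmul, map_mul, h₁, hm, Algebra.TensorProduct.map_tmul, Algebra.TensorProduct.map_tmul,
        map_one, map_one, Algebra.TensorProduct.map_tmul, inR_tmul, AlgHom.id_apply]
  induction w using conv_induction m with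
  | zero => simp
  | add x y hx hy => simp only [map_add, hx, hy]
  | mul s e =>
    rw [map_mul (Algebra.TensorProduct.map _ _), h₁, h₂, conv_apply, conv_apply,
      convQ_inS_mul_inR, convQ_inS_mul_inR, LinearMap.dualMap_apply, LinearMap.dualMap_apply,
      AlgHom.toLinearMap_apply, AlgHom.toLinearMap_apply, map_mul (Algebra.TensorProduct.map _ _),
      hm]

variable (k₀ R S) in
/-- The reordering `(B ⊗ S) ⊗ R = B ⊗ (R ⊗ S)`. -/
abbrev swapAssoc (B : Type u) [CommRing B] [Algebra k₀ B] :
    (B ⊗[k₀] S) ⊗[k₀] R →ₐ[k₀] B ⊗[k₀] (R ⊗[k₀] S) :=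
  (Algebra.TensorProduct.map (AlgHom.id k₀ B) (Algebra.TensorProduct.comm k₀ S R).toAlgHom).comp
    (Algebra.TensorProduct.assoc k₀ k₀ k₀ B S R).toAlgHom

theorem swapAssoc_tmul {B : Type u} [CommRing B] [Algebra k₀ B] (b : B) (s : S) (r : R) :
    swapAssoc k₀ R S B ((b ⊗ₜ s) ⊗ₜ r) = b ⊗ₜ (r ⊗ₜ s) := rfl

/-- This recognizes `inR` in the right side of the axiom `act_mul` of an action. -/
theorem swapAssoc_map (t : k ⊗[k₀] R) :
    swapAssoc k₀ R S k (Algebra.TensorProduct.map m (AlgHom.id k₀ R) t) = inR R m t := by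
  induction t with
  | zero => simp
  | add x y hx hy => simp only [map_add, hx, hy]
  | tmul c r =>
    rw [Algebra.TensorProduct.map_tmul, inR_tmul]
    generalize m c = q
    induction q with
    | zero => simp
    | add x y hx hy => simp only [map_add, TensorProduct.add_tmul, add_mul, hx, hy]
    | tmul b s =>
      rw [AlgHom.id_apply, swapAssoc_tmul]
      simp

end Conv

/-! ### The map $\tau_\alpha\tau_\beta(X)\to\tau_\gamma(X)$ and its coordinates. -/

section Tau
open scoped TensorProduct
variable {k₀ : Type u} [CommRing k₀] {k : Type u} [Field k] [Algebra k₀ k]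
  {M : FormalMonoid k₀}

/-- The law `(m₁ m₂) z = m₁ (m₂ z)` for the action on `spec k`. It is the reason for the twist in
`inR`: with it, `conv` is compatible with the scalars of `X`. -/
theorem baseMul_act (μ : MAction M k) (α β : M.I) (c : k) :
    M.baseMul k β α (μ.act (M.mulIdx β α) c) = inR (M.E β) (μ.act α) (μ.act β c) :=
  (DFunLike.congr_fun (μ.act_mul β α) c).trans (swapAssoc_map (μ.act α) (μ.act β c))

theorem dualMap_baseMul_mulDual (α β : M.I) (e : M.base k (M.mulIdx β α))
    (ψ : Module.Dual k (k ⊗[k₀] (M.E β ⊗[k₀] M.E α))) :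
    (M.baseMul k β α).toLinearMap.dualMap (mulDual k (M.baseMul k β α e) ψ) =
      mulDual k e ((M.baseMul k β α).toLinearMap.dualMap ψ) :=
  LinearMap.ext fun x => congrArg ψ (map_mul (M.baseMul k β α) e x).symm

namespace TauV
variable {μ : MAction M k} {α β : M.I} {X : Type u} [AddCommGroup X] [Module k X]
  {Y : Type u} [AddCommGroup Y] [Module k Y]

variable (μ α β) in
/-- The map from functionals on `E_β ⊗ E_α` to `E_γ^∨ ⊗_μ X`, for `m : E_γ → E_β ⊗ E_α`. -/
noncomputable def tmulMul (x : X) : Module.Dual k (k ⊗[k₀] (M.E β ⊗[k₀] M.E α)) →ₗ[k]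
    TauV μ (M.mulIdx β α) X :=
  tmulDual μ (M.mulIdx β α) x ∘ₗ (M.baseMul k β α).toLinearMap.dualMap

theorem tmulMul_add (x x' : X) : tmulMul μ α β (x + x') = tmulMul μ α β x + tmulMul μ α β x' := by
  rw [tmulMul, tmulDual_add, LinearMap.add_comp]
  rfl

theorem base_smul_tmulMul (e : M.base k (M.mulIdx β α)) (x : X)
    (ψ : Module.Dual k (k ⊗[k₀] (M.E β ⊗[k₀] M.E α))) :
    e • tmulMul μ α β x ψ = tmulMul μ α β x (mulDual k (M.baseMul k β α e) ψ) := by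
  rw [tmulMul, LinearMap.comp_apply, LinearMap.comp_apply, base_smul_tmulDual,
    dualMap_baseMul_mulDual]

theorem tmulMul_smul (c : k) (x : X) (ψ : Module.Dual k (k ⊗[k₀] (M.E β ⊗[k₀] M.E α))) :
    tmulMul μ α β (c • x) ψ =
      tmulMul μ α β x (mulDual k (inR (M.E β) (μ.act α) (μ.act β c)) ψ) := by
  rw [← baseMul_act, ← base_smul_tmulMul]
  exact LinearMap.congr_fun (tmulDual_smul c x) _

theorem contractDual_tmulMul (φ : X →ₗ[k] k) (x : X)
    (ψ : Module.Dual k (k ⊗[k₀] (M.E β ⊗[k₀] M.E α))) :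
    contractDual φ (tmulMul μ α β x ψ) 1 = ψ (inR (M.E β) (μ.act α) (μ.act β (φ x))) := by
  rw [← baseMul_act]
  change ψ (M.baseMul k β α (μ.act _ (φ x) * 1)) = _
  rw [mul_one]

/-- The map `η ⊗ x ↦ (θ * η) ⊗ x`. -/
noncomputable def mulAux (θ : Module.Dual k (M.base k α)) :
    TauV μ β X →+ TauV μ (M.mulIdx β α) X :=
  lift (fun η x => tmulMul μ α β x (conv (μ.act α) (CoE.toDual η) θ))
    (fun η η' x => by
      refine Eq.trans ?_ (map_add (tmulMul μ α β x) _ _)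
      exact congrArg _ (LinearMap.congr_fun
        (conv_add (μ.act α) (CoE.toDual η) (CoE.toDual η')) θ))
    (fun η x y => by rw [tmulMul_add, LinearMap.add_apply])
    (fun c η x => by
      rw [tmulMul_smul, ← conv_mulDual_right]
      rfl)

theorem mulAux_tmul (θ : Module.Dual k (M.base k α)) (η : CoE μ β) (x : X) :
    mulAux θ (tmul η x) = tmulMul μ α β x (conv (μ.act α) (CoE.toDual η) θ) := rfl

/-- The map `τ_α τ_β(X) → τ_γ(X)`. -/
noncomputable def mul : TauV μ α (TauV μ β X) →ₗ[k] TauV μ (M.mulIdx β α) X where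
  toFun := lift (fun θ t => mulAux (CoE.toDual θ) t)
    (fun θ θ' t => by
      induction t using induction with
      | zero => simp
      | add s t hs ht => simp only [map_add, hs, ht]; abel
      | tm η x =>
        rw [mulAux_tmul, mulAux_tmul, mulAux_tmul, ← map_add, ← map_add]
        rfl)
    (fun θ s t => map_add _ s t)
    (fun c θ t => by
      induction t using induction with
      | zero => simp
      | add s t hs ht => simp only [map_add, smul_add, hs, ht]
      | tm η x =>
        -- The inner scalar acts on `τ_β(X)` through the projection, that is, by multiplying `η`;
        -- `conv_smul` turns this into `μ_α(c)` on `θ`.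
        have h : c • tmul η x = tmulDual μ β x (c • CoE.toDual η) :=
          ((tmulDual μ β x).map_smul c (CoE.toDual η)).symm
        rw [h]
        refine congrArg (tmulMul μ α β x) ?_
        exact (conv_smul (μ.act α) c (CoE.toDual η) (CoE.toDual θ)).symm)
  map_add' := map_add _
  map_smul' c t := by
    rw [RingHom.id_apply]
    induction t using induction with
    | zero => simp
    | add s t hs ht => simp only [smul_add, map_add, hs, ht]
    | tm θ t =>
      have h : ∀ t : TauV μ β X, c • tmul θ t = tmulDual μ α t (c • CoE.toDual θ) := fun t =>
        ((tmulDual μ α t).map_smul c (CoE.toDual θ)).symm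
      rw [h]
      change mulAux (c • CoE.toDual θ) t = c • mulAux (CoE.toDual θ) t
      induction t using induction with
      | zero => simp
      | add s t hs ht => simp only [smul_add, map_add, hs, ht]
      | tm η x => rw [mulAux_tmul, mulAux_tmul, map_smul, map_smul]

theorem mul_tmul (θ : CoE μ α) (η : CoE μ β) (x : X) :
    mul (tmul θ (tmul η x)) = tmulMul μ α β x (conv (μ.act α) (CoE.toDual η) (CoE.toDual θ)) := rfl

theorem mul_comp_tmulDual (η : Module.Dual k (M.base k β)) (x : X) :
    mul ∘ₗ tmulDual μ α (tmulDual μ β x η) = tmulMul μ α β x ∘ₗ conv (μ.act α) η := rfl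

theorem linearMap_ext₂ {Z : Type*} [AddCommMonoid Z] [Module k Z]
    {f g : TauV μ α (TauV μ β X) →ₗ[k] Z}
    (h : ∀ θ η x, f (tmul θ (tmul η x)) = g (tmul θ (tmul η x))) : f = g := by
  refine LinearMap.ext fun t => ?_
  induction t using induction with
  | zero => simp
  | add s t hs ht => simp only [map_add, hs, ht]
  | tm θ s =>
    induction s using induction with
    | zero => rw [tmul_zero, map_zero, map_zero]
    | add s t hs ht => simp only [tmul_add, map_add, hs, ht]
    | tm x y => exact h θ x y

variable (μ α β X) in
/-- The action of the element `s * μ(e)` of `E_β ⊗ E_α` on `τ_α τ_β(X)`. -/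
def act₂ (s : M.base k α) (e : M.base k β) : TauV μ α (TauV μ β X) →ₗ[k] TauV μ α (TauV μ β X) :=
  (Algebra.lsmul k k (TauV μ α (TauV μ β X)) s : _ →ₗ[k] _) ∘ₗ
    (TauV.map (Algebra.lsmul k k (TauV μ β X) e)).restrictScalars k

theorem act₂_tmul (s : M.base k α) (e : M.base k β) (θ : CoE μ α) (η : CoE μ β) (x : X) :
    act₂ μ α β X s e (tmul θ (tmul η x)) = tmul (s • θ) (tmul (e • η) x) := rfl

theorem mul_act₂_tmul (s : M.base k α) (e : M.base k β) (θ : CoE μ α) (η : CoE μ β) (x : X) :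
    mul (act₂ μ α β X s e (tmul θ (tmul η x))) =
      tmulMul μ α β x (mulDual k (inS k₀ k _ _ s * inR (M.E β) (μ.act α) e)
        (conv (μ.act α) (CoE.toDual η) (CoE.toDual θ))) := by
  rw [← mulDual_mul, ← conv_mulDual_right, ← conv_mulDual_left]
  rfl

/-- The functional `s ↦ ⟨φ(s), e⟩` on `τ_β(X)`. -/
def evalDual (φ : X →ₗ[k] k) (e : M.base k β) : TauV μ β X →ₗ[k] k :=
  Module.Dual.eval k _ e ∘ₗ contractDual φ

theorem evalDual_tmul (φ : X →ₗ[k] k) (e : M.base k β) (η : CoE μ β) (x : X) :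
    evalDual φ e (tmul η x) = CoE.toDual η (μ.act β (φ x) * e) := rfl

/-- For `t = θ ⊗ (η ⊗ x)` both sides are `θ (μ_α (η (μ_β (φ x) e)) s)`. Hence the functional on `E_β
⊗ E_α` attached to `t` consists of the coordinates of `t` along the functionals `evalDual φ e` of
`τ_β(X)`. -/
theorem contractDual_mul_act₂ (φ : X →ₗ[k] k) (s : M.base k α) (e : M.base k β)
    (t : TauV μ α (TauV μ β X)) :
    contractDual φ (mul (act₂ μ α β X s e t)) 1 = contractDual (evalDual φ e) t s := by
  refine LinearMap.congr_fun (linearMap_ext₂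
    (f := Module.Dual.eval k _ 1 ∘ₗ contractDual φ ∘ₗ mul ∘ₗ act₂ μ α β X s e)
    (g := Module.Dual.eval k _ s ∘ₗ contractDual (evalDual φ e)) fun θ η x => ?_) t
  change contractDual φ (mul (act₂ μ α β X s e (tmul θ (tmul η x)))) 1 = CoE.toDual θ
    (μ.act α (evalDual φ e (tmul η x)) * s)
  rw [mul_act₂_tmul, contractDual_tmulMul, mulDual_apply, mul_assoc, ← map_mul, conv_apply,
    convQ_inS_mul_inR, evalDual_tmul, mul_comm s, mul_comm e]

section Basis
variable {ι κ : Type*} [Fintype ι] [Fintype κ] (b : Module.Basis ι k X)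
  (c : Module.Basis κ k (M.base k β))

/-- With `evalDual_tmulDual`, this gives dual bases of `τ_β(X)` as a vector space through the
projection, which are the coordinates needed for the outer functor. -/
theorem sum_evalDual_smul (s : TauV μ β X) : ∑ p : ι × κ, evalDual (b.coord p.1) (c p.2) s •
    tmulDual μ β (b p.1) (c.coord p.2) = s := by
  rw [Fintype.sum_prod_type]
  conv_rhs => rw [← sum_tmul_contract b b.coord b.sum_repr s]
  refine Finset.sum_congr rfl fun i _ => ?_
  simp only [← map_smul, ← map_sum]
  refine congrArg (tmulDual μ β (b i)) (c.ext fun j => ?_)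
  classical
  rw [LinearMap.sum_apply, Finset.sum_eq_single j]
  · rw [LinearMap.smul_apply, Module.Basis.coord_apply, c.repr_self, Finsupp.single_eq_same,
      smul_eq_mul, mul_one]
    rfl
  · intro l _ h
    simp [Ne.symm h]
  · simp

omit [Fintype ι] [Fintype κ] in
theorem evalDual_tmulDual [DecidableEq ι] [DecidableEq κ] (p q : ι × κ) :
    evalDual (b.coord p.1) (c p.2) (tmulDual μ β (b q.1) (c.coord q.2)) = if p = q then 1 else 0 := by
  change c.coord q.2 (μ.act β (b.coord p.1 (b q.1)) * c p.2) = _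
  rw [Module.Basis.coord_apply b, Module.Basis.repr_self, Finsupp.single_apply]
  by_cases h : q.1 = p.1
  · rw [if_pos h, map_one, one_mul, Module.Basis.coord_apply, Module.Basis.repr_self,
      Finsupp.single_apply]
    simp [Prod.ext_iff, h]
  · rw [if_neg h, map_zero, zero_mul, map_zero, if_neg fun h' => h (congrArg Prod.fst h'.symm)]

theorem eq_zero_of_evalDual (t : TauV μ α (TauV μ β X))
    (h : ∀ i e s, contractDual (evalDual (b.coord i) e) t s = 0) : t = 0 := by
  rw [← sum_tmul_contract _ _ (sum_evalDual_smul b (Module.finBasis k (M.base k β))) t]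
  refine Finset.sum_eq_zero fun p _ => ?_
  have h' : contract (evalDual (b.coord p.1) (Module.finBasis k (M.base k β) p.2)) t = 0 :=
    LinearMap.ext fun s => h p.1 _ s
  rw [h', zero_tmul]

theorem exists_evalDual (Θ : ι → κ → Module.Dual k (M.base k α)) :
    ∃ t : TauV μ α (TauV μ β X), ∀ i j s, contractDual (evalDual (b.coord i) (c j)) t s = Θ i j s := by
  classical
  refine ⟨∑ p : ι × κ, tmul (CoE.mk (Θ p.1 p.2)) (tmulDual μ β (b p.1) (c.coord p.2)),
    fun i j s => ?_⟩
  have h := contract_sum (μ := μ) (α := α) (fun p : ι × κ => tmulDual μ β (b p.1) (c.coord p.2))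
    (fun p => evalDual (b.coord p.1) (c p.2)) (evalDual_tmulDual b c)
    (fun p => CoE.mk (Θ p.1 p.2)) (i, j)
  exact congrArg (fun θ => CoE.toDual θ s) h

end Basis

theorem ε_mul_tmul (θ : CoE μ α) (η : CoE μ β) (c : k) :
    ε (mul (tmul θ (tmul η c))) = ε (tmul θ (ε (tmul η c))) := by
  rw [mul_tmul, ε_apply, contractDual_tmulMul, conv_apply, convQ_inR, ε_tmul, ε_tmul]
  rfl

theorem δ_mul_tmul (θ : CoE μ α) (η : CoE μ β) (x : X) (y : Y) :
    δ (mul (tmul θ (tmul η (x ⊗ₜ[k] y)))) =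
      TensorProduct.map mul mul (δ (tmul θ (δ (tmul η (x ⊗ₜ[k] y))))) := by
  have := M.finite α
  have := M.finite β
  -- Writing `dualComul η` as a finite sum of pure tensors expresses both sides by `dualComul_conv`,
  -- term by term.
  obtain ⟨J, hJ⟩ := TensorProduct.exists_finset (dualComul k _ (CoE.toDual η))
  rw [mul_tmul, δ_tmul, hJ, map_sum]
  have h : tmul θ (∑ j ∈ J, TensorProduct.map (tmulDual μ β x) (tmulDual μ β y) (j.1 ⊗ₜ[k] j.2)) =
    ∑ j ∈ J, tmul θ (TensorProduct.map (tmulDual μ β x) (tmulDual μ β y) (j.1 ⊗ₜ[k] j.2)) :=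
    TensorProduct.tmul_sum θ _ _
  rw [h, map_sum, map_sum, tmulMul, LinearMap.comp_apply, δ_tmulDual, ← map_dualMap_dualComul,
    dualComul_conv (μ.act α) hJ, map_sum, map_sum]
  refine Finset.sum_congr rfl fun j _ => ?_
  rw [TensorProduct.map_tmul, δ_tmul, TensorProduct.map_map, TensorProduct.map_map,
    TensorProduct.map_map, mul_comp_tmulDual, mul_comp_tmulDual]
  rfl

theorem δ_mul (t : TauV μ α (TauV μ β (X ⊗[k] Y))) :
    δ (mul t) = TensorProduct.map mul mul (δ (TauV.map δ t)) := by
  refine LinearMap.congr_fun (linearMap_ext₂ (f := δ ∘ₗ mul)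
    (g := TensorProduct.map mul mul ∘ₗ δ ∘ₗ (TauV.map δ).restrictScalars k) fun θ η s => ?_) t
  induction s with
  | zero => rw [tmul_zero, tmul_zero, map_zero, map_zero]
  | add s t hs ht => rw [tmul_add, tmul_add, map_add, map_add, hs, ht]
  | tmul x y => exact δ_mul_tmul θ η x y

theorem res_mul_res {α' β' γ : M.I} (f : α ⟶ α') (g : β ⟶ β') (u : γ ⟶ M.mulIdx β α)
    (v : γ ⟶ M.mulIdx β' α')
    (h : ((Algebra.TensorProduct.map (M.res g) (M.res f)).comp (M.mul β α)).comp (M.res u) =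
      (M.mul β' α').comp (M.res v)) (t : TauV μ α' (TauV μ β' X)) :
    res u (mul (res f (TauV.map (res g) t))) = res v (mul t) := by
  refine LinearMap.congr_fun (linearMap_ext₂
    (f := res u ∘ₗ mul ∘ₗ res f ∘ₗ (TauV.map (res g)).restrictScalars k)
    (g := res v ∘ₗ mul) fun θ η x => ?_) t
  -- Only functionals on `E_γ` remain to be compared. By naturality of `conv`, both are `conv η θ`
  -- after one of the two algebra maps that `h` equates.
  refine congrArg (tmulDual μ γ x) (LinearMap.ext fun (w : k ⊗[k₀] M.E γ) => ?_)
  refine (conv_dualMap (μ.act α) (μ.act α') (M.res f) (M.res g) (baseRes_act μ f) (CoE.toDual θ)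
    (CoE.toDual η) (M.baseMul k β α (M.baseRes k u w))).trans ?_
  change _ = conv (μ.act α') (CoE.toDual η) (CoE.toDual θ) (M.baseMul k β' α' (M.baseRes k v w))
  congr 1
  induction w with
  | zero => simp
  | add x y hx hy => simp only [map_add, hx, hy]
  | tmul c d => exact congrArg (c ⊗ₜ[k₀] ·) (DFunLike.congr_fun h d)

end TauV
end Tau

/-! ### Equivariance, $E\otimes_kE$-linearity and universality of the product map. -/

section Tau
open scoped TensorProduct
variable {k₀ : Type u} [CommRing k₀] {k : Type u} [Field k] [Algebra k₀ k]
  {M : FormalMonoid k₀}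

namespace TauV
variable {μ : MAction M k} {α β : M.I} {X : Type u} [AddCommGroup X] [Module k X]
  {B : Type u} [CommRing B] [Algebra k B] [Algebra k₀ B] [IsScalarTower k₀ k B]

variable (μ α β B) in
/-- For a functional `ψ` on `E_β ⊗ E_α`, the map `b ⊗ d ↦ (d ψ ⊗ x) ⊗ b`. -/
noncomputable def coeffMul (x : X) (ψ : Module.Dual k (k ⊗[k₀] (M.E β ⊗[k₀] M.E α))) :
    B ⊗[k₀] (M.E β ⊗[k₀] M.E α) →+ TauV μ (M.mulIdx β α) X ⊗[k] B :=
  TensorProduct.liftAddHom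
    (AddMonoidHom.mk' (fun b => AddMonoidHom.mk' (fun v =>
        tmulMul μ α β x (mulDual k ((1 : k) ⊗ₜ v) ψ) ⊗ₜ[k] b)
      (fun v v' => by
        rw [TensorProduct.tmul_add, ← TensorProduct.add_tmul, ← map_add]
        congr 2
        exact LinearMap.ext fun w => (congrArg ψ (add_mul _ _ w)).trans (map_add ψ _ _)))
      (fun b b' => AddMonoidHom.ext fun v => TensorProduct.tmul_add _ _ _))
    (fun r b v => by
      have h : mulDual k ((1 : k) ⊗ₜ[k₀] (r • v)) ψ =
          algebraMap k₀ k r • mulDual k ((1 : k) ⊗ₜ[k₀] v) ψ := LinearMap.ext fun w => by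
        rw [LinearMap.smul_apply, mulDual_apply, mulDual_apply, TensorProduct.tmul_smul,
          ← algebraMap_smul k r, smul_mul_assoc, map_smul]
      change tmulMul μ α β x (mulDual k ((1 : k) ⊗ₜ v) ψ) ⊗ₜ[k] (r • b) =
        tmulMul μ α β x (mulDual k ((1 : k) ⊗ₜ (r • v)) ψ) ⊗ₜ[k] b
      rw [h, map_smul, TensorProduct.smul_tmul, algebraMap_smul])

theorem coeffMul_tmul (x : X) (ψ : Module.Dual k (k ⊗[k₀] (M.E β ⊗[k₀] M.E α))) (b : B)
    (v : M.E β ⊗[k₀] M.E α) : coeffMul μ α β B x ψ (b ⊗ₜ v) =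
      tmulMul μ α β x (mulDual k ((1 : k) ⊗ₜ v) ψ) ⊗ₜ[k] b := rfl

theorem coeffAct_tmulMul (x : X) (ψ : Module.Dual k (k ⊗[k₀] (M.E β ⊗[k₀] M.E α)))
    (p : B ⊗[k₀] M.E (M.mulIdx β α)) : coeffAct B (tmulMul μ α β x ψ) p =
      coeffMul μ α β B x ψ (Algebra.TensorProduct.map (AlgHom.id k₀ B) (M.mul β α) p) := by
  induction p with
  | zero => simp
  | add p q hp hq => simp only [map_add, hp, hq]
  | tmul b d =>
    rw [coeffAct_tmul, base_smul_tmulMul]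
    rfl

/-- Acting by `d` on `η` and by `d'` on `θ` multiplies `conv` by `1 ⊗ (d ⊗ d')`; the coefficient in
`B` is only carried along. -/
theorem rTensor_mul_coeffAct (θ : CoE μ α) (η : CoE μ β) (x : X) (d : M.E β)
    (q : B ⊗[k₀] M.E α) :
    LinearMap.rTensor B mul
      (coeffAct B (tmul θ (tmul (((1 : k) ⊗ₜ[k₀] d : M.base k β) • η) x)) q) =
    coeffMul μ α β B x (conv (μ.act α) (CoE.toDual η) (CoE.toDual θ))
      (swapAssoc k₀ (M.E β) (M.E α) B (q ⊗ₜ d)) := by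
  induction q with
  | zero => simp
  | add p q hp hq => simp only [map_add, TensorProduct.add_tmul, hp, hq]
  | tmul b d' =>
    rw [coeffAct_tmul, LinearMap.rTensor_tmul, base_smul_tmul, ← act₂_tmul, mul_act₂_tmul,
      swapAssoc_tmul, coeffMul_tmul, ← tmul_eq_inS_mul_inR]

variable (s s' : M.base k α) (e e' : M.base k β) (t : TauV μ α (TauV μ β X))

theorem act₂_add_left :
    act₂ μ α β X (s + s') e t = act₂ μ α β X s e t + act₂ μ α β X s' e t :=
  add_smul s s' (TauV.map (Algebra.lsmul k k (TauV μ β X) e) t)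

theorem act₂_zero_left : act₂ μ α β X 0 e t = 0 :=
  zero_smul (M.base k α) (TauV.map (Algebra.lsmul k k (TauV μ β X) e) t)

theorem act₂_add_right :
    act₂ μ α β X s (e + e') t = act₂ μ α β X s e t + act₂ μ α β X s e' t := by
  refine LinearMap.congr_fun (linearMap_ext₂ (f := act₂ μ α β X s (e + e'))
    (g := act₂ μ α β X s e + act₂ μ α β X s e') fun θ η x => ?_) t
  rw [LinearMap.add_apply, act₂_tmul, act₂_tmul, act₂_tmul, add_smul, add_tmul, tmul_add]

theorem act₂_zero_right : act₂ μ α β X s 0 t = 0 := by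
  refine LinearMap.congr_fun (linearMap_ext₂ (f := act₂ μ α β X s 0) (g := 0) fun θ η x => ?_) t
  rw [act₂_tmul, zero_smul, zero_tmul, tmul_zero, LinearMap.zero_apply]

/-- The functor `τ_α` takes the scalar `c` on `τ_β(X)` to `μ_α(c)`; this matches the relation
`inR_algebraMap`. -/
theorem act₂_tmul_right (c : k) (r : M.E β) :
    act₂ μ α β X s (c ⊗ₜ r) t = act₂ μ α β X (s * μ.act α c) (1 ⊗ₜ r) t := by
  refine LinearMap.congr_fun (linearMap_ext₂ (f := act₂ μ α β X s (c ⊗ₜ r))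
    (g := act₂ μ α β X (s * μ.act α c) (1 ⊗ₜ r)) fun θ η x => ?_) t
  have h : (c ⊗ₜ[k₀] r : M.base k β) • tmul η x =
      c • (((1 : k) ⊗ₜ[k₀] r : M.base k β) • tmul η x) := by
    rw [← smul_assoc, TensorProduct.smul_tmul', smul_eq_mul, mul_one]
  rw [act₂_tmul, act₂_tmul, mul_comm s, mul_smul, ← smul_comm s, ← base_smul_tmul s,
    ← base_smul_tmul s, act_smul_tmul, ← base_smul_tmul, h, ← base_smul_tmul]

end TauV

namespace MGroup
open RepCat
variable {μ : MAction M k} (G : MGroup μ) (α β : M.I)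

theorem rTensor_mul_twist_coeffAct {X : Type u} [AddCommGroup X] [Module k X] (θ : CoE μ α)
    (η : CoE μ β) (x : X) (p : G.A ⊗[k₀] M.E β) :
    LinearMap.rTensor G.A TauV.mul (G.twist α θ (coeffAct G.A (TauV.tmul η x) p)) =
    TauV.coeffMul μ α β G.A x (conv (μ.act α) (CoE.toDual η) (CoE.toDual θ))
      (swapAssoc k₀ (M.E β) (M.E α) G.A
        (Algebra.TensorProduct.map (G.s.act α) (AlgHom.id k₀ (M.E β)) p)) := by
  induction p with
  | zero => simp
  | add p q hp hq => simp only [map_add, hp, hq]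
  | tmul b d =>
    rw [coeffAct_tmul, twist_tmul, TauV.base_smul_tmul, TauV.rTensor_mul_coeffAct,
      Algebra.TensorProduct.map_tmul, AlgHom.id_apply]

/-- This is the equivariance of `mul`. On a coefficient `a` it is the law `act_mul` for the action
of `M₀` on `G`: twisting by `β` and then by `α` is twisting once along the product. -/
theorem twist_mul {X : Type u} [AddCommGroup X] [Module k X] (θ : CoE μ α) (η : CoE μ β)
    (t : X ⊗[k] G.A) :
    G.twist (M.mulIdx β α) (CoE.mk ((M.baseMul k β α).toLinearMap.dualMap
      (conv (μ.act α) (CoE.toDual η) (CoE.toDual θ)))) t =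
    LinearMap.rTensor G.A TauV.mul (G.twist α θ (G.twist β η t)) := by
  induction t with
  | zero => simp
  | add s t hs ht => simp only [map_add, hs, ht]
  | tmul x a =>
    rw [twist_tmul, twist_tmul, rTensor_mul_twist_coeffAct]
    refine (TauV.coeffAct_tmulMul x _ _).trans ?_
    exact congrArg _ (DFunLike.congr_fun (G.s.act_mul β α) a)

/-- The map `τ_α τ_β(X) → τ_γ(X)` of representations, for `m : E_γ → E_β ⊗ E_α`. -/
noncomputable def tauMul (X : RepCat k G.A) :
    G.tauObj α (G.tauObj β X) ⟶ G.tauObj (M.mulIdx β α) X :=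
  ofLin (X := G.tauObj α (G.tauObj β X)) (Y := G.tauObj (M.mulIdx β α) X) TauV.mul
    (TauV.linearMap_ext₂ fun θ η x => G.twist_mul α β θ η (X.ρ x))

theorem sq_smul_tmul (X : RepCat k G.A) (c : k) (r : M.E β) (s : M.E α)
    (t : TauV μ α (TauV μ β X.V)) :
    lin ((Plng.sq G.tauP G.isLinearOver α β X).smul (c ⊗ₜ (r ⊗ₜ s))) t =
      TauV.act₂ μ α β X.V (c ⊗ₜ s) (1 ⊗ₜ r) t := by
  have h : (c ⊗ₜ[k₀] s : M.base k α) • TauV.map (Algebra.lsmul k k (TauV μ β X.V)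
      ((1 : k) ⊗ₜ[k₀] r : M.base k β)) t = c • TauV.map (Algebra.lsmul k k (TauV μ β X.V)
      ((1 : k) ⊗ₜ[k₀] r : M.base k β)) (((1 : k) ⊗ₜ[k₀] s : M.base k α) • t) := by
    rw [map_smul, ← smul_assoc, TensorProduct.smul_tmul', smul_eq_mul, mul_one]
  refine Eq.trans ?_ h.symm
  have h' : (Plng.sq G.tauP G.isLinearOver α β X).smul (c ⊗ₜ (r ⊗ₜ s)) =
      ((G.tauMod α (G.tauObj β X)).smul (1 ⊗ₜ s) ≫
        G.tauMap α ((G.tauMod β X).smul (1 ⊗ₜ r))) ≫ (c • 𝟙 (G.tauObj α (G.tauObj β X))) := rfl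
  rw [h']
  rfl

/-- The prescribed action on `τ_α τ_β(X)` is described on tensors `c ⊗ (r ⊗ s)`. Rewritten on the
generators `inS s * inR e`, it becomes two commuting operators, to which the coordinate formulas
apply. -/
theorem sq_smul (X : RepCat k G.A) (s : k ⊗[k₀] M.E α) (e : k ⊗[k₀] M.E β)
    (t : TauV μ α (TauV μ β X.V)) :
    lin ((Plng.sq G.tauP G.isLinearOver α β X).smul (inS k₀ k _ _ s * inR (M.E β) (μ.act α) e)) t =
      TauV.act₂ μ α β X.V s e t := by
  let Y := Plng.sq G.tauP G.isLinearOver α β X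
  have h₁ : ∀ (q : k ⊗[k₀] M.E α) (r : M.E β), lin (Y.smul (inS k₀ k _ _ q * (1 ⊗ₜ (r ⊗ₜ 1)))) t =
      TauV.act₂ μ α β X.V q (1 ⊗ₜ r) t := fun q r => by
    induction q with
    | zero =>
      rw [map_zero, zero_mul, TauV.act₂_zero_left]
      exact LinearMap.congr_fun (congrArg lin (map_zero Y.act)) t
    | add p q hp hq =>
      rw [map_add, add_mul, TauV.act₂_add_left, ← hp, ← hq]
      exact smul_add' Y _ _ t
    | tmul c s =>
      rw [Algebra.TensorProduct.map_tmul, Algebra.TensorProduct.tmul_mul_tmul,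
        Algebra.TensorProduct.includeRight_apply, Algebra.TensorProduct.tmul_mul_tmul, one_mul,
        mul_one, mul_one, AlgHom.id_apply]
      exact G.sq_smul_tmul α β X c r s t
  induction e with
  | zero =>
    rw [map_zero, mul_zero, TauV.act₂_zero_right]
    exact LinearMap.congr_fun (congrArg lin (map_zero Y.act)) t
  | add p q hp hq =>
    rw [map_add, mul_add, TauV.act₂_add_right, ← hp, ← hq]
    exact smul_add' Y _ _ t
  | tmul c r =>
    rw [inR_tmul, ← mul_assoc, ← map_mul, TauV.act₂_tmul_right]
    exact h₁ _ r

theorem mul_sq_smul_tmul (X : RepCat k G.A) (w : k ⊗[k₀] (M.E β ⊗[k₀] M.E α)) (θ : CoE μ α)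
    (η : CoE μ β) (x : X.V) :
    TauV.mul (lin ((Plng.sq G.tauP G.isLinearOver α β X).smul w) (TauV.tmul θ (TauV.tmul η x))) =
      TauV.tmulMul μ α β x (mulDual k w (conv (μ.act α) (CoE.toDual η) (CoE.toDual θ))) := by
  let Y := Plng.sq G.tauP G.isLinearOver α β X
  let ψ := conv (μ.act α) (CoE.toDual η) (CoE.toDual θ)
  let O : (k ⊗[k₀] (M.E β ⊗[k₀] M.E α)) →ₗ[k] TauV μ α (TauV μ β X.V) :=
    orbit Y (TauV.tmul θ (TauV.tmul η x))
  let P : (k ⊗[k₀] (M.E β ⊗[k₀] M.E α)) →ₗ[k] TauV μ (M.mulIdx β α) X.V :=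
    TauV.tmulMul μ α β x ∘ₗ (LinearMap.mul k _).compr₂ ψ
  change TauV.mul (O w) = P w
  induction w using conv_induction (μ.act α) with
  | zero => simp only [map_zero]
  | add v w hv hw => simp only [map_add, hv, hw]
  | mul s e => exact (congrArg TauV.mul (G.sq_smul α β X s e _)).trans (TauV.mul_act₂_tmul s e θ η x)

/-- By `contractDual_mul_act₂`, the functionals in the criterion, evaluated at `inS s * inR e`, are
the coordinates of `t`; and `E_β ⊗ E_α` is spanned over `E_α` by the images of a basis of `E_β`. -/
theorem isCartesian_tauMul (X : RepCat k G.A) : EMod.IsCartesian (M.baseMul k β α)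
    (Plng.sq G.tauP G.isLinearOver α β X) (G.tauMod (M.mulIdx β α) X) (G.tauMul α β X) := by
  let Y := Plng.sq G.tauP G.isLinearOver α β X
  let b := Module.finBasis k X.V
  let c := Module.finBasis k (M.base k β)
  have h : ∀ φ s e (t : TauV μ α (TauV μ β X.V)), TauV.contractDual φ (TauV.mul
      (lin (Y.smul (inS k₀ k _ _ s * inR (M.E β) (μ.act α) e)) t)) 1 =
      TauV.contractDual (TauV.evalDual φ e) t s := fun φ s e t =>
    (congrArg (fun t => TauV.contractDual φ (TauV.mul t) 1) (G.sq_smul α β X s e t)).trans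
      (TauV.contractDual_mul_act₂ φ s e t)
  refine G.isCartesian_tau _ Y X (G.tauMul α β X)
    (fun e => hom_ext (TauV.linearMap_ext₂ fun θ η x => ?_)) b
    (fun y hy => TauV.eq_zero_of_evalDual b y fun i e s => (h _ s e y).symm.trans (hy i _))
    fun Θ => ?_
  · exact (G.mul_sq_smul_tmul α β X _ θ η x).trans (TauV.base_smul_tmulMul e x _).symm
  -- The coordinate `(i, j)` of `t` is prescribed to be `s ↦ Θ i (inS s * inR (c j))`; these
  -- products determine `Θ i`.
  · obtain ⟨t, ht⟩ := TauV.exists_evalDual (μ := μ) b c fun i j =>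
      Θ i ∘ₗ LinearMap.mulRight k (inR (M.E β) (μ.act α) (c j)) ∘ₗ
        (inS k₀ k (M.E β) (M.E α)).toLinearMap
    let O : (k ⊗[k₀] (M.E β ⊗[k₀] M.E α)) →ₗ[k] TauV μ α (TauV μ β X.V) := orbit Y t
    have key : ∀ i w, TauV.contractDual (b.coord i) (TauV.mul (O w)) 1 = Θ i w := by
      intro i w
      induction w using conv_induction_basis (μ.act α) c with
      | zero => simp only [map_zero, LinearMap.zero_apply]
      | add v w hv hw => simp only [map_add, LinearMap.add_apply, hv, hw]
      | mul s j => exact (h _ s _ t).trans (ht i j s)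
    exact ⟨t, key⟩

end MGroup
end Tau

/-! ### Assembly of the $E_0$-structure. -/

namespace MGroup
open RepCat
variable {k₀ : Type u} [CommRing k₀] {k : Type u} [Field k] [Algebra k₀ k]
  {M : FormalMonoid k₀} {μ : MAction M k} (G : MGroup μ)

/-- The `E₀`-structure on the category of representations. -/
noncomputable def e₀Structure : E₀Structure k (RepCat k G.A) M where
  τ := G.tauP
  linear := G.isLinearOver
  exact := G.exact_tau
  tensor := G.tauTensor
  a :=
    { app := G.tauUnit
      naturality := fun _ _ _ => hom_ext (LinearMap.ext fun _ => rfl) }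
  a_cartesian := G.isCartesian_tauUnit
  a_tensor _ _ := hom_ext (LinearMap.ext fun s => TauV.δ_ofUnit s)
  a_unit := hom_ext (LinearMap.ext fun c : k => TauV.ε_ofUnit (μ := μ) c)
  b α β :=
    { app := G.tauMul α β
      naturality := fun _ _ _ => hom_ext (TauV.linearMap_ext₂ fun _ _ _ => rfl) }
  b_cartesian := G.isCartesian_tauMul
  b_tr f g u v h _ := hom_ext (LinearMap.ext fun t => TauV.res_mul_res f g u v h t)
  b_tensor _ _ _ _ := hom_ext (LinearMap.ext fun t => TauV.δ_mul t)
  b_unit _ _ := hom_ext (TauV.linearMap_ext₂ TauV.ε_mul_tmul)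

end MGroup
end OpTensor

theorem mainTheorem4 {k₀ k : Type u} [CommRing k₀] [IsNoetherianRing k₀] [Field k] [Algebra k₀ k]
    (M : OpTensor.FormalMonoid k₀) (μ : OpTensor.MAction M k) (G : OpTensor.MGroup μ) :
    OpTensor.IsTensorCategory k (OpTensor.RepCat k G.A) ∧
      ∃ S : OpTensor.E₀Structure k (OpTensor.RepCat k G.A) M,
        Nonempty (S.τ ⋙ ObjectProperty.ι _ ≅ G.tau) :=
  -- The functor of the structure is the lift of `G.tau` to the full subcategory, so forgetting the
  -- property returns `G.tau` definitionally.
  ⟨OpTensor.RepCat.isTensorCategory, G.e₀Structure, ⟨Iso.refl _⟩⟩
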